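/- **Setting.** Let $d\ge 1$, $\ell=(l_1,\dots,l_d)\in(0,\infty]^d$ and $Q^\ell=\prod_{i=1}^d(-l_i,l_i)\subseteq\mathbb R^d$; write $\mathbb 1=(1,\dots,1)$. For $N\in\{0,1,2,\dots\}\cup\{\infty\}$ and $\varepsilon_0>0$, a function $g\in C^{N+2}(Q^\ell)$ is called *elliptic over $Q^\ell$ with parameters $N,\varepsilon_0$* if $D^2g$ is positive definite on $Q^\ell$ and $g(\xi)=|\xi|^2+h(\xi)$ with $h(0)=0$, $\nabla h(0)=0$, $D^2h(0)=0$, and $$\big\|\xi\mapsto D^2h(\tilde l_1\xi_1,\dots,\tilde l_d\xi_d)\big\|_{C^N(Q^{\mathbb 1})}<\varepsilon_0\qquad\text{whenever }\tilde\ell\in(0,\infty)^d,\ Q^{\tilde\ell}\subseteq Q^\ell,$$ where $\|F\|_{C^N(U)}=\sup_{|\gamma|\le N}\sup_U|\partial^\gamma F|$ and matrices carry the spectral norm. Put $$\mathcal E^\ell_g f(t,x)=\int_{Q^\ell}e^{i(t g(\xi)+x\cdot\xi)}f(\xi)\,d\xi,\qquad (t,x)\in\mathbb R^{1+d},\ f\in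 L^1(Q^\ell).$$ For $1\le p,q\le\infty$ let $\|\mathcal E^\ell_g\|_{L^p\to L^q}\in[0,\infty]$ be the supremum of $\|\mathcal E^\ell_gf\|_{L^q(\mathbb R^{1+d})}/\|f\|_{L^p(Q^\ell)}$ over nonzero $f\in L^1\cap L^p(Q^\ell)$, and let $$\|\mathcal E^\ell_g\|^{\rm RWT}_{L^p\to L^q}=\sup\frac{|\langle\mathcal E^\ell_gf_E,u_F\rangle|}{|E|^{1/p}|F|^{1/q'}},$$ the supremum over measurable sets $E\subseteq\mathbb R^d$, $F\subseteq\mathbb R^{1+d}$ of positive finite measure and measurable functions $|f_E|\le\chi_E$, $|u_F|\le\chi_F$. Primes denote conjugate exponents. **Theorem.** Let $d\ge1$ and $1\le p,q\le\infty$. There are a constant $c>0$ and a function $\alpha\ge c$ on $[0,\infty]$ with $\alpha(r)\to\infty=\alpha(\infty)$ as $r\to\infty$, both depending only on $d,p,q$, such that the following holds for every $\ell\in(0,\infty]^d$ with $l_1\le\dots\le l_d$ and every $g$ elliptic over $Q^\ell$ with parameters $N\ge2$ and $0<\varepsilon_0<1$. 1. If $q<\frac{d+2}d\,p'$ or $q\le\frac{2(d+1)}d$,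 then $\mathcal E^\ell_g$ does not extend from $L^1\cap L^p(Q^\ell)$ to a bounded linear operator $L^p(Q^\ell)\to L^q(\mathbb R^{1+d})$; moreover $\|\mathcal E^\ell_g\|_{L^p\to L^q}=\|\mathcal E^\ell_g\|^{\rm RWT}_{L^p\to L^q}=\infty$. 2. If $l_k=\infty$ for some $1\le k\le d$, the same conclusions hold whenever $p\ge q$, and whenever $q>\frac{d-k+3}{d-k+1}\,p'$. 3. The following lower bounds hold both for $K=\|\mathcal E^\ell_g\|_{L^p\to L^q}$ and for $K=\|\mathcal E^\ell_g\|^{\rm RWT}_{L^p\to L^q}$. * If $q>p$ and $q=\frac{d-j-\theta+2}{d-j-\theta}\,p'$ for some integer $0\le j<d$ and $0\le\theta\le1$, then $$K\ \ge\ c\,\big(l_1\cdots l_j\,l_{j+1}^{\theta}\big)^{\frac1{p'}-\frac1q}.$$ * If $q=\frac{2(d-j-\theta+1)}{d-j-\theta}\le p$ for some integer $0\le j\le d-2$ and $0<\theta\le1$, then $$K\ \ge\ (l_1\cdots l_d)^{\frac1q-\frac1p}\,\alpha\!\Big(\frac{l_d}{l_{j+1}}\Big)\big(l_1\cdots l_j\,l_{j+1}^\theta\big)^{1-\frac2q}.$$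 * If $q>4$ and $p\ge(\frac q3)'$, then $$K\ \ge\ c\,(l_1\cdots l_{d-1})^{\frac1{p'}-\frac1q}\,l_d^{\,1-\frac3q-\frac1p}.$$ Here $\frac20=\infty$ (so $j=d-1$, $\theta=1$ in the first bound means $q=\infty$), $\infty^0=1$, and $\alpha(\infty/\infty)$ is read as $\alpha(0)$ (the right-hand side is then $\infty$). -/

import Mathlib

open MeasureTheory Filter Topology
open scoped ENNReal NNReal

noncomputable section

namespace RestrictionAboveRectangles

/-- The frequency space `ℝ^d` with its Euclidean norm and Lebesgue measure. -/
abbrev Freq (d : ℕ) : Type := EuclideanSpace ℝ (Fin d)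

/-- The open rectangle `Q^ℓ = ∏ (-l_i, l_i)`, for `ℓ ∈ [0, ∞]^d`. -/
def rectangle {d : ℕ} (ℓ : Fin d → ℝ≥0∞) : Set (Freq d) :=
  {ξ | ∀ i, ‖ξ i‖ₑ < ℓ i}

/-- The diagonal dilation `A^m (ξ) = (m_1 ξ_1, …, m_d ξ_d)`. -/
def dilation {d : ℕ} (m : Fin d → ℝ) (ξ : Freq d) : Freq d :=
  WithLp.toLp 2 (fun i => m i * ξ i)

/-- The second derivative `D²u(ξ)`, as a bilinear form on `ℝ^d`; its norm is the spectral norm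
of the Hessian matrix. -/
def hessian {d : ℕ} (u : Freq d → ℝ) (ξ : Freq d) : Freq d →L[ℝ] Freq d →L[ℝ] ℝ :=
  fderiv ℝ (fderiv ℝ u) ξ

/-- The norm of `C^N(U)`: the largest supremum over `U` of an iterated coordinate partial
derivative `∂_{s_1} ⋯ ∂_{s_n} F` of order `n ≤ N` (all finite orders `n` if `N = ∞`). -/
def cNorm {d : ℕ} {V : Type*} [NormedAddCommGroup V] [NormedSpace ℝ V]
    (N : ℕ∞) (F : Freq d → V) (U : Set (Freq d)) : ℝ≥0∞ :=
  ⨆ (n : ℕ) (_ : (n : ℕ∞) ≤ N) (s : Fin n → Fin d) (ξ ∈ U),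
    ‖iteratedFDeriv ℝ n F ξ (fun i => EuclideanSpace.single (s i) (1 : ℝ))‖ₑ

/-- The perturbation `h` in `g(ξ) = |ξ|² + h(ξ)`. -/
def perturbation {d : ℕ} (g : Freq d → ℝ) (ξ : Freq d) : ℝ := g ξ - ‖ξ‖ ^ 2

/-- `g` is elliptic over `Q^ℓ` with parameters `N, ε₀`. Only the values of `g` on the open set
`Q^ℓ` matter. -/
structure IsElliptic {d : ℕ} (N : ℕ∞) (ε₀ : ℝ) (ℓ : Fin d → ℝ≥0∞) (g : Freq d → ℝ) : Prop where
  contDiffOn : ContDiffOn ℝ ((N + 2 : ℕ∞) : WithTop ℕ∞) g (rectangle ℓ)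
  hessian_pos : ∀ ξ ∈ rectangle ℓ, ∀ v : Freq d, v ≠ 0 → 0 < hessian g ξ v v
  value_zero : perturbation g 0 = 0
  gradient_zero : fderiv ℝ (perturbation g) 0 = 0
  hessian_zero : hessian (perturbation g) 0 = 0
  bound : ∀ m : Fin d → ℝ, (∀ i, 0 < m i) →
    rectangle (fun i => ENNReal.ofReal (m i)) ⊆ rectangle ℓ →
    cNorm N (fun ξ => hessian (perturbation g) (dilation m ξ)) (rectangle (fun _ => 1))
      < ENNReal.ofReal ε₀

/-- The extension operator
`E f (t, x) = ∫_{Q^ℓ} exp(i (t g(ξ) + x · ξ)) f(ξ) dξ`, for `f` integrable over `Q^ℓ`. -/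
def extOp {d : ℕ} (ℓ : Fin d → ℝ≥0∞) (g : Freq d → ℝ) (f : Freq d → ℂ) (z : ℝ × Freq d) : ℂ :=
  ∫ ξ in rectangle ℓ,
    Complex.exp (Complex.I * ((z.1 * g ξ + inner ℝ z.2 ξ : ℝ) : ℂ)) * f ξ

/-- The operator norm of `E` from `L^p(Q^ℓ)` to `L^q(ℝ^{1+d})`, in `[0, ∞]`: the supremum of
`‖E f‖_q / ‖f‖_p` over `f ∈ L¹ ∩ L^p` (here `0 / 0 = 0`). -/
def strongNorm {d : ℕ} (ℓ : Fin d → ℝ≥0∞) (g : Freq d → ℝ) (p q : ℝ≥0∞) : ℝ≥0∞ :=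
  ⨆ (f : Freq d → ℂ) (_ : MemLp f p (volume.restrict (rectangle ℓ)))
    (_ : IntegrableOn f (rectangle ℓ)),
    eLpNorm (extOp ℓ g f) q volume / eLpNorm f p (volume.restrict (rectangle ℓ))

/-- `E`, initially defined on `L¹ ∩ L^p(Q^ℓ)`, extends to a bounded linear operator from
`L^p(Q^ℓ)` to `L^q(ℝ^{1+d})`. -/
def ExtendsBoundedly {d : ℕ} (ℓ : Fin d → ℝ≥0∞) (g : Freq d → ℝ) (p q : ℝ≥0∞)
    [Fact (1 ≤ p)] [Fact (1 ≤ q)] : Prop :=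
  ∃ T : Lp ℂ p ((volume : Measure (Freq d)).restrict (rectangle ℓ)) →L[ℂ]
      Lp ℂ q (volume : Measure (ℝ × Freq d)),
    ∀ (f : Freq d → ℂ) (hf : MemLp f p (volume.restrict (rectangle ℓ))),
      IntegrableOn f (rectangle ℓ) → T (hf.toLp f) =ᵐ[volume] extOp ℓ g f

/-- The restricted weak type norm of `E`: the supremum of
`|⟨E f_A, u_B⟩| / (|A|^{1/p} |B|^{1/q'})` over measurable sets `A`, `B` of positive finite measure
and measurable functions with `|f_A| ≤ χ_A`, `|u_B| ≤ χ_B`. -/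
def rwtNorm {d : ℕ} (ℓ : Fin d → ℝ≥0∞) (g : Freq d → ℝ) (p q : ℝ≥0∞) : ℝ≥0∞ :=
  ⨆ (A : Set (Freq d)) (B : Set (ℝ × Freq d)) (f : Freq d → ℂ) (u : ℝ × Freq d → ℂ)
    (_ : MeasurableSet A ∧ 0 < volume A ∧ volume A < ∞)
    (_ : MeasurableSet B ∧ 0 < volume B ∧ volume B < ∞)
    (_ : Measurable f ∧ ∀ ξ, ‖f ξ‖ ≤ A.indicator (fun _ => (1 : ℝ)) ξ)
    (_ : Measurable u ∧ ∀ z, ‖u z‖ ≤ B.indicator (fun _ => (1 : ℝ)) z),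
    ‖∫ z, extOp ℓ g f z * (starRingEnd ℂ) (u z)‖ₑ /
      (volume A ^ (p⁻¹).toReal * volume B ^ (1 - (q⁻¹).toReal))

end RestrictionAboveRectangles

end

namespace RestrictionAboveRectangles

/-! Everything follows from one lower bound for the restricted weak type norm,
`IsElliptic.kakeya_lower_bound`, since this norm is dominated by the operator norm
(`rwtNorm_le_strongNorm`). Write a = 1/p and b = 1/q. In a finite box with half-sides m_i inside
Q^ℓ, tile a fixed proportion of the positive orthant by cells of sides σ_i = min(m_i, λ). The
extension of a modulated indicator of one cell has modulus at least half the cell's volume on a tube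
of duration ~ λ⁻² and widths ~ 1/σ_i (`IsElliptic.prod_div_two_le_norm_extOp`); the modulation
places the tube anywhere in space. Adding the packets with random signs produces, by Khinchine, the
square root of the number of tubes through each point. The norm is therefore large when the union of
the tubes is small compared with their total volume while pairwise overlaps stay moderate
(`rwtNorm_ge_of_tubes`).

Such compression is possible within a block of 2^μ consecutive cells along one axis e. Their normal
directions are nearly in arithmetic progression, and Keich's arrangement of lines makes the union
smaller than the total volume by a factor of order μ+1 (`volume_iUnion_kakeyaTube_le`), while each
tube has total overlap O(μ+1) times its own volume with the tubes of its block
(`volume_kakeyaTube_inter_le`, `sum_inv_dist_le`). Linearising the gradient over the block costs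
(2^μ λ)²/m_e, because the e-derivative of D²g is O(1/m_e); this is within the admissible error λ
exactly when 4^μ λ ≤ m_e. Distinct blocks are moved far apart. The outcome, up to a constant
depending on d, is the lower bound (μ+1)^(1/2-b) (∏ m_i)^(b-a) (∏ σ_i)^(1-2b) λ^(-2b).

The theorem consists of choices of m, λ, μ. With μ = 0 and λ the largest side this is the Knapp
example: shrinking cubes exclude q < (d+2)p'/d, growing the infinite sides gives the second
condition of part 2, cutting all later sides down to l_{j+1} gives the first quantitative bound, and
the whole box gives the third. A fixed cube with λ ~ 4^(-μ) excludes q ≤ 2(d+1)/d, the factor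
(μ+1)^(1/2-b) deciding the endpoint; one side stretched to 4^μ excludes p ≥ q; and λ = l_{j+1} with
4^μ ≤ l_d/l_{j+1} yields the bound containing α. -/

/-- The sign `+1` on `t` and `-1` off `t`. -/
def signOn {ι : Type*} [DecidableEq ι] (t : Finset ι) (i : ι) : ℂ := if i ∈ t then 1 else -1

lemma norm_signOn {ι : Type*} [DecidableEq ι] (t : Finset ι) (i : ι) : ‖signOn t i‖ = 1 := by
  unfold signOn; split_ifs <;> simp

/-! ### Khinchine's inequality from second and fourth moments -/

section Khinchine

variable {ι : Type*} [DecidableEq ι] (a : ι → ℂ)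

lemma sum_signOn_insert {s : Finset ι} {i : ι} (hi : i ∉ s) {t : Finset ι} (ht : t ⊆ s) :
    ∑ k ∈ insert i s, signOn t k * a k = ∑ k ∈ s, signOn t k * a k - a i ∧
    ∑ k ∈ insert i s, signOn (insert i t) k * a k = ∑ k ∈ s, signOn t k * a k + a i := by
  have hit : i ∉ t := fun h => hi (ht h)
  refine ⟨?_, ?_⟩
  · rw [Finset.sum_insert hi]
    simp [signOn, hit]; ring
  · rw [Finset.sum_insert hi, add_comm]
    congr 1
    · refine Finset.sum_congr rfl fun k hk => ?_
      have : k ≠ i := fun h => hi (h ▸ hk)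
      simp [signOn, this]
    · simp [signOn]

/-- Orthogonality of the signs: the parallelogram law disposes of one sign at a time. -/
lemma sum_sq_signs (s : Finset ι) :
    ∑ t ∈ s.powerset, ‖∑ k ∈ s, signOn t k * a k‖ ^ 2 = 2 ^ s.card * ∑ k ∈ s, ‖a k‖ ^ 2 := by
  induction s using Finset.induction_on with
  | empty => simp
  | insert i s hi ih =>
    rw [Finset.sum_powerset_insert hi, ← Finset.sum_add_distrib]
    have : ∀ t ∈ s.powerset, ‖∑ k ∈ insert i s, signOn t k * a k‖ ^ 2 +
        ‖∑ k ∈ insert i s, signOn (insert i t) k * a k‖ ^ 2 =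
        2 * ‖∑ k ∈ s, signOn t k * a k‖ ^ 2 + 2 * ‖a i‖ ^ 2 := by
      intro t ht
      obtain ⟨h1, h2⟩ := sum_signOn_insert a hi (Finset.mem_powerset.1 ht)
      rw [h1, h2]
      linarith [parallelogram_law_with_norm ℝ (∑ k ∈ s, signOn t k * a k) (a i)]
    rw [Finset.sum_congr rfl this, Finset.sum_add_distrib, ← Finset.mul_sum, ih,
      Finset.sum_insert hi, Finset.card_insert_of_notMem hi]
    simp [Finset.card_powerset]
    ring

/-- The squares of the two norms have sum 2(|x|² + |y|²) and difference at most 4|x||y| in modulus;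
the sum of fourth powers is half the sum of the squares of these two quantities. -/
lemma norm_add_pow_four_add_norm_sub_pow_four_le (x y : ℂ) :
    ‖x - y‖ ^ 4 + ‖x + y‖ ^ 4 ≤ 2 * ‖x‖ ^ 4 + 12 * ‖x‖ ^ 2 * ‖y‖ ^ 2 + 2 * ‖y‖ ^ 4 := by
  have h := parallelogram_law_with_norm ℝ x y
  have h1 : ‖x + y‖ ^ 2 ≤ (‖x‖ + ‖y‖) ^ 2 := by gcongr; exact norm_add_le x y
  have h2 : ‖x - y‖ ^ 2 ≤ (‖x‖ + ‖y‖) ^ 2 := by gcongr; exact norm_sub_le x y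
  have h3 : |‖x + y‖ ^ 2 - ‖x - y‖ ^ 2| ≤ 4 * (‖x‖ * ‖y‖) := by
    rw [abs_le]; constructor <;> nlinarith
  have h4 := sq_le_sq' (abs_le.1 h3).1 (abs_le.1 h3).2
  have h5 : (‖x + y‖ ^ 2 + ‖x - y‖ ^ 2) ^ 2 = (2 * (‖x‖ ^ 2 + ‖y‖ ^ 2)) ^ 2 := by rw [h]
  nlinarith

/-- With the factor 3 the induction closes: the cross terms, 12 times the product of the new square
and the old sum, then agree on both sides. -/
lemma sum_pow_four_signs_le (s : Finset ι) :
    ∑ t ∈ s.powerset, ‖∑ k ∈ s, signOn t k * a k‖ ^ 4 ≤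
      3 * 2 ^ s.card * (∑ k ∈ s, ‖a k‖ ^ 2) ^ 2 := by
  induction s using Finset.induction_on with
  | empty => simp
  | insert i s hi ih =>
    rw [Finset.sum_powerset_insert hi, ← Finset.sum_add_distrib]
    have : ∀ t ∈ s.powerset, ‖∑ k ∈ insert i s, signOn t k * a k‖ ^ 4 +
        ‖∑ k ∈ insert i s, signOn (insert i t) k * a k‖ ^ 4 ≤
        2 * ‖∑ k ∈ s, signOn t k * a k‖ ^ 4 +
        12 * ‖a i‖ ^ 2 * ‖∑ k ∈ s, signOn t k * a k‖ ^ 2 + 2 * ‖a i‖ ^ 4 := by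
      intro t ht
      obtain ⟨h1, h2⟩ := sum_signOn_insert a hi (Finset.mem_powerset.1 ht)
      rw [h1, h2]
      linarith [norm_add_pow_four_add_norm_sub_pow_four_le (∑ k ∈ s, signOn t k * a k) (a i)]
    refine (Finset.sum_le_sum this).trans ?_
    rw [Finset.sum_add_distrib, Finset.sum_add_distrib, ← Finset.mul_sum, ← Finset.mul_sum,
      sum_sq_signs, Finset.sum_insert hi, Finset.card_insert_of_notMem hi, Finset.sum_const,
      Finset.card_powerset, nsmul_eq_mul, pow_succ (2 : ℝ)]
    push_cast
    have h2 : (0 : ℝ) ≤ 2 ^ s.card * ‖a i‖ ^ 4 := by positivity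
    nlinarith

/-- With y = z² the difference is z (z - 1)² (z + 2) / 2. This minorant turns bounds on second and
fourth moments into a lower bound on a first moment. -/
lemma sqrt_ge_quadratic {y : ℝ} (hy : 0 ≤ y) : 3 / 2 * y - y ^ 2 / 2 ≤ √y := by
  have hz := Real.sqrt_nonneg y
  set z := √y
  have : y = z ^ 2 := (Real.sq_sqrt hy).symm
  rw [this]
  nlinarith [mul_nonneg (mul_nonneg hz (sq_nonneg (z - 1))) (by linarith : 0 ≤ z + 2)]

/-- Khinchine's inequality, lower bound for the first moment. -/
lemma khinchine (s : Finset ι) :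
    2 ^ s.card * (√(∑ k ∈ s, ‖a k‖ ^ 2) / 2) ≤
      ∑ t ∈ s.powerset, ‖∑ k ∈ s, signOn t k * a k‖ := by
  set A := ∑ k ∈ s, ‖a k‖ ^ 2 with hA
  have hA0 : 0 ≤ A := Finset.sum_nonneg fun _ _ => by positivity
  rcases hA0.eq_or_lt with h | h
  · rw [← h]; simp; exact Finset.sum_nonneg fun _ _ => norm_nonneg _
  -- Normalising by 4A gives the quadratic minorant mean at least 3/8 - 3/32 = 9/32, hence a first
  -- moment at least (9/16)√A, which exceeds √A/2.
  have key : ∀ x : ℝ, 0 ≤ x →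
      2 * √A * (3 / 2 * (x ^ 2 / (4 * A)) - (x ^ 2 / (4 * A)) ^ 2 / 2) ≤ x := by
    intro x hx
    have h1 := sqrt_ge_quadratic (y := x ^ 2 / (4 * A)) (by positivity)
    have h2 : √(x ^ 2 / (4 * A)) = x / (2 * √A) := by
      rw [Real.sqrt_div (sq_nonneg x), Real.sqrt_sq hx, Real.sqrt_mul (by norm_num)]
      congr 2
      rw [show (4 : ℝ) = 2 ^ 2 by norm_num, Real.sqrt_sq (by norm_num)]
    rw [h2] at h1
    have h3 : 0 < 2 * √A := by positivity
    calc _ ≤ 2 * √A * (x / (2 * √A)) := by gcongr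
      _ = x := by field_simp
  refine le_trans ?_ (Finset.sum_le_sum fun t _ => key _ (norm_nonneg _))
  rw [← Finset.mul_sum, Finset.sum_sub_distrib, ← Finset.mul_sum, ← Finset.sum_div,
    ← Finset.sum_div, sum_sq_signs, ← hA]
  have h4 : ∑ t ∈ s.powerset, (‖∑ k ∈ s, signOn t k * a k‖ ^ 2 / (4 * A)) ^ 2 ≤
      3 * 2 ^ s.card / 16 := by
    have : ∀ t ∈ s.powerset, (‖∑ k ∈ s, signOn t k * a k‖ ^ 2 / (4 * A)) ^ 2 =
      ‖∑ k ∈ s, signOn t k * a k‖ ^ 4 / (16 * A ^ 2) := by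
      intro t _; rw [div_pow]; ring
    rw [Finset.sum_congr rfl this, ← Finset.sum_div, div_le_iff₀ (by positivity)]
    refine (sum_pow_four_signs_le a s).trans (le_of_eq ?_)
    rw [← hA]; ring
  have h5 : (2 : ℝ) ^ s.card * A / (4 * A) = 2 ^ s.card / 4 := by field_simp
  rw [h5]
  have h6 : 0 < √A := by positivity
  have h7 : (0 : ℝ) < 2 ^ s.card := by positivity
  calc (2 : ℝ) ^ s.card * (√A / 2)
    _ ≤ 2 * √A * (3 / 2 * (2 ^ s.card / 4) - 3 * 2 ^ s.card / 16 / 2) := by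
        nlinarith [mul_pos h6 h7]
    _ ≤ _ := by gcongr

end Khinchine

/-! ### Basic properties of the extension operator and comparison of its norms -/

section Operator

variable {d : ℕ} {ℓ : Fin d → ℝ≥0∞} {g : Freq d → ℝ}

lemma isOpen_rectangle (ℓ : Fin d → ℝ≥0∞) : IsOpen (rectangle ℓ) := by
  simp only [rectangle, Set.ofPred_forall]
  refine isOpen_iInter_of_finite fun i => isOpen_lt ?_ continuous_const
  exact (EuclideanSpace.proj (𝕜 := ℝ) i).continuous.enorm

lemma aestronglyMeasurable_extOp_integrand (hg : ContinuousOn g (rectangle ℓ)) {f : Freq d → ℂ}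
    (hf : AEStronglyMeasurable f (volume.restrict (rectangle ℓ))) (z : ℝ × Freq d) :
    AEStronglyMeasurable (fun ξ => Complex.exp (Complex.I * ((z.1 * g ξ + inner ℝ z.2 ξ : ℝ) : ℂ))
      * f ξ) (volume.restrict (rectangle ℓ)) := by
  refine AEStronglyMeasurable.mul ?_ hf
  refine ContinuousOn.aestronglyMeasurable ?_ (isOpen_rectangle ℓ).measurableSet
  have : ContinuousOn (fun ξ => z.1 * g ξ + inner ℝ z.2 ξ) (rectangle ℓ) :=
    (continuousOn_const.mul hg).add (by fun_prop)
  fun_prop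

lemma norm_extOp_integrand (f : Freq d → ℂ) (z : ℝ × Freq d) (ξ : Freq d) :
    ‖Complex.exp (Complex.I * ((z.1 * g ξ + inner ℝ z.2 ξ : ℝ) : ℂ)) * f ξ‖ = ‖f ξ‖ := by
  rw [norm_mul, mul_comm Complex.I, Complex.norm_exp_ofReal_mul_I, one_mul]

lemma integrable_extOp_integrand (hg : ContinuousOn g (rectangle ℓ)) {f : Freq d → ℂ}
    (hf : IntegrableOn f (rectangle ℓ)) (z : ℝ × Freq d) :
    Integrable (fun ξ => Complex.exp (Complex.I * ((z.1 * g ξ + inner ℝ z.2 ξ : ℝ) : ℂ))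
      * f ξ) (volume.restrict (rectangle ℓ)) :=
  Integrable.mono hf (aestronglyMeasurable_extOp_integrand hg hf.1 z)
    (Eventually.of_forall fun ξ => (norm_extOp_integrand f z ξ).le)

lemma continuous_extOp (hg : ContinuousOn g (rectangle ℓ)) {f : Freq d → ℂ}
    (hf : IntegrableOn f (rectangle ℓ)) : Continuous (extOp ℓ g f) := by
  refine continuous_of_dominated (bound := fun ξ => ‖f ξ‖)
    (fun z => aestronglyMeasurable_extOp_integrand hg hf.1 z)
    (fun z => Eventually.of_forall fun ξ => (norm_extOp_integrand f z ξ).le) hf.norm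
    (Eventually.of_forall fun ξ => ?_)
  fun_prop

lemma norm_extOp_le (f : Freq d → ℂ) (z : ℝ × Freq d) :
    ‖extOp ℓ g f z‖ ≤ ∫ ξ in rectangle ℓ, ‖f ξ‖ := by
  refine (norm_integral_le_integral_norm _).trans (le_of_eq ?_)
  simp_rw [norm_extOp_integrand]

lemma extOp_sum (hg : ContinuousOn g (rectangle ℓ)) {ι : Type*} (s : Finset ι) (ε : ι → ℂ)
    (f : ι → Freq d → ℂ) (hf : ∀ i ∈ s, IntegrableOn (f i) (rectangle ℓ)) (z : ℝ × Freq d) :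
    extOp ℓ g (fun ξ => ∑ i ∈ s, ε i * f i ξ) z = ∑ i ∈ s, ε i * extOp ℓ g (f i) z := by
  simp only [extOp, Finset.mul_sum]
  rw [integral_finsetSum]
  · refine Finset.sum_congr rfl fun i _ => ?_
    rw [← integral_const_mul]
    congr 1; ext ξ; ring
  · intro i hi
    refine ((integrable_extOp_integrand hg (hf i hi) z).const_mul (ε i)).congr
      (Eventually.of_forall fun ξ => ?_)
    simp only; ring

lemma integrable_of_norm_le_indicator {α : Type*} [MeasurableSpace α] {μ : Measure α}
    {A : Set α} (hA : MeasurableSet A) (hA' : μ A < ∞) {f : α → ℂ} (hf : Measurable f)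
    (h : ∀ x, ‖f x‖ ≤ A.indicator (fun _ => (1 : ℝ)) x) : Integrable f μ :=
  Integrable.mono' ((integrable_indicator_iff hA).2 (integrableOn_const hA'.ne))
    hf.aestronglyMeasurable (Eventually.of_forall h)

lemma eLpNorm_le_of_norm_le_indicator {α : Type*} [MeasurableSpace α] {μ : Measure α}
    {A : Set α} {f : α → ℂ} (p : ℝ≥0∞)
    (h : ∀ x, ‖f x‖ ≤ A.indicator (fun _ => (1 : ℝ)) x) :
    eLpNorm f p μ ≤ μ A ^ (p⁻¹).toReal := by
  refine (eLpNorm_mono_real h).trans ((eLpNorm_indicator_const_le (1 : ℝ) p).trans ?_)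
  simp [ENNReal.toReal_inv]

lemma inv_toReal_mem {p : ℝ≥0∞} (hp : 1 ≤ p) : 0 ≤ (p⁻¹).toReal ∧ (p⁻¹).toReal ≤ 1 :=
  ⟨ENNReal.toReal_nonneg, ENNReal.toReal_le_of_le_ofReal zero_le_one
    (by simpa using ENNReal.inv_le_one.2 hp)⟩

lemma inv_conjExponent_toReal {p : ℝ≥0∞} (hp : 1 ≤ p) :
    (p.conjExponent⁻¹).toReal = 1 - (p⁻¹).toReal := by
  have h : p.HolderConjugate p.conjExponent := ENNReal.HolderConjugate.conjExponent hp
  have h1 : p⁻¹ + p.conjExponent⁻¹ = 1 := ENNReal.HolderConjugate.inv_add_inv_eq_one p _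
  have h2 : p⁻¹ ≠ ∞ := fun h => by simp [h] at h1
  have h3 : p.conjExponent⁻¹ ≠ ∞ := fun h => by simp [h] at h1
  have := congrArg ENNReal.toReal h1
  rw [ENNReal.toReal_add h2 h3, ENNReal.toReal_one] at this
  linarith

/-- Hölder with exponents q and q' bounds the pairing. It allows every lower bound to be proved for
the restricted weak type norm only. -/
lemma rwtNorm_le_strongNorm (hg : ContinuousOn g (rectangle ℓ)) {p q : ℝ≥0∞}
    (hq : 1 ≤ q) : rwtNorm ℓ g p q ≤ strongNorm ℓ g p q := by
  refine iSup_le fun A => iSup_le fun B => iSup_le fun f => iSup_le fun u => iSup_le fun hA =>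
    iSup_le fun hB => iSup_le fun hf => iSup_le fun hu => ?_
  obtain ⟨hA1, hA2, hA3⟩ := hA
  obtain ⟨hB1, hB2, hB3⟩ := hB
  have hfi : Integrable f volume := integrable_of_norm_le_indicator hA1 hA3 hf.1 hf.2
  have hfp : eLpNorm f p (volume.restrict (rectangle ℓ)) ≤ volume A ^ (p⁻¹).toReal :=
    (eLpNorm_mono_measure _ Measure.restrict_le_self).trans
      (eLpNorm_le_of_norm_le_indicator p hf.2)
  have hA4 : volume A ^ (p⁻¹).toReal ≠ ∞ :=
    (ENNReal.rpow_lt_top_of_nonneg ENNReal.toReal_nonneg hA3.ne).ne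
  have hmem : MemLp f p (volume.restrict (rectangle ℓ)) :=
    ⟨hf.1.aestronglyMeasurable, hfp.trans_lt hA4.lt_top⟩
  have hcont := continuous_extOp hg hfi.integrableOn
  have hub : eLpNorm u q.conjExponent volume ≤ volume B ^ (1 - (q⁻¹).toReal) := by
    rw [← inv_conjExponent_toReal hq]
    exact eLpNorm_le_of_norm_le_indicator _ hu.2
  have hpair : ‖∫ z, extOp ℓ g f z * (starRingEnd ℂ) (u z)‖ₑ ≤
      eLpNorm (extOp ℓ g f) q volume * volume B ^ (1 - (q⁻¹).toReal) := by
    have hc : q.HolderConjugate q.conjExponent := ENNReal.HolderConjugate.conjExponent hq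
    refine (enorm_integral_le_lintegral_enorm _).trans ?_
    have hu' : AEStronglyMeasurable (fun z => (starRingEnd ℂ) (u z)) volume :=
      (Complex.continuous_conj.measurable.comp hu.1).aestronglyMeasurable
    have h1 := eLpNorm_smul_le_mul_eLpNorm (r := 1) hu'
      (hcont.aestronglyMeasurable (μ := volume))
      (p := q) (q := q.conjExponent)
    rw [eLpNorm_one_eq_lintegral_enorm] at h1
    refine h1.trans ?_
    gcongr
    refine le_trans (le_of_eq ?_) hub
    exact eLpNorm_congr_norm_ae (Eventually.of_forall fun z => by simp)
  have hB4 : volume B ^ (1 - (q⁻¹).toReal) ≠ ∞ :=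
    (ENNReal.rpow_lt_top_of_nonneg (by linarith [(inv_toReal_mem hq).2]) hB3.ne).ne
  have hB5 : volume B ^ (1 - (q⁻¹).toReal) ≠ 0 := (ENNReal.rpow_pos hB2 hB3.ne).ne'
  have hA5 : volume A ^ (p⁻¹).toReal ≠ 0 := (ENNReal.rpow_pos hA2 hA3.ne).ne'
  have hstrong : eLpNorm (extOp ℓ g f) q volume / eLpNorm f p (volume.restrict (rectangle ℓ)) ≤
      strongNorm ℓ g p q :=
    le_iSup_of_le f (le_iSup_of_le hmem (le_iSup_of_le hfi.integrableOn le_rfl))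
  refine le_trans ?_ hstrong
  calc _ ≤ (eLpNorm (extOp ℓ g f) q volume * volume B ^ (1 - (q⁻¹).toReal)) /
        (volume A ^ (p⁻¹).toReal * volume B ^ (1 - (q⁻¹).toReal)) := by gcongr
    _ = eLpNorm (extOp ℓ g f) q volume / volume A ^ (p⁻¹).toReal :=
        ENNReal.mul_div_mul_right _ _ hB5 hB4
    _ ≤ _ := by gcongr

lemma strongNorm_lt_top_of_extendsBoundedly {p q : ℝ≥0∞}
    [Fact (1 ≤ p)] [Fact (1 ≤ q)] (h : ExtendsBoundedly ℓ g p q) : strongNorm ℓ g p q < ∞ := by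
  obtain ⟨T, hT⟩ := h
  refine lt_of_le_of_lt ?_ (enorm_lt_top (x := T))
  refine iSup_le fun f => iSup_le fun hf => iSup_le fun hfi => ?_
  refine ENNReal.div_le_of_le_mul ?_
  rw [← eLpNorm_congr_ae (hT f hf hfi), ← Lp.enorm_def, ← Lp.enorm_toLp hf]
  exact T.le_opENorm _

end Operator

/-! ### Random signs: from overlapping tubes to a lower bound for the norm -/

section RandomSigns

/-- Let n be the counting function of the sets. The hypothesis says that ∫ n² ≤ M ∫ n; integrating
`sqrt_ge_quadratic` at n/M bounds ∫ √n below by (3/2 - 1/2) M^(-1/2) ∫ n. -/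
lemma lintegral_sqrt_count_ge {α ι : Type*} [MeasurableSpace α] {μ : Measure α} [Fintype ι]
    {T : ι → Set α} (hT : ∀ i, MeasurableSet (T i)) (hT' : ∀ i, μ (T i) < ∞) {M : ℝ} (hM : 0 < M)
    (h : ∑ i, ∑ j, μ (T i ∩ T j) ≤ ENNReal.ofReal M * ∑ i, μ (T i)) :
    ENNReal.ofReal (1 / √M) * ∑ i, μ (T i) ≤
      ∫⁻ z, ENNReal.ofReal √(∑ i, (T i).indicator (fun _ => (1 : ℝ)) z) ∂μ := by
  set n : α → ℝ≥0∞ := fun z => ∑ i, (T i).indicator (fun _ => (1 : ℝ≥0∞)) z with hn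
  have hnm : Measurable n :=
    Finset.measurable_sum _ fun i _ => measurable_const.indicator (hT i)
  have hnN : ∀ z, ENNReal.ofReal (∑ i, (T i).indicator (fun _ => (1 : ℝ)) z) = n z := by
    intro z
    rw [ENNReal.ofReal_sum_of_nonneg fun i _ => Set.indicator_nonneg (fun _ _ => zero_le_one) z]
    refine Finset.sum_congr rfl fun i _ => ?_
    by_cases hz : z ∈ T i <;> simp [hz]
  have h1 : ∫⁻ z, n z ∂μ = ∑ i, μ (T i) := by
    rw [lintegral_finsetSum _ fun i _ => measurable_const.indicator (hT i)]
    exact Finset.sum_congr rfl fun i _ => lintegral_indicator_one (hT i)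
  have h2 : ∫⁻ z, n z ^ 2 ∂μ = ∑ i, ∑ j, μ (T i ∩ T j) := by
    have : ∀ z, n z ^ 2 = ∑ i, ∑ j, (T i ∩ T j).indicator (fun _ => (1 : ℝ≥0∞)) z := by
      intro z
      rw [hn, sq, Finset.sum_mul_sum]
      refine Finset.sum_congr rfl fun i _ => Finset.sum_congr rfl fun j _ => ?_
      by_cases hi : z ∈ T i <;> by_cases hj : z ∈ T j <;> simp [hi, hj]
    simp_rw [this]
    have hij : ∀ i j, MeasurableSet (T i ∩ T j) := fun i j => (hT i).inter (hT j)
    rw [lintegral_finsetSum _ fun i _ => Finset.measurable_sum _ fun j _ =>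
      measurable_const.indicator (hij i j)]
    refine Finset.sum_congr rfl fun i _ => ?_
    rw [lintegral_finsetSum _ fun j _ => measurable_const.indicator (hij i j)]
    exact Finset.sum_congr rfl fun j _ => lintegral_indicator_one (hij i j)
  have hs : 0 < √M := Real.sqrt_pos.2 hM
  -- The quadratic term is moved to the right-hand side because subtraction in `ℝ≥0∞` is truncated;
  -- it is cancelled at the end, the total measure being finite.
  have key : ∀ z, ENNReal.ofReal (3 / (2 * √M)) * n z ≤
      ENNReal.ofReal (1 / (2 * M * √M)) * n z ^ 2 +
      ENNReal.ofReal √(∑ i, (T i).indicator (fun _ => (1 : ℝ)) z) := by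
    intro z
    have h0 : 0 ≤ ∑ i, (T i).indicator (fun _ => (1 : ℝ)) z :=
      Finset.sum_nonneg fun i _ => Set.indicator_nonneg (fun _ _ => zero_le_one) z
    rw [← hnN]
    set N := ∑ i, (T i).indicator (fun _ => (1 : ℝ)) z
    rw [← ENNReal.ofReal_pow h0, ← ENNReal.ofReal_mul (by positivity),
      ← ENNReal.ofReal_mul (by positivity), ← ENNReal.ofReal_add (by positivity) (by positivity)]
    refine ENNReal.ofReal_le_ofReal ?_
    have := sqrt_ge_quadratic (y := N / M) (by positivity)
    rw [Real.sqrt_div h0] at this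
    have h3 := mul_le_mul_of_nonneg_right this hs.le
    rw [div_mul_cancel₀ _ hs.ne'] at h3
    have hss : √M * √M = M := Real.mul_self_sqrt hM.le
    have e1 : 3 / (2 * √M) * N = 3 / 2 * (N / M) * √M := by
      field_simp; rw [sq, hss, mul_comm]
    have e2 : 1 / (2 * M * √M) * N ^ 2 = (N / M) ^ 2 / 2 * √M := by
      field_simp; rw [sq √M, hss]
    rw [e1, e2]; linarith
  have hV : ∑ i, μ (T i) ≠ ∞ := (ENNReal.sum_lt_top.2 fun i _ => hT' i).ne
  have := lintegral_mono (μ := μ) key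
  rw [lintegral_const_mul _ hnm, lintegral_add_left ((hnm.pow_const 2).const_mul _),
    lintegral_const_mul _ (hnm.pow_const 2), h1, h2] at this
  have h4 : ENNReal.ofReal (1 / (2 * M * √M)) * ∑ i, ∑ j, μ (T i ∩ T j) ≤
      ENNReal.ofReal (1 / (2 * √M)) * ∑ i, μ (T i) := by
    calc _ ≤ ENNReal.ofReal (1 / (2 * M * √M)) * (ENNReal.ofReal M * ∑ i, μ (T i)) := by gcongr
      _ = _ := by
        rw [← mul_assoc, ← ENNReal.ofReal_mul (by positivity)]
        congr 2; field_simp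
  have h5 : ENNReal.ofReal (3 / (2 * √M)) * ∑ i, μ (T i) =
      ENNReal.ofReal (1 / (2 * √M)) * ∑ i, μ (T i) +
        ENNReal.ofReal (1 / √M) * ∑ i, μ (T i) := by
    rw [← add_mul, ← ENNReal.ofReal_add (by positivity) (by positivity)]
    congr 2; field_simp; norm_num
  rw [h5] at this
  refine (ENNReal.add_le_add_iff_left (a := ENNReal.ofReal (1 / (2 * √M)) * ∑ i, μ (T i))
    (ENNReal.mul_ne_top ENNReal.ofReal_ne_top hV)).1 (this.trans (by gcongr))

variable {d : ℕ} {ℓ : Fin d → ℝ≥0∞} {g : Freq d → ℝ}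

/-- Testing the restricted weak type norm against the phase of `E f`. -/
lemma lintegral_extOp_le (hg : ContinuousOn g (rectangle ℓ)) (p : ℝ≥0∞) {q : ℝ≥0∞} (hq : 1 ≤ q)
    {A : Set (Freq d)} {B : Set (ℝ × Freq d)} {f : Freq d → ℂ}
    (hA : MeasurableSet A ∧ 0 < volume A ∧ volume A < ∞)
    (hB : MeasurableSet B ∧ 0 < volume B ∧ volume B < ∞)
    (hf : Measurable f ∧ ∀ ξ, ‖f ξ‖ ≤ A.indicator (fun _ => (1 : ℝ)) ξ) :
    ∫⁻ z in B, ‖extOp ℓ g f z‖ₑ ≤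
      rwtNorm ℓ g p q * (volume A ^ (p⁻¹).toReal * volume B ^ (1 - (q⁻¹).toReal)) := by
  have hfi : Integrable f volume := integrable_of_norm_le_indicator hA.1 hA.2.2 hf.1 hf.2
  have hcont := continuous_extOp hg hfi.integrableOn
  set X := extOp ℓ g f with hX
  set u : ℝ × Freq d → ℂ := B.indicator fun z => X z / ‖X z‖ with hu
  have hum : Measurable u := by
    refine Measurable.indicator ?_ hB.1
    exact hcont.measurable.div (Complex.measurable_ofReal.comp hcont.norm.measurable)
  have hu1 : ∀ z, ‖u z‖ ≤ B.indicator (fun _ => (1 : ℝ)) z := by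
    intro z
    by_cases hz : z ∈ B
    · simp only [hu, Set.indicator_of_mem hz, norm_div, Complex.norm_real, norm_norm]
      exact div_self_le_one _
    · simp [hu, hz]
  have hXu : ∀ z, X z * (starRingEnd ℂ) (u z) = B.indicator (fun z => ((‖X z‖ : ℝ) : ℂ)) z := by
    intro z
    by_cases hz : z ∈ B
    · simp only [hu, Set.indicator_of_mem hz, map_div₀, Complex.conj_ofReal, ← mul_div_assoc,
        Complex.mul_conj, Complex.normSq_eq_norm_sq]
      by_cases h0 : ‖X z‖ = 0
      · simp [h0]
      · push_cast; field_simp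
    · simp [hu, hz]
  have hint : IntegrableOn (fun z => ‖X z‖) B := by
    refine Integrable.mono' (integrableOn_const (C := ∫ ξ in rectangle ℓ, ‖f ξ‖) hB.2.2.ne)
      hcont.norm.aestronglyMeasurable (Eventually.of_forall fun z => ?_)
    rw [norm_norm]; exact norm_extOp_le f z
  have hval : ‖∫ z, X z * (starRingEnd ℂ) (u z)‖ₑ = ∫⁻ z in B, ‖X z‖ₑ := by
    simp_rw [hXu]
    rw [integral_indicator hB.1, integral_complex_ofReal, ← ofReal_norm, Complex.norm_real,
      Real.norm_of_nonneg (integral_nonneg fun _ => norm_nonneg _)]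
    exact ofReal_integral_norm_eq_lintegral_enorm
      (hint.congr' hcont.aestronglyMeasurable (Eventually.of_forall fun z => by simp))
  have hB4 : volume B ^ (1 - (q⁻¹).toReal) ≠ ∞ :=
    (ENNReal.rpow_lt_top_of_nonneg (by linarith [(inv_toReal_mem hq).2]) hB.2.2.ne).ne
  have hB5 : volume B ^ (1 - (q⁻¹).toReal) ≠ 0 := (ENNReal.rpow_pos hB.2.1 hB.2.2.ne).ne'
  have hA4 : volume A ^ (p⁻¹).toReal ≠ ∞ :=
    (ENNReal.rpow_lt_top_of_nonneg ENNReal.toReal_nonneg hA.2.2.ne).ne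
  have hA5 : volume A ^ (p⁻¹).toReal ≠ 0 := (ENNReal.rpow_pos hA.2.1 hA.2.2.ne).ne'
  rw [← hval, ← ENNReal.div_le_iff (mul_ne_zero hA5 hB5) (ENNReal.mul_ne_top hA4 hB4)]
  exact le_iSup_of_le A <| le_iSup_of_le B <| le_iSup_of_le f <| le_iSup_of_le u <|
    le_iSup_of_le hA <| le_iSup_of_le hB <| le_iSup_of_le hf <| le_iSup_of_le ⟨hum, hu1⟩ le_rfl

/-- Every choice of signs gives an admissible test function on the union of the cells. Averaging
over the signs, Khinchine replaces the extension by v/2 times the square root of the number of tubes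
through a point, and the overlap hypothesis bounds the integral of that root. -/
lemma rwtNorm_ge_of_tubes (hg : ContinuousOn g (rectangle ℓ)) (p : ℝ≥0∞) {q : ℝ≥0∞} (hq : 1 ≤ q)
    {ι : Type*} [Fintype ι] {C : ι → Set (Freq d)} {f : ι → Freq d → ℂ}
    {T : ι → Set (ℝ × Freq d)} (hC : ∀ i, MeasurableSet (C i))
    (hCd : Pairwise (Function.onFun Disjoint C))
    (hCvol : 0 < volume (⋃ i, C i)) (hCvol' : volume (⋃ i, C i) < ∞)
    (hf : ∀ i, Measurable (f i) ∧ ∀ ξ, ‖f i ξ‖ ≤ (C i).indicator (fun _ => (1 : ℝ)) ξ)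
    (hT : ∀ i, MeasurableSet (T i)) (hTvol : 0 < volume (⋃ i, T i))
    (hTvol' : volume (⋃ i, T i) < ∞) {v M : ℝ} (hv : 0 ≤ v) (hM : 0 < M)
    (hlow : ∀ i, ∀ z ∈ T i, v ≤ ‖extOp ℓ g (f i) z‖)
    (hcross : ∑ i, ∑ j, volume (T i ∩ T j) ≤ ENNReal.ofReal M * ∑ i, volume (T i)) :
    ENNReal.ofReal (v / (2 * √M)) * ∑ i, volume (T i) ≤
      rwtNorm ℓ g p q *
        (volume (⋃ i, C i) ^ (p⁻¹).toReal * volume (⋃ i, T i) ^ (1 - (q⁻¹).toReal)) := by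
  classical
  set R := rwtNorm ℓ g p q *
        (volume (⋃ i, C i) ^ (p⁻¹).toReal * volume (⋃ i, T i) ^ (1 - (q⁻¹).toReal))
  set B := ⋃ i, T i with hB
  have hBm : MeasurableSet B := MeasurableSet.iUnion hT
  have hfi : ∀ i, IntegrableOn (f i) (rectangle ℓ) := fun i =>
    (integrable_of_norm_le_indicator (hC i)
      ((measure_mono (Set.subset_iUnion C i)).trans_lt hCvol') (hf i).1 (hf i).2).integrableOn
  -- Disjointness of the cells keeps the signed sum below the indicator of their union, so one bound
  -- serves all signs.
  have hone : ∀ t : Finset ι,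
      ∫⁻ z in B, ‖∑ i, signOn t i * extOp ℓ g (f i) z‖ₑ ≤ R := by
    intro t
    have := lintegral_extOp_le hg p hq (A := ⋃ i, C i) (B := B)
      (f := fun ξ => ∑ i, signOn t i * f i ξ) ⟨MeasurableSet.iUnion hC, hCvol, hCvol'⟩
      ⟨hBm, hTvol, hTvol'⟩ ⟨?_, ?_⟩
    · simp_rw [extOp_sum hg Finset.univ (signOn t) f fun i _ => hfi i] at this
      exact this
    · exact Finset.measurable_sum _ fun i _ => (hf i).1.const_mul _
    · intro ξ
      have hz : ∀ i, ξ ∉ C i → f i ξ = 0 := fun i hi => by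
        have := (hf i).2 ξ
        rw [Set.indicator_of_notMem hi] at this
        exact norm_le_zero_iff.1 this
      by_cases hξ : ∃ i, ξ ∈ C i
      · obtain ⟨i, hi⟩ := hξ
        rw [Set.indicator_of_mem (Set.mem_iUnion.2 ⟨i, hi⟩), Finset.sum_eq_single i]
        · rw [norm_mul, norm_signOn, one_mul]
          have := (hf i).2 ξ
          rwa [Set.indicator_of_mem hi] at this
        · intro j _ hj
          rw [hz j fun h => Set.disjoint_left.1 (hCd hj) h hi, mul_zero]
        · simp
      · push Not at hξ
        rw [Finset.sum_eq_zero fun i _ => by rw [hz i (hξ i), mul_zero], norm_zero]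
        exact Set.indicator_nonneg (fun _ _ => zero_le_one) _
  have hpt : ∀ z ∈ B, 2 ^ Fintype.card ι *
      (ENNReal.ofReal (v / 2) *
        ENNReal.ofReal √(∑ i, (T i).indicator (fun _ => (1 : ℝ)) z)) ≤
      ∑ t : Finset ι, ‖∑ i, signOn t i * extOp ℓ g (f i) z‖ₑ := by
    intro z _
    have h := khinchine (fun i => extOp ℓ g (f i) z) Finset.univ
    rw [Finset.powerset_univ] at h
    have h2 : v * √(∑ i, (T i).indicator (fun _ => (1 : ℝ)) z) ≤
        √(∑ i, ‖extOp ℓ g (f i) z‖ ^ 2) := by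
      rw [← Real.sqrt_sq hv, ← Real.sqrt_mul (sq_nonneg v), Finset.mul_sum]
      refine Real.sqrt_le_sqrt (Finset.sum_le_sum fun i _ => ?_)
      by_cases hz : z ∈ T i
      · rw [Set.indicator_of_mem hz, mul_one]
        gcongr; exact hlow i z hz
      · rw [Set.indicator_of_notMem hz, mul_zero]; positivity
    rw [← ENNReal.ofReal_mul (by positivity)]
    have h3 : (2 : ℝ≥0∞) ^ Fintype.card ι = ENNReal.ofReal (2 ^ Fintype.card ι) := by
      rw [ENNReal.ofReal_pow (by norm_num)]; simp
    rw [h3, ← ENNReal.ofReal_mul (by positivity)]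
    calc _ ≤ ENNReal.ofReal (∑ t : Finset ι, ‖∑ i, signOn t i * extOp ℓ g (f i) z‖) := by
          refine ENNReal.ofReal_le_ofReal (le_trans ?_ h)
          rw [Finset.card_univ]
          have : (0 : ℝ) < 2 ^ Fintype.card ι := by positivity
          gcongr
          linarith
      _ = _ := by
          rw [ENNReal.ofReal_sum_of_nonneg fun _ _ => norm_nonneg _]
          simp only [ofReal_norm]
  have hmeas : Measurable fun z => ENNReal.ofReal √(∑ i, (T i).indicator (fun _ => (1 : ℝ)) z) :=
    ENNReal.measurable_ofReal.comp (Real.continuous_sqrt.measurable.comp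
      (Finset.measurable_sum _ fun i _ => measurable_const.indicator (hT i)))
  have hTfin : ∀ i, volume (T i) < ∞ := fun i =>
    (measure_mono (Set.subset_iUnion T i)).trans_lt hTvol'
  have hcount := lintegral_sqrt_count_ge hT hTfin hM hcross
  have hres : ∫⁻ z, ENNReal.ofReal √(∑ i, (T i).indicator (fun _ => (1 : ℝ)) z) =
      ∫⁻ z in B, ENNReal.ofReal √(∑ i, (T i).indicator (fun _ => (1 : ℝ)) z) := by
    rw [← lintegral_indicator hBm]
    refine lintegral_congr fun z => ?_
    by_cases hz : z ∈ B
    · rw [Set.indicator_of_mem hz]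
    · rw [Set.indicator_of_notMem hz, Finset.sum_eq_zero, Real.sqrt_zero, ENNReal.ofReal_zero]
      intro i _
      exact Set.indicator_of_notMem (fun h => hz (Set.mem_iUnion.2 ⟨i, h⟩)) _
  have hsum : 2 ^ Fintype.card ι * (ENNReal.ofReal (v / 2) *
      ∫⁻ z in B, ENNReal.ofReal √(∑ i, (T i).indicator (fun _ => (1 : ℝ)) z)) ≤
      2 ^ Fintype.card ι * R := by
    calc _ = ∫⁻ z in B, 2 ^ Fintype.card ι * (ENNReal.ofReal (v / 2) *
          ENNReal.ofReal √(∑ i, (T i).indicator (fun _ => (1 : ℝ)) z)) := by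
          rw [lintegral_const_mul _ (hmeas.const_mul _), lintegral_const_mul _ hmeas]
      _ ≤ ∫⁻ z in B, ∑ t : Finset ι, ‖∑ i, signOn t i * extOp ℓ g (f i) z‖ₑ :=
          setLIntegral_mono' hBm hpt
      _ = ∑ t : Finset ι, ∫⁻ z in B, ‖∑ i, signOn t i * extOp ℓ g (f i) z‖ₑ := by
          refine lintegral_finsetSum _ fun t _ => ?_
          exact (Finset.measurable_sum _ fun i _ =>
            (continuous_extOp hg (hfi i)).measurable.const_mul _).enorm
      _ ≤ ∑ t : Finset ι, R := Finset.sum_le_sum fun t _ => hone t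
      _ = _ := by simp
  have h2 := (ENNReal.mul_le_mul_iff_right (by positivity) (by finiteness)).1 hsum
  refine le_trans ?_ h2
  rw [← hres]
  calc _ = ENNReal.ofReal (v / 2) * (ENNReal.ofReal (1 / √M) * ∑ i, volume (T i)) := by
        rw [← mul_assoc, ← ENNReal.ofReal_mul (by positivity)]
        congr 2; field_simp
    _ ≤ _ := by gcongr

end RandomSigns

/-! ### Keich's arrangement of lines in the plane -/

section Kakeya

/-- The position at time `τ` of the `n`-th line in Keich's arrangement with `D` levels. -/
noncomputable def kakeyaLine (D n : ℕ) (τ : ℝ) : ℝ :=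
  n * τ - (∑ r ∈ Finset.range D, ((n % 2 ^ r : ℕ) : ℝ)) / D

lemma continuous_kakeyaLine (D n : ℕ) : Continuous (kakeyaLine D n) := by
  unfold kakeyaLine; fun_prop

lemma abs_kakeyaLine_le (D n : ℕ) {τ : ℝ} (hτ : τ ∈ Set.Icc (0 : ℝ) 1) :
    |kakeyaLine D n τ| ≤ n := by
  have h0 : 0 ≤ ∑ r ∈ Finset.range D, ((n % 2 ^ r : ℕ) : ℝ) :=
    Finset.sum_nonneg fun _ _ => Nat.cast_nonneg _
  have h1 : (∑ r ∈ Finset.range D, ((n % 2 ^ r : ℕ) : ℝ)) / D ≤ n := by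
    refine div_le_of_le_mul₀ (Nat.cast_nonneg _) (Nat.cast_nonneg _) ?_
    calc _ ≤ ∑ _r ∈ Finset.range D, (n : ℝ) :=
          Finset.sum_le_sum fun r _ => by exact_mod_cast Nat.mod_le _ _
      _ = _ := by simp [mul_comm]
  have h2 : 0 ≤ (∑ r ∈ Finset.range D, ((n % 2 ^ r : ℕ) : ℝ)) / D := by positivity
  have hn : (0 : ℝ) ≤ n := Nat.cast_nonneg n
  unfold kakeyaLine
  rw [abs_le]
  constructor <;> nlinarith [hτ.1, hτ.2]

lemma mod_two_pow_sub (n : ℕ) {r s : ℕ} (h : s ≤ r) :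
    n % 2 ^ r = (2 ^ s * (n / 2 ^ s)) % 2 ^ r + n % 2 ^ s := by
  obtain ⟨k, rfl⟩ := Nat.exists_eq_add_of_le h
  rw [pow_add, Nat.mod_mul, Nat.mul_mod_mul_left, add_comm]

/-- During the `j`-th time interval, lines whose indices share the first `j` digits are close. -/
lemma abs_kakeyaLine_sub_le {D j : ℕ} (hj : j < D) (n : ℕ) {τ : ℝ}
    (hτ : τ ∈ Set.Icc ((j : ℝ) / D) ((j + 1) / D)) :
    |kakeyaLine D n τ - kakeyaLine D (2 ^ (D - j) * (n / 2 ^ (D - j))) τ| ≤ 2 ^ (D - j) / D := by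
  set s := D - j with hs
  set a := 2 ^ s * (n / 2 ^ s) with ha
  set e := n % 2 ^ s with he
  have hD : (0 : ℝ) < D := by exact_mod_cast (by omega : 0 < D)
  have hn : (n : ℝ) = a + e := by exact_mod_cast (Nat.div_add_mod n (2 ^ s)).symm
  have hDs : D = s + j := by omega
  -- Each of the j levels r ≥ s contains the low part e in full. The resulting shift j e / D cancels
  -- the drift e τ at τ = j / D, so the lines of one group nearly meet there and have little time to
  -- separate.
  have hsum : ∑ r ∈ Finset.range D, ((n % 2 ^ r : ℕ) : ℝ) -
      ∑ r ∈ Finset.range D, ((a % 2 ^ r : ℕ) : ℝ) =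
      ∑ r ∈ Finset.range s, ((n % 2 ^ r : ℕ) : ℝ) + j * e := by
    have hlow : ∀ r ∈ Finset.range s, ((a % 2 ^ r : ℕ) : ℝ) = 0 := by
      intro r hr
      have : 2 ^ r ∣ a := (pow_dvd_pow 2 (Finset.mem_range.1 hr).le).mul_right _
      simp [Nat.mod_eq_zero_of_dvd this]
    rw [hDs, Finset.sum_range_add, Finset.sum_range_add, Finset.sum_congr rfl hlow]
    have : ∀ x ∈ Finset.range j, ((n % 2 ^ (s + x) : ℕ) : ℝ) = ((a % 2 ^ (s + x) : ℕ) : ℝ) + e := by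
      intro x _
      rw [mod_two_pow_sub n (Nat.le_add_right s x)]
      push_cast; rfl
    rw [Finset.sum_congr rfl this, Finset.sum_add_distrib]
    simp only [Finset.sum_const_zero, Finset.sum_const, Finset.card_range, nsmul_eq_mul]
    ring
  have hS0 : 0 ≤ ∑ r ∈ Finset.range s, ((n % 2 ^ r : ℕ) : ℝ) :=
    Finset.sum_nonneg fun _ _ => Nat.cast_nonneg _
  have hS1 : ∑ r ∈ Finset.range s, ((n % 2 ^ r : ℕ) : ℝ) ≤ 2 ^ s := by
    calc _ ≤ ∑ r ∈ Finset.range s, (2 : ℝ) ^ r := Finset.sum_le_sum fun r _ => by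
            exact_mod_cast (Nat.mod_lt n (by positivity : 2 ^ r > 0)).le
      _ ≤ _ := by rw [geom_sum_eq (by norm_num)]; norm_num
  have he1 : (e : ℝ) ≤ 2 ^ s := by exact_mod_cast (Nat.mod_lt n (by positivity : 2 ^ s > 0)).le
  have he0 : (0 : ℝ) ≤ e := Nat.cast_nonneg _
  have hdiff : kakeyaLine D n τ - kakeyaLine D a τ =
      e * (τ - j / D) - (∑ r ∈ Finset.range s, ((n % 2 ^ r : ℕ) : ℝ)) / D := by
    unfold kakeyaLine
    rw [sub_eq_iff_eq_add'.1 hsum, hn]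
    field_simp; ring
  rw [hdiff]
  have h1 : 0 ≤ τ - j / D := by linarith [hτ.1]
  have h2 : τ - j / D ≤ 1 / D := by have := hτ.2; rw [add_div] at this; linarith
  have h3 : e * (τ - j / D) ≤ 2 ^ s / D := by
    calc _ ≤ (2 : ℝ) ^ s * (1 / D) := by gcongr
      _ = _ := by ring
  have h4 : (∑ r ∈ Finset.range s, ((n % 2 ^ r : ℕ) : ℝ)) / D ≤ 2 ^ s / D := by gcongr
  have h5 : 0 ≤ (∑ r ∈ Finset.range s, ((n % 2 ^ r : ℕ) : ℝ)) / D := by positivity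
  have h6 : 0 ≤ e * (τ - j / D) := by positivity
  rw [abs_le]; constructor <;> linarith

/-- At each time the lines are covered by few unit intervals moving along coarse lines. -/
lemma exists_kakeyaLine_mem {μ n : ℕ} (hn : n < 2 ^ μ) {τ : ℝ} (hτ : τ ∈ Set.Icc (0 : ℝ) 1) :
    ∃ j ∈ Finset.range (μ + 1), ∃ i ∈ Finset.range (2 ^ j),
      ∃ k ∈ Finset.Icc (-((2 ^ (μ + 1 - j) / (μ + 1) + 1 : ℕ) : ℤ))
        ((2 ^ (μ + 1 - j) / (μ + 1) + 1 : ℕ) : ℤ),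
      τ ∈ Set.Icc ((j : ℝ) / (μ + 1 : ℕ)) ((j + 1) / (μ + 1 : ℕ)) ∧
      |kakeyaLine (μ + 1) n τ - (kakeyaLine (μ + 1) (2 ^ (μ + 1 - j) * i) τ + k)| ≤ 1 := by
  set D := μ + 1 with hDdef
  have hD : (0 : ℝ) < (D : ℕ) := by positivity
  obtain ⟨j, hj, hjτ⟩ : ∃ j < D, τ ∈ Set.Icc ((j : ℝ) / D) ((j + 1) / D) := by
    -- At τ = 1 the floor of τ D would be D, one too many; the last interval is used instead.
    rcases hτ.2.eq_or_lt with h | h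
    · refine ⟨μ, by omega, ?_⟩
      have : ((μ : ℝ) + 1) / D = 1 := by rw [hDdef]; push_cast; field_simp
      rw [this, h]
      refine ⟨?_, le_rfl⟩
      rw [div_le_one hD, hDdef]; push_cast; linarith
    · refine ⟨⌊τ * D⌋₊, ?_, ?_, ?_⟩
      · rw [Nat.floor_lt (by have := hτ.1; positivity)]
        nlinarith
      · rw [div_le_iff₀ hD]; exact Nat.floor_le (by have := hτ.1; positivity)
      · rw [le_div_iff₀ hD]; exact (Nat.lt_floor_add_one _).le
  have hclose := abs_kakeyaLine_sub_le hj n hjτ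
  set s := D - j with hs
  set x := kakeyaLine D n τ - kakeyaLine D (2 ^ s * (n / 2 ^ s)) τ with hx
  have hR : (2 : ℝ) ^ s / D < ((2 ^ s / D + 1 : ℕ) : ℝ) := by
    rw [div_lt_iff₀ hD]
    have := Nat.lt_mul_div_succ (2 ^ s) (show 0 < D by omega)
    have h2 : 2 ^ s < (2 ^ s / D + 1) * D := by rw [mul_comm]; exact this
    exact_mod_cast h2
  refine ⟨j, Finset.mem_range.2 hj, n / 2 ^ s, ?_, ⌊x⌋, ?_, hjτ, ?_⟩
  · rw [Finset.mem_range, Nat.div_lt_iff_lt_mul (by positivity), ← pow_add]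
    exact hn.trans_le (Nat.pow_le_pow_right (by norm_num) (by omega))
  · obtain ⟨h1, h2⟩ := abs_le.1 hclose
    rw [Finset.mem_Icc]
    refine ⟨?_, ?_⟩
    · rw [Int.le_floor, Int.cast_neg, Int.cast_natCast]; linarith
    · have h3 : x < (((2 ^ s / D + 1 : ℕ) : ℤ) : ℝ) := by rw [Int.cast_natCast]; linarith
      exact (Int.floor_lt.2 h3).le
  · have h1 := Int.floor_le x
    have h2 := Int.lt_floor_add_one x
    have : kakeyaLine D n τ - (kakeyaLine D (2 ^ s * (n / 2 ^ s)) τ + ⌊x⌋) = x - ⌊x⌋ := by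
      rw [hx]; ring
    rw [this, abs_le]; constructor <;> linarith

/-- Up to rounding, level j needs 2^j groups of about 2^(μ+1-j)/(μ+1) unit intervals, a number
independent of j, so the μ+1 levels use O(2^μ) in all. Each lasts only a time 1/(μ+1), which is the
source of the gain. -/
lemma kakeya_cover_count (μ : ℕ) :
    ∑ j ∈ Finset.range (μ + 1), (2 : ℝ) ^ j * (2 * ((2 ^ (μ + 1 - j) / (μ + 1) + 1 : ℕ) : ℝ) + 1) ≤
      10 * 2 ^ μ := by
  have hD : (0 : ℝ) < ((μ + 1 : ℕ) : ℝ) := by positivity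
  have h : ∀ j ∈ Finset.range (μ + 1),
      (2 : ℝ) ^ j * (2 * ((2 ^ (μ + 1 - j) / (μ + 1) + 1 : ℕ) : ℝ) + 1) ≤
      2 * (2 ^ (μ + 1) / (μ + 1 : ℕ)) + 3 * 2 ^ j := by
    intro j hj
    have h1 : ((2 ^ (μ + 1 - j) / (μ + 1) : ℕ) : ℝ) ≤ 2 ^ (μ + 1 - j) / (μ + 1 : ℕ) := by
      refine (Nat.cast_div_le).trans ?_
      push_cast; rfl
    have h2 : (2 : ℝ) ^ j * 2 ^ (μ + 1 - j) = 2 ^ (μ + 1) := by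
      rw [← pow_add]; congr 1; have := Finset.mem_range.1 hj; omega
    rw [← h2, mul_div_assoc]
    push_cast at h1 ⊢
    nlinarith [show (0 : ℝ) < 2 ^ j by positivity]
  refine (Finset.sum_le_sum h).trans ?_
  rw [Finset.sum_add_distrib, ← Finset.mul_sum _ _ (3 : ℝ), geom_sum_eq (by norm_num),
    Finset.sum_const, Finset.card_range, nsmul_eq_mul]
  have : ((μ + 1 : ℕ) : ℝ) * (2 * (2 ^ (μ + 1) / (μ + 1 : ℕ))) = 4 * 2 ^ μ := by
    field_simp; rw [pow_succ]; ring
  rw [this, pow_succ]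
  have : (0 : ℝ) < 2 ^ μ := by positivity
  linarith

/-- Tubes n and k share at most the fraction 4/|n - k| of their duration. Summing over k leaves two
harmonic sums, each at most 1 + log 2^μ before the factor 4. -/
lemma sum_inv_dist_le {μ n : ℕ} (hn : n < 2 ^ μ) :
    ∑ k ∈ Finset.range (2 ^ μ), (if n = k then (1 : ℝ) else 4 / |(n : ℝ) - k|) ≤ 17 * (μ + 1) := by
  have hH : ∀ m ≤ 2 ^ μ, ∑ i ∈ Finset.range m, (4 : ℝ) / (i + 1) ≤ 4 * (μ + 1) := by
    intro m hm
    have h1 : ∑ i ∈ Finset.range m, (4 : ℝ) / (i + 1) = 4 * ((harmonic m : ℚ) : ℝ) := by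
      rw [harmonic]; push_cast; rw [Finset.mul_sum]; rfl
    rw [h1]
    rcases Nat.eq_zero_or_pos m with rfl | h0
    · simp; positivity
    have h2 := harmonic_le_one_add_log m
    have h3 : Real.log m ≤ Real.log (2 ^ μ) :=
      Real.log_le_log (by exact_mod_cast h0) (by exact_mod_cast hm)
    rw [Real.log_pow] at h3
    have h4 : (μ : ℝ) * Real.log 2 ≤ μ * 1 := by
      gcongr; linarith [Real.log_two_lt_d9]
    linarith
  obtain ⟨m, hm⟩ := Nat.exists_eq_add_of_lt hn
  rw [show 2 ^ μ = n + (1 + m) by omega, Finset.sum_range_add, Finset.sum_range_add]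
  have h1 : ∑ k ∈ Finset.range n, (if n = k then (1 : ℝ) else 4 / |(n : ℝ) - k|) =
      ∑ i ∈ Finset.range n, (4 : ℝ) / (i + 1) := by
    rw [← Finset.sum_range_reflect]
    refine Finset.sum_congr rfl fun k hk => ?_
    have hk' := Finset.mem_range.1 hk
    rw [if_neg (by omega)]
    congr 1
    have : ((n - 1 - k : ℕ) : ℝ) = n - 1 - k := by
      rw [Nat.cast_sub (by omega), Nat.cast_sub (by omega)]; simp
    rw [this, abs_of_nonneg] <;> ring_nf
    positivity
  have h2 : ∑ x ∈ Finset.range m, (if n = n + (1 + x) then (1 : ℝ) else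
      4 / |(n : ℝ) - (n + (1 + x) : ℕ)|) = ∑ i ∈ Finset.range m, (4 : ℝ) / (i + 1) := by
    refine Finset.sum_congr rfl fun k _ => ?_
    rw [if_neg (by omega)]
    congr 1
    push_cast
    rw [abs_of_nonpos (by have : (0 : ℝ) ≤ k := Nat.cast_nonneg k; linarith)]
    ring
  rw [h1, h2]
  have h3 := hH n hn.le
  have h4 := hH m (by omega)
  have h5 : (0 : ℝ) ≤ μ := Nat.cast_nonneg μ
  simp only [Finset.sum_range_one, add_zero, if_true]
  linarith

end Kakeya

/-! ### Volumes of sheared boxes -/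

section ShearedBox

variable {d : ℕ}

/-- The box with half-sides `r` whose centre moves along `φ` during the time set `I`. -/
def shearedBox (I : Set ℝ) (φ : ℝ → Freq d) (r : Fin d → ℝ) : Set (ℝ × Freq d) :=
  {z | z.1 ∈ I ∧ ∀ i, |z.2 i - φ z.1 i| ≤ r i}

lemma volume_box (c : Freq d) {r : Fin d → ℝ} (hr : ∀ i, 0 ≤ r i) :
    volume {x : Freq d | ∀ i, |x i - c i| ≤ r i} = ENNReal.ofReal (∏ i, (2 * r i)) := by
  have h : {x : Freq d | ∀ i, |x i - c i| ≤ r i} =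
      (MeasurableEquiv.toLp 2 (Fin d → ℝ)).symm ⁻¹'
        (Set.univ.pi fun i => Set.Icc (c i - r i) (c i + r i)) := by
    ext x
    simp only [Set.mem_ofPred_eq, Set.mem_preimage, Set.mem_univ_pi, Set.mem_Icc, abs_le]
    refine forall_congr' fun i => ?_
    constructor <;> rintro ⟨h1, h2⟩ <;> constructor <;>
      first | (change c i - r i ≤ x i; linarith) | (change x i ≤ c i + r i; linarith) |
        (change c i - r i ≤ x i at h1; linarith) | (change x i ≤ c i + r i at h2; linarith)
  rw [h, (EuclideanSpace.volume_preserving_symm_measurableEquiv_toLp (Fin d)).measure_preimage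
    (MeasurableSet.univ_pi fun i => measurableSet_Icc).nullMeasurableSet, volume_pi_pi,
    ENNReal.ofReal_prod_of_nonneg fun i _ => by have := hr i; positivity]
  refine Finset.prod_congr rfl fun i _ => ?_
  rw [Real.volume_Icc]; congr 1; ring

lemma measurableSet_shearedBox {I : Set ℝ} (hI : MeasurableSet I) {φ : ℝ → Freq d}
    (hφ : Continuous φ) (r : Fin d → ℝ) : MeasurableSet (shearedBox I φ r) := by
  refine MeasurableSet.inter (measurable_fst hI) ?_
  have hφ' : Continuous fun z : ℝ × Freq d => φ z.1 := hφ.comp continuous_fst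
  have : IsClosed {z : ℝ × Freq d | ∀ i, |z.2 i - φ z.1 i| ≤ r i} := by
    rw [Set.ofPred_forall]
    exact isClosed_iInter fun i => isClosed_le (by fun_prop) continuous_const
  exact this.measurableSet

lemma volume_shearedBox {I : Set ℝ} (hI : MeasurableSet I) {φ : ℝ → Freq d}
    (hφ : Continuous φ) {r : Fin d → ℝ} (hr : ∀ i, 0 ≤ r i) :
    volume (shearedBox I φ r) = volume I * ENNReal.ofReal (∏ i, (2 * r i)) := by
  rw [Measure.volume_eq_prod, Measure.prod_apply (measurableSet_shearedBox hI hφ r)]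
  have : ∀ t, volume (Prod.mk t ⁻¹' shearedBox I φ r) =
      I.indicator (fun _ => ENNReal.ofReal (∏ i, (2 * r i))) t := by
    intro t
    by_cases ht : t ∈ I
    · rw [Set.indicator_of_mem ht, ← volume_box (φ t) hr]
      congr 1; ext x; simp [shearedBox, ht]
    · rw [Set.indicator_of_notMem ht]
      convert measure_empty (μ := (volume : Measure (Freq d)))
      ext x; simp [shearedBox, ht]
  simp_rw [this]
  rw [lintegral_indicator hI, setLIntegral_const, mul_comm]

end ShearedBox

/-! ### Taylor estimates from ellipticity -/

section Taylor

variable {d : ℕ}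

lemma mem_rectangle_ofReal {m : Fin d → ℝ} {ξ : Freq d} :
    ξ ∈ rectangle (fun i => ENNReal.ofReal (m i)) ↔ ∀ i, |ξ i| < m i := by
  refine forall_congr' fun i => ?_
  rw [Real.enorm_eq_ofReal_abs, ENNReal.ofReal_lt_ofReal_iff_of_nonneg (abs_nonneg _)]

lemma convex_rectangle_ofReal (m : Fin d → ℝ) :
    Convex ℝ (rectangle (fun i => ENNReal.ofReal (m i))) := by
  intro x hx y hy a b ha hb hab
  rw [mem_rectangle_ofReal] at *
  intro i
  have h1 := abs_lt.1 (hx i)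
  have h2 := abs_lt.1 (hy i)
  have h3 : (a • x + b • y) i = a * x i + b * y i := by simp
  rw [h3, abs_lt]
  have hb' : b = 1 - a := by linarith
  subst hb'
  rcases ha.eq_or_lt with rfl | ha
  · constructor <;> linarith
  · constructor <;> nlinarith

/-- The diagonal dilation as a continuous linear map. -/
noncomputable def dilationL (m : Fin d → ℝ) : Freq d →L[ℝ] Freq d :=
  LinearMap.toContinuousLinearMap
    { toFun := dilation m
      map_add' := fun x y => by ext i; simp [dilation, mul_add]
      map_smul' := fun c x => by ext i; simp [dilation]; ring }

lemma dilationL_apply (m : Fin d → ℝ) (ξ : Freq d) : dilationL m ξ = dilation m ξ := rfl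

lemma dilationL_single (m : Fin d → ℝ) (e : Fin d) :
    dilationL m (EuclideanSpace.single e 1) = m e • EuclideanSpace.single e (1 : ℝ) := by
  ext i
  by_cases h : i = e
  · subst h; simp [dilationL_apply, dilation]
  · simp [dilationL_apply, dilation, h]

/-- The unit coordinate vector. -/
noncomputable abbrev coordVec (e : Fin d) : Freq d := EuclideanSpace.single e (1 : ℝ)

variable {N : ℕ∞} {ε₀ : ℝ} {ℓ : Fin d → ℝ≥0∞} {g : Freq d → ℝ}

lemma IsElliptic.contDiffAt (hg : IsElliptic N ε₀ ℓ g) (hN : 2 ≤ N) {ξ : Freq d}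
    (hξ : ξ ∈ rectangle ℓ) : ContDiffAt ℝ 4 g ξ := by
  refine (hg.contDiffOn.contDiffAt ((isOpen_rectangle ℓ).mem_nhds hξ)).of_le ?_
  have : (4 : ℕ∞) ≤ N + 2 := by
    calc (4 : ℕ∞) = 2 + 2 := by norm_num
      _ ≤ N + 2 := by gcongr
  have h : ((4 : ℕ∞) : WithTop ℕ∞) ≤ ((N + 2 : ℕ∞) : WithTop ℕ∞) := WithTop.coe_le_coe.2 this
  exact h

lemma IsElliptic.contDiffAt_fderiv (hg : IsElliptic N ε₀ ℓ g) (hN : 2 ≤ N) {ξ : Freq d}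
    (hξ : ξ ∈ rectangle ℓ) : ContDiffAt ℝ 3 (fderiv ℝ g) ξ :=
  (hg.contDiffAt hN hξ).fderiv_right (by norm_num)

lemma IsElliptic.contDiffAt_hessian (hg : IsElliptic N ε₀ ℓ g) (hN : 2 ≤ N) {ξ : Freq d}
    (hξ : ξ ∈ rectangle ℓ) : ContDiffAt ℝ 2 (hessian g) ξ :=
  (hg.contDiffAt_fderiv hN hξ).fderiv_right (by norm_num)

lemma IsElliptic.hessian_perturbation (hg : IsElliptic N ε₀ ℓ g) (hN : 2 ≤ N) {ξ : Freq d}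
    (hξ : ξ ∈ rectangle ℓ) : hessian (perturbation g) ξ = hessian g ξ - 2 • innerSL ℝ := by
  have h1 : ∀ η ∈ rectangle ℓ,
      fderiv ℝ (perturbation g) η = fderiv ℝ g η - (2 • innerSL ℝ : Freq d →L[ℝ] _) η := by
    intro η hη
    have : fderiv ℝ (perturbation g) η =
        fderiv ℝ g η - fderiv ℝ (fun x : Freq d => ‖x‖ ^ 2) η := by
      refine fderiv_fun_sub ((hg.contDiffAt hN hη).differentiableAt (by norm_num)) ?_
      exact (contDiff_norm_sq ℝ (n := 1)).differentiable (by norm_num) η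
    rw [this, fderiv_norm_sq]; rfl
  have h2 : fderiv ℝ (perturbation g) =ᶠ[𝓝 ξ]
      fun η => fderiv ℝ g η - (2 • innerSL ℝ : Freq d →L[ℝ] _) η := by
    filter_upwards [(isOpen_rectangle ℓ).mem_nhds hξ] with η hη using h1 η hη
  rw [hessian, h2.fderiv_eq, fderiv_fun_sub
    ((hg.contDiffAt_fderiv hN hξ).differentiableAt (by norm_num))
    (ContinuousLinearMap.differentiableAt _), ContinuousLinearMap.fderiv]
  rfl

lemma enorm_iteratedFDeriv_le_cNorm {V : Type*} [NormedAddCommGroup V] [NormedSpace ℝ V]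
    {F : Freq d → V} {U : Set (Freq d)} {n : ℕ} (hn : (n : ℕ∞) ≤ N) (s : Fin n → Fin d)
    {ξ : Freq d} (hξ : ξ ∈ U) :
    ‖iteratedFDeriv ℝ n F ξ (fun i => coordVec (s i))‖ₑ ≤ cNorm N F U :=
  le_iSup_of_le n <| le_iSup_of_le hn <| le_iSup_of_le s <| le_iSup_of_le ξ <|
    le_iSup_of_le hξ le_rfl

lemma norm_le_of_enorm_lt_ofReal {V : Type*} [NormedAddCommGroup V] {x : V} {r : ℝ} (hr : 0 < r)
    (h : ‖x‖ₑ < ENNReal.ofReal r) : ‖x‖ ≤ r := by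
  rw [← ofReal_norm] at h
  exact ((ENNReal.ofReal_lt_ofReal_iff hr).1 h).le

variable {m : Fin d → ℝ}

lemma exists_dilation_eq (hm : ∀ i, 0 < m i) {ξ : Freq d}
    (hξ : ξ ∈ rectangle (fun i => ENNReal.ofReal (m i))) :
    ∃ η ∈ rectangle (fun _ : Fin d => 1), dilation m η = ξ := by
  rw [mem_rectangle_ofReal] at hξ
  refine ⟨WithLp.toLp 2 fun i => ξ i / m i, ?_, ?_⟩
  · have : (fun _ : Fin d => (1 : ℝ≥0∞)) = fun i => ENNReal.ofReal ((fun _ => (1 : ℝ)) i) := by simp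
    rw [this, mem_rectangle_ofReal]
    intro i
    simp only [abs_div, abs_of_pos (hm i)]
    exact (div_lt_one (hm i)).2 (hξ i)
  · ext i
    simp only [dilation]
    exact mul_div_cancel₀ _ (hm i).ne'

lemma norm_le_div_of_norm_fderiv_comp_dilation_le {V : Type*} [NormedAddCommGroup V]
    [NormedSpace ℝ V] {H : Freq d → V} {H' : Freq d →L[ℝ] V} {η : Freq d} {ε : ℝ} {e : Fin d}
    (hme : 0 < m e) (hH : HasFDerivAt H H' (dilation m η))
    (h : ‖fderiv ℝ (fun ξ => H (dilation m ξ)) η (coordVec e)‖ ≤ ε) :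
    ‖H' (coordVec e)‖ ≤ ε / m e := by
  have h5 : HasFDerivAt (fun ξ => H (dilation m ξ)) (H'.comp (dilationL m)) η :=
    HasFDerivAt.comp η (g := H) (f := dilation m) hH (dilationL m).hasFDerivAt
  rw [h5.fderiv, ContinuousLinearMap.comp_apply, dilationL_single, map_smul, norm_smul,
    Real.norm_of_nonneg hme.le] at h
  rwa [le_div_iff₀ hme, mul_comm]

lemma hasFDerivAt_of_eventuallyEq_sub_const {V : Type*} [NormedAddCommGroup V]
    [NormedSpace ℝ V] {A B : Freq d → V} {c : V} {ξ : Freq d} (h : B =ᶠ[𝓝 ξ] fun η => A η - c)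
    (hA : DifferentiableAt ℝ A ξ) : HasFDerivAt B (fderiv ℝ A ξ) ξ :=
  (hA.hasFDerivAt.sub_const c).congr_of_eventuallyEq h

lemma norm_add_two_smul_le {V : Type*} [SeminormedAddCommGroup V] (x y : V) :
    ‖x + 2 • y‖ ≤ ‖x‖ + 2 * ‖y‖ := by
  rw [two_smul]
  linarith [norm_add_le x (y + y), norm_add_le y y]

lemma IsElliptic.norm_hessian_perturbation_le (hg : IsElliptic N ε₀ ℓ g) (hε : 0 < ε₀)
    (hm : ∀ i, 0 < m i) (hmℓ : rectangle (fun i => ENNReal.ofReal (m i)) ⊆ rectangle ℓ)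
    {ξ : Freq d} (hξ : ξ ∈ rectangle (fun i => ENNReal.ofReal (m i))) :
    ‖hessian (perturbation g) ξ‖ ≤ ε₀ := by
  obtain ⟨η, hη, rfl⟩ := exists_dilation_eq hm hξ
  have := (enorm_iteratedFDeriv_le_cNorm (N := N) (n := 0)
    (F := fun ξ => hessian (perturbation g) (dilation m ξ)) (by simp)
    (fun i => i.elim0) hη).trans_lt (hg.bound m hm hmℓ)
  rw [iteratedFDeriv_zero_apply] at this
  exact norm_le_of_enorm_lt_ofReal hε this

/-- The dilation multiplies an e-derivative by `m e`, so the scaled norm gains this factor; D²g and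
D²h have the same derivatives because they differ by a constant. -/
lemma IsElliptic.norm_fderiv_hessian_le (hg : IsElliptic N ε₀ ℓ g) (hN : 2 ≤ N) (hε : 0 < ε₀)
    (hm : ∀ i, 0 < m i) (hmℓ : rectangle (fun i => ENNReal.ofReal (m i)) ⊆ rectangle ℓ)
    {ξ : Freq d} (hξ : ξ ∈ rectangle (fun i => ENNReal.ofReal (m i))) (e : Fin d) :
    ‖fderiv ℝ (hessian g) ξ (coordVec e)‖ ≤ ε₀ / m e := by
  obtain ⟨η, hη, rfl⟩ := exists_dilation_eq hm hξ
  have h1 := (enorm_iteratedFDeriv_le_cNorm (N := N) (n := 1)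
    (F := fun ξ => hessian (perturbation g) (dilation m ξ)) (le_trans (by norm_num) hN)
    (fun _ => e) hη).trans_lt (hg.bound m hm hmℓ)
  rw [iteratedFDeriv_one_apply] at h1
  have h2 := norm_le_of_enorm_lt_ofReal hε h1
  have h3 : hessian (perturbation g) =ᶠ[𝓝 (dilation m η)] fun ξ => hessian g ξ - 2 • innerSL ℝ := by
    filter_upwards [(isOpen_rectangle ℓ).mem_nhds (hmℓ hξ)] with ζ hζ
      using hg.hessian_perturbation hN hζ
  have hdiff : DifferentiableAt ℝ (hessian g) (dilation m η) :=
    (hg.contDiffAt_hessian hN (hmℓ hξ)).differentiableAt (by norm_num)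
  exact norm_le_div_of_norm_fderiv_comp_dilation_le (hm e)
    (hasFDerivAt_of_eventuallyEq_sub_const h3 hdiff) h2

variable (hg : IsElliptic N ε₀ ℓ g) (hN : 2 ≤ N) (hε : 0 < ε₀) (hε' : ε₀ < 1)
  (hm : ∀ i, 0 < m i) (hmℓ : rectangle (fun i => ENNReal.ofReal (m i)) ⊆ rectangle ℓ)

include hg hN hε hε' hm hmℓ

lemma IsElliptic.norm_hessian_le {ξ : Freq d}
    (hξ : ξ ∈ rectangle (fun i => ENNReal.ofReal (m i))) : ‖hessian g ξ‖ ≤ 3 := by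
  have h1 := hg.hessian_perturbation hN (hmℓ hξ)
  have h2 := hg.norm_hessian_perturbation_le hε hm hmℓ hξ
  have h3 : hessian g ξ = hessian (perturbation g) ξ + 2 • innerSL ℝ := by rw [h1]; abel
  have h4 : ‖(innerSL ℝ : Freq d →L[ℝ] Freq d →L[ℝ] ℝ)‖ ≤ 1 := norm_innerSL_le ℝ
  have h5 := norm_add_two_smul_le (hessian (perturbation g) ξ)
    (innerSL ℝ : Freq d →L[ℝ] Freq d →L[ℝ] ℝ)
  rw [h3]
  linarith

/-- The diagonal entry is 2 up to an error at most ε₀ < 1. It makes the tubes of a block diverge in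
the coordinate e, which controls their intersections. -/
lemma IsElliptic.one_le_hessian_coordVec {ξ : Freq d}
    (hξ : ξ ∈ rectangle (fun i => ENNReal.ofReal (m i))) (e : Fin d) :
    1 ≤ hessian g ξ (coordVec e) (coordVec e) := by
  have h1 := hg.hessian_perturbation hN (hmℓ hξ)
  have h2 := hg.norm_hessian_perturbation_le hε hm hmℓ hξ
  have h3 : hessian g ξ = hessian (perturbation g) ξ + 2 • innerSL ℝ := by rw [h1]; abel
  have h4 : |hessian (perturbation g) ξ (coordVec e) (coordVec e)| ≤ 1 := by
    rw [← Real.norm_eq_abs]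
    refine (ContinuousLinearMap.le_opNorm₂ _ _ _).trans ?_
    simp only [coordVec, PiLp.norm_single, norm_one, mul_one]
    linarith
  have h5 : hessian g ξ (coordVec e) (coordVec e) =
      hessian (perturbation g) ξ (coordVec e) (coordVec e) + 2 := by
    have h6 : innerSL ℝ (coordVec e) (coordVec e) = (1 : ℝ) := by
      rw [innerSL_apply_apply]; simp [coordVec]
    have h7 : hessian g ξ (coordVec e) (coordVec e) =
      hessian (perturbation g) ξ (coordVec e) (coordVec e) +
        (2 : ℕ) • innerSL ℝ (coordVec e) (coordVec e) := by rw [h3]; rfl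
    rw [h7, h6]; norm_num
  rw [h5]; linarith [(abs_le.1 h4).1]

lemma IsElliptic.abs_hessian_coordVec_le {ξ : Freq d}
    (hξ : ξ ∈ rectangle (fun i => ENNReal.ofReal (m i))) (e i : Fin d) :
    |hessian g ξ (coordVec e) (coordVec i)| ≤ 3 := by
  rw [← Real.norm_eq_abs]
  refine (ContinuousLinearMap.le_opNorm₂ _ _ _).trans ?_
  simp only [coordVec, PiLp.norm_single, norm_one, mul_one]
  exact hg.norm_hessian_le hN hε hε' hm hmℓ hξ

lemma IsElliptic.taylor_value {ξ η : Freq d}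
    (hξ : ξ ∈ rectangle (fun i => ENNReal.ofReal (m i)))
    (hη : η ∈ rectangle (fun i => ENNReal.ofReal (m i))) :
    |g η - g ξ - fderiv ℝ g ξ (η - ξ)| ≤ 3 * ‖η - ξ‖ ^ 2 := by
  have hseg : segment ℝ ξ η ⊆ rectangle (fun i => ENNReal.ofReal (m i)) :=
    (convex_rectangle_ofReal m).segment_subset hξ hη
  have hlip : ∀ x ∈ segment ℝ ξ η, ‖fderiv ℝ g x - fderiv ℝ g ξ‖ ≤ 3 * ‖η - ξ‖ := by
    intro x hx
    have h1 := (convex_rectangle_ofReal m).norm_image_sub_le_of_norm_fderiv_le (𝕜 := ℝ)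
      (f := fderiv ℝ g) (C := 3)
      (fun y hy => (hg.contDiffAt_fderiv hN (hmℓ hy)).differentiableAt (by norm_num))
      (fun y hy => hg.norm_hessian_le hN hε hε' hm hmℓ hy) hξ (hseg hx)
    refine h1.trans ?_
    gcongr
    exact norm_sub_le_of_mem_segment hx
  have h2 := (convex_segment ξ η).norm_image_sub_le_of_norm_hasFDerivWithin_le'
    (𝕜 := ℝ) (f := g) (f' := fderiv ℝ g) (φ := fderiv ℝ g ξ)
    (fun x hx => ((hg.contDiffAt hN (hmℓ (hseg hx))).differentiableAt
      (by norm_num)).hasFDerivAt.hasFDerivWithinAt)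
    hlip (left_mem_segment ℝ ξ η) (right_mem_segment ℝ ξ η)
  rw [Real.norm_eq_abs] at h2
  refine h2.trans (le_of_eq (by ring))

/-- Displacement along a single axis involves only the e-derivative of the Hessian, so the error is
governed by `m e` alone, however short the other sides are. -/
lemma IsElliptic.taylor_gradient {ξ : Freq d} {s : ℝ} (hs : 0 ≤ s) (e : Fin d)
    (hξ : ξ ∈ rectangle (fun i => ENNReal.ofReal (m i)))
    (hη : ξ + s • coordVec e ∈ rectangle (fun i => ENNReal.ofReal (m i))) :
    ‖fderiv ℝ g (ξ + s • coordVec e) - fderiv ℝ g ξ - s • hessian g ξ (coordVec e)‖ ≤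
      s ^ 2 / m e := by
  have hme := hm e
  have hseg : ∀ r ∈ Set.Icc 0 s,
      ξ + r • coordVec e ∈ rectangle (fun i => ENNReal.ofReal (m i)) := by
    intro r hr
    rcases hs.eq_or_lt with h | h
    · have : r = 0 := le_antisymm (h ▸ hr.2) hr.1
      simpa [this] using hξ
    · have := (convex_rectangle_ofReal m).add_smul_sub_mem hξ hη (t := r / s)
        ⟨by have := hr.1; positivity, (div_le_one h).2 hr.2⟩
      rwa [add_sub_cancel_left, smul_smul, div_mul_cancel₀ _ h.ne'] at this
  have hline : ∀ r, HasDerivAt (fun r : ℝ => ξ + r • coordVec e) (coordVec e) r := by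
    intro r
    simpa using ((hasDerivAt_id r).smul_const (coordVec e)).const_add ξ
  have h1 : ∀ r ∈ Set.Icc 0 s, ‖hessian g (ξ + r • coordVec e) - hessian g ξ‖ ≤ s / m e := by
    intro r hr
    have h := (convex_Icc 0 s).norm_image_sub_le_of_norm_hasDerivWithin_le
      (f := fun r : ℝ => hessian g (ξ + r • coordVec e))
      (f' := fun r => fderiv ℝ (hessian g) (ξ + r • coordVec e) (coordVec e)) (C := 1 / m e)
      (fun x hx => (HasFDerivAt.comp_hasDerivAt x (l := hessian g)
        ((hg.contDiffAt_hessian hN (hmℓ (hseg x hx))).differentiableAt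
        (by norm_num)).hasFDerivAt (hline x)).hasDerivWithinAt)
      (fun x hx => (hg.norm_fderiv_hessian_le hN hε hm hmℓ (hseg x hx) e).trans (by gcongr))
      (Set.left_mem_Icc.2 hs) hr
    simp only [zero_smul, add_zero, sub_zero, Real.norm_of_nonneg hr.1] at h
    refine h.trans ?_
    rw [one_div_mul_eq_div]
    gcongr
    exact hr.2
  have h := (convex_Icc 0 s).norm_image_sub_le_of_norm_hasDerivWithin_le
      (f := fun r : ℝ => fderiv ℝ g (ξ + r • coordVec e) - r • hessian g ξ (coordVec e))
      (f' := fun r => hessian g (ξ + r • coordVec e) (coordVec e) -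
        (1 : ℝ) • hessian g ξ (coordVec e)) (C := s / m e)
      (fun x hx => ((((hg.contDiffAt_fderiv hN (hmℓ (hseg x hx))).differentiableAt
        (by norm_num)).hasFDerivAt.comp_hasDerivAt x (hline x)).sub
        ((hasDerivAt_id x).smul_const _)).hasDerivWithinAt)
      (fun x hx => ?_) (Set.left_mem_Icc.2 hs) (Set.right_mem_Icc.2 hs)
  · simp only [zero_smul, add_zero, sub_zero, Real.norm_of_nonneg hs] at h
    calc _ = ‖fderiv ℝ g (ξ + s • coordVec e) - s • hessian g ξ (coordVec e) - fderiv ℝ g ξ‖ := by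
          congr 1; abel
      _ ≤ s / m e * s := h
      _ = _ := by ring
  · rw [one_smul]
    refine (ContinuousLinearMap.le_opNorm
      (hessian g (ξ + x • coordVec e) - hessian g ξ) (coordVec e)).trans ?_
    simp only [coordVec, PiLp.norm_single, norm_one, mul_one]
    exact h1 x hx

end Taylor

/-! ### Wave packets and their tubes -/

section WavePacket

variable {d : ℕ}

/-- The half-open box with lower corner `η` and sides `σ`. -/
def cell (η : Freq d) (σ : Fin d → ℝ) : Set (Freq d) :=
  {ξ | ∀ i, ξ i ∈ Set.Ico (η i) (η i + σ i)}

lemma cell_eq_preimage (η : Freq d) (σ : Fin d → ℝ) :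
    cell η σ = (MeasurableEquiv.toLp 2 (Fin d → ℝ)).symm ⁻¹'
      (Set.univ.pi fun i => Set.Ico (η i) (η i + σ i)) := by
  ext ξ
  simp only [cell, Set.mem_preimage, Set.mem_univ_pi]
  rfl

lemma measurableSet_cell (η : Freq d) (σ : Fin d → ℝ) : MeasurableSet (cell η σ) := by
  rw [cell_eq_preimage]
  exact (MeasurableEquiv.toLp 2 (Fin d → ℝ)).symm.measurable
    (MeasurableSet.univ_pi fun i => measurableSet_Ico)

lemma volume_cell (η : Freq d) {σ : Fin d → ℝ} (hσ : ∀ i, 0 ≤ σ i) :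
    volume (cell η σ) = ENNReal.ofReal (∏ i, σ i) := by
  rw [cell_eq_preimage,
    (EuclideanSpace.volume_preserving_symm_measurableEquiv_toLp (Fin d)).measure_preimage
    (MeasurableSet.univ_pi fun i => measurableSet_Ico).nullMeasurableSet, volume_pi_pi,
    ENNReal.ofReal_prod_of_nonneg fun i _ => hσ i]
  refine Finset.prod_congr rfl fun i _ => ?_
  rw [Real.volume_Ico]; congr 1; ring

/-- The indicator of `C` modulated so that its extension is translated by `y` in space. -/
noncomputable def wavePacket (C : Set (Freq d)) (y : Freq d) : Freq d → ℂ :=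
  C.indicator fun ξ => Complex.exp (Complex.I * ((-inner ℝ y ξ : ℝ) : ℂ))

lemma measurable_wavePacket {C : Set (Freq d)} (hC : MeasurableSet C) (y : Freq d) :
    Measurable (wavePacket C y) := by
  refine Measurable.indicator (Continuous.measurable ?_) hC
  fun_prop

lemma norm_wavePacket_le (C : Set (Freq d)) (y ξ : Freq d) :
    ‖wavePacket C y ξ‖ ≤ C.indicator (fun _ => (1 : ℝ)) ξ := by
  by_cases h : ξ ∈ C
  · rw [wavePacket, Set.indicator_of_mem h, Set.indicator_of_mem h, mul_comm,
      Complex.norm_exp_ofReal_mul_I]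
  · simp [wavePacket, h]

variable {ℓ : Fin d → ℝ≥0∞} {g : Freq d → ℝ}

/-- There is no cancellation when the phase stays within 1 of a constant: after removing that
constant, the real part of the integrand is at least 1 - 1/2. -/
lemma le_norm_extOp_wavePacket (hg : ContinuousOn g (rectangle ℓ)) {C : Set (Freq d)}
    (hC : MeasurableSet C) (hC' : volume C ≠ ∞) (hCℓ : C ⊆ rectangle ℓ) (y x : Freq d) (t φ₀ : ℝ)
    (hφ : ∀ ξ ∈ C, |t * g ξ + inner ℝ (x - y) ξ - φ₀| ≤ 1) :
    (volume C).toReal / 2 ≤ ‖extOp ℓ g (wavePacket C y) (t, x)‖ := by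
  set θ : Freq d → ℝ := fun ξ => t * g ξ + inner ℝ (x - y) ξ - φ₀ with hθ
  have hθc : ContinuousOn θ C :=
    ((continuousOn_const.mul (hg.mono hCℓ)).add (by fun_prop)).sub continuousOn_const
  have h1 : extOp ℓ g (wavePacket C y) (t, x) =
      Complex.exp (Complex.I * φ₀) * ∫ ξ in C, Complex.exp (Complex.I * (θ ξ : ℂ)) := by
    have : ∀ ξ, Complex.exp (Complex.I * ((t * g ξ + inner ℝ x ξ : ℝ) : ℂ)) * wavePacket C y ξ =
        C.indicator (fun ξ => Complex.exp (Complex.I * φ₀) *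
          Complex.exp (Complex.I * (θ ξ : ℂ))) ξ := by
      intro ξ
      by_cases h : ξ ∈ C
      · rw [wavePacket, Set.indicator_of_mem h, Set.indicator_of_mem h, ← Complex.exp_add,
          ← Complex.exp_add]
        congr 1
        rw [hθ]
        simp only [inner_sub_left]
        push_cast
        ring
      · simp [wavePacket, h]
    simp only [extOp]
    simp_rw [this]
    rw [integral_indicator hC, Measure.restrict_restrict hC, Set.inter_eq_self_of_subset_left hCℓ,
      integral_const_mul]
  rw [h1, norm_mul, mul_comm Complex.I, Complex.norm_exp_ofReal_mul_I, one_mul]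
  refine le_trans ?_ (Complex.re_le_norm _)
  have hint : IntegrableOn (fun ξ => Complex.exp (Complex.I * (θ ξ : ℂ))) C := by
    refine Integrable.mono' (integrableOn_const (C := (1 : ℝ)) hC')
      (ContinuousOn.aestronglyMeasurable (by fun_prop) hC) (Eventually.of_forall fun ξ => ?_)
    rw [mul_comm, Complex.norm_exp_ofReal_mul_I]
  have h2 : (∫ ξ in C, Complex.exp (Complex.I * (θ ξ : ℂ))).re = ∫ ξ in C, Real.cos (θ ξ) := by
    have h := integral_re (𝕜 := ℂ) hint
    refine Eq.trans h.symm (integral_congr_ae (Eventually.of_forall fun ξ => ?_))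
    simp only [mul_comm Complex.I]
    exact Complex.exp_ofReal_mul_I_re _
  rw [h2]
  have h3 : ∀ ξ ∈ C, (1 / 2 : ℝ) ≤ Real.cos (θ ξ) := by
    intro ξ hξ
    have := Real.one_sub_sq_div_two_le_cos (x := θ ξ)
    have h4 : θ ξ ^ 2 ≤ 1 := by
      rw [← sq_abs]; exact pow_le_one₀ (abs_nonneg _) (hφ ξ hξ)
    linarith
  have hcos : IntegrableOn (fun ξ => Real.cos (θ ξ)) C := by
    refine Integrable.mono' (integrableOn_const (C := (1 : ℝ)) hC')
      (ContinuousOn.aestronglyMeasurable (Real.continuous_cos.comp_continuousOn hθc) hC)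
      (Eventually.of_forall fun ξ => Real.abs_cos_le_one _)
  calc (volume C).toReal / 2 = ∫ _ξ in C, (1 / 2 : ℝ) := by
        rw [setIntegral_const, measureReal_def, smul_eq_mul]; ring
    _ ≤ _ := setIntegral_mono_on (integrableOn_const hC') hcos hC h3

variable {N : ℕ∞} {ε₀ : ℝ} {m : Fin d → ℝ}

lemma continuousLinearMap_apply_eq_sum (L : Freq d →L[ℝ] ℝ) (x : Freq d) :
    L x = ∑ i, x i * L (coordVec i) := by
  conv_lhs => rw [← (EuclideanSpace.basisFun (Fin d) ℝ).sum_repr x, map_sum]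
  refine Finset.sum_congr rfl fun i _ => ?_
  simp [coordVec]

/-- The extension of a wave packet over a small cell is large on a tube whose direction is the
linearised normal direction at the cell. -/
lemma IsElliptic.prod_div_two_le_norm_extOp (hg : IsElliptic N ε₀ ℓ g) (hN : 2 ≤ N) (hε : 0 < ε₀)
    (hε' : ε₀ < 1) (hm : ∀ i, 0 < m i)
    (hmℓ : rectangle (fun i => ENNReal.ofReal (m i)) ⊆ rectangle ℓ) (hd : 0 < d)
    {e : Fin d} {lam s : ℝ} (hlam : 0 < lam) (hs : 0 ≤ s) (hs' : s ^ 2 ≤ lam * m e)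
    {σ : Fin d → ℝ} (hσ : ∀ i, 0 < σ i) (hσ' : ∀ i, σ i ≤ lam) {ξ₀ : Freq d}
    (hξ₀ : ξ₀ ∈ rectangle (fun i => ENNReal.ofReal (m i)))
    (hcell : cell (ξ₀ + s • coordVec e) σ ⊆ rectangle (fun i => ENNReal.ofReal (m i)))
    {t : ℝ} (ht : t ∈ Set.Icc 0 (1 / (5 * d) / lam ^ 2)) {x y : Freq d}
    (hxy : ∀ i, |x i - y i + t * (fderiv ℝ g ξ₀ (coordVec i) +
      s * hessian g ξ₀ (coordVec e) (coordVec i))| ≤ 1 / (5 * d) / σ i) :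
    (∏ i, σ i) / 2 ≤ ‖extOp ℓ g (wavePacket (cell (ξ₀ + s • coordVec e) σ) y) (t, x)‖ := by
  set η := ξ₀ + s • coordVec e with hη
  set κ : ℝ := 1 / (5 * d) with hκ
  have hd' : (0 : ℝ) < d := by exact_mod_cast hd
  have hκ0 : 0 < κ := by positivity
  have hηm : η ∈ rectangle (fun i => ENNReal.ofReal (m i)) :=
    hcell fun i => ⟨le_rfl, by linarith [hσ i]⟩
  have hgc : ContinuousOn g (rectangle ℓ) := hg.contDiffOn.continuousOn
  have hvol := volume_cell η fun i => (hσ i).le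
  have hP : 0 ≤ ∏ i, σ i := Finset.prod_nonneg fun i _ => (hσ i).le
  have := le_norm_extOp_wavePacket hgc (measurableSet_cell η σ) (by rw [hvol]; finiteness)
    (hcell.trans hmℓ) y x t (t * g η + inner ℝ (x - y) η) ?_
  · rwa [hvol, ENNReal.toReal_ofReal hP] at this
  intro ξ hξ
  have hδ0 : ∀ i, 0 ≤ (ξ - η) i := fun i => by
    have := (hξ i).1
    simp only [PiLp.sub_apply]; linarith
  have hδ1 : ∀ i, (ξ - η) i ≤ σ i := fun i => by
    have := (hξ i).2
    simp only [PiLp.sub_apply]; linarith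
  have hnorm : ‖ξ - η‖ ^ 2 ≤ d * lam ^ 2 := by
    rw [EuclideanSpace.norm_sq_eq]
    calc _ ≤ ∑ _i : Fin d, lam ^ 2 := Finset.sum_le_sum fun i _ => by
            rw [Real.norm_eq_abs, sq_abs]
            exact pow_le_pow_left₀ (hδ0 i) ((hδ1 i).trans (hσ' i)) 2
      _ = _ := by simp
  have htay := hg.taylor_value hN hε hε' hm hmℓ hηm (hcell hξ)
  have hgrad := hg.taylor_gradient hN hε hε' hm hmℓ hs e hξ₀ hηm
  -- The phase budget 1 is split as 3/5 + 2/5: the quadratic remainder costs 3dκ and the linear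
  -- terms cost 2dκ, with κ = 1/(5d).
  have hA : |t * (g ξ - g η - fderiv ℝ g η (ξ - η))| ≤ 3 / 5 := by
    rw [abs_mul, abs_of_nonneg ht.1]
    calc t * _ ≤ κ / lam ^ 2 * (3 * (d * lam ^ 2)) := by
          refine mul_le_mul ht.2 (htay.trans (by linarith)) (abs_nonneg _) (by positivity)
      _ = 3 / 5 := by rw [hκ]; field_simp
  -- One κ/σ_i is the width of the tube; the other pays for replacing the true gradient by its
  -- linearisation, an error at most λ during a time at most κ/λ².
  have hcoord : ∀ i, |x i - y i + t * fderiv ℝ g η (coordVec i)| ≤ 2 * κ / σ i := by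
    intro i
    have h1 : |fderiv ℝ g η (coordVec i) - (fderiv ℝ g ξ₀ (coordVec i) +
        s * hessian g ξ₀ (coordVec e) (coordVec i))| ≤ lam := by
      have h2 : fderiv ℝ g η (coordVec i) - (fderiv ℝ g ξ₀ (coordVec i) +
          s * hessian g ξ₀ (coordVec e) (coordVec i)) =
          (fderiv ℝ g η - fderiv ℝ g ξ₀ - s • hessian g ξ₀ (coordVec e)) (coordVec i) := by
        change _ = fderiv ℝ g η (coordVec i) - fderiv ℝ g ξ₀ (coordVec i) -
          s * hessian g ξ₀ (coordVec e) (coordVec i)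
        ring
      rw [h2, ← Real.norm_eq_abs]
      refine (ContinuousLinearMap.le_opNorm _ _).trans ?_
      simp only [coordVec, PiLp.norm_single, norm_one, mul_one]
      refine hgrad.trans ?_
      rw [div_le_iff₀ (hm e)]; exact hs'
    have h3 : |t * (fderiv ℝ g η (coordVec i) - (fderiv ℝ g ξ₀ (coordVec i) +
        s * hessian g ξ₀ (coordVec e) (coordVec i)))| ≤ κ / σ i := by
      rw [abs_mul, abs_of_nonneg ht.1]
      calc _ ≤ κ / lam ^ 2 * lam := mul_le_mul ht.2 h1 (abs_nonneg _) (by positivity)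
        _ = κ / lam := by field_simp
        _ ≤ κ / σ i := by gcongr; exacts [hσ i, hσ' i]
    calc _ = |(x i - y i + t * (fderiv ℝ g ξ₀ (coordVec i) +
          s * hessian g ξ₀ (coordVec e) (coordVec i))) +
          t * (fderiv ℝ g η (coordVec i) - (fderiv ℝ g ξ₀ (coordVec i) +
          s * hessian g ξ₀ (coordVec e) (coordVec i)))| := by congr 1; ring
      _ ≤ κ / σ i + κ / σ i := (abs_add_le _ _).trans (add_le_add (hxy i) h3)
      _ = _ := by ring
  have hsplit : t * g ξ + inner ℝ (x - y) ξ - (t * g η + inner ℝ (x - y) η) =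
      t * (g ξ - g η - fderiv ℝ g η (ξ - η)) +
      ∑ i, (ξ - η) i * (x i - y i + t * fderiv ℝ g η (coordVec i)) := by
    have h1 : inner ℝ (x - y) ξ - inner ℝ (x - y) η = ∑ i, (ξ - η) i * (x i - y i) := by
      rw [← inner_sub_right, PiLp.inner_apply]
      simp [mul_comm]
    simp_rw [mul_add]
    rw [Finset.sum_add_distrib, ← h1, continuousLinearMap_apply_eq_sum (fderiv ℝ g η) (ξ - η)]
    have h2 : ∑ i, (ξ - η) i * (t * fderiv ℝ g η (coordVec i)) =
        t * ∑ i, (ξ - η) i * fderiv ℝ g η (coordVec i) := by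
      rw [Finset.mul_sum]; exact Finset.sum_congr rfl fun i _ => by ring
    rw [h2]; ring
  have hB : |∑ i, (ξ - η) i * (x i - y i + t * fderiv ℝ g η (coordVec i))| ≤ 2 / 5 := by
    refine (Finset.abs_sum_le_sum_abs _ _).trans ?_
    calc _ ≤ ∑ _i : Fin d, 2 * κ := Finset.sum_le_sum fun i _ => by
            rw [abs_mul, abs_of_nonneg (hδ0 i)]
            calc _ ≤ σ i * (2 * κ / σ i) :=
                  mul_le_mul (hδ1 i) (hcoord i) (abs_nonneg _) (hσ i).le
              _ = _ := by have := (hσ i).ne'; field_simp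
      _ = 2 / 5 := by simp [hκ]; field_simp
  rw [hsplit]
  refine (abs_add_le _ _).trans ?_
  linarith

end WavePacket

/-! ### Intersections and union of the Kakeya tubes -/

section KakeyaTubes

variable {d : ℕ}

/-- A tube of length `T` and half-sides `r`, sheared along `v` as the `n`-th Kakeya line. -/
noncomputable def kakeyaTube (T ρ : ℝ) (r : Fin d → ℝ) (c : ℝ → Freq d) (v : Freq d) (D n : ℕ) :
    Set (ℝ × Freq d) :=
  shearedBox (Set.Icc 0 T) (fun t => c t - (kakeyaLine D n (t / T) * ρ) • v) r

variable {T ρ : ℝ} {r : Fin d → ℝ} {c : ℝ → Freq d} {v : Freq d}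

lemma continuous_kakeyaTube_center (hc : Continuous c) (D n : ℕ) :
    Continuous fun t => c t - (kakeyaLine D n (t / T) * ρ) • v := by
  have := (continuous_kakeyaLine D n).comp (continuous_id.div_const T)
  exact hc.sub ((this.mul continuous_const).smul continuous_const)

lemma measurableSet_kakeyaTube (hc : Continuous c) (D n : ℕ) :
    MeasurableSet (kakeyaTube T ρ r c v D n) :=
  measurableSet_shearedBox measurableSet_Icc (continuous_kakeyaTube_center hc D n) r

lemma volume_kakeyaTube (hT : 0 < T) (hr : ∀ i, 0 < r i) (hc : Continuous c) (D n : ℕ) :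
    volume (kakeyaTube T ρ r c v D n) = ENNReal.ofReal (T * ∏ i, (2 * r i)) := by
  rw [kakeyaTube, volume_shearedBox measurableSet_Icc (continuous_kakeyaTube_center hc D n)
    fun i => (hr i).le, Real.volume_Icc, sub_zero, ENNReal.ofReal_mul hT.le]

lemma volume_kakeyaTube_inter_le (hT : 0 < T) (hρ : 0 < ρ) (hr : ∀ i, 0 < r i) {e : Fin d}
    (hre : r e = ρ) (hve : 1 ≤ v e) (hc : Continuous c) (D n k : ℕ) :
    volume (kakeyaTube T ρ r c v D n ∩ kakeyaTube T ρ r c v D k) ≤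
      ENNReal.ofReal ((if n = k then (1 : ℝ) else 4 / |(n : ℝ) - k|) * (T * ∏ i, (2 * r i))) := by
  split_ifs with h
  · rw [h, Set.inter_self, volume_kakeyaTube hT hr hc, one_mul]
  have hprod : 0 ≤ ∏ i, (2 * r i) := Finset.prod_nonneg fun i _ => by have := hr i; positivity
  have hnk : (0 : ℝ) < |(n : ℝ) - k| := abs_pos.2 (sub_ne_zero.2 (by exact_mod_cast h))
  -- The difference of the two lines is affine of slope n - k and vanishes at -b. As `v e` is at
  -- least 1, the tubes meet only while this difference is at most 2, that is, within δ of -b.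
  set b := (kakeyaLine D n 0 - kakeyaLine D k 0) / ((n : ℝ) - k) with hb
  set δ := 2 / |(n : ℝ) - k| with hδ
  have hsub : kakeyaTube T ρ r c v D n ∩ kakeyaTube T ρ r c v D k ⊆
      shearedBox (Set.Icc (T * (-b - δ)) (T * (-b + δ)))
        (fun t => c t - (kakeyaLine D n (t / T) * ρ) • v) r := by
    rintro z ⟨h1, h2⟩
    refine ⟨?_, h1.2⟩
    have h3 := h1.2 e
    have h4 := h2.2 e
    simp only [PiLp.sub_apply, PiLp.smul_apply, smul_eq_mul, hre] at h3 h4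
    set w := kakeyaLine D n (z.1 / T) - kakeyaLine D k (z.1 / T) with hw
    have h5 : |w| * (ρ * v e) ≤ 2 * ρ := by
      rw [← abs_of_nonneg (by positivity : 0 ≤ ρ * v e), ← abs_mul]
      calc |w * (ρ * v e)| = |(z.2 e - (c z.1 e - kakeyaLine D n (z.1 / T) * ρ * v e)) -
            (z.2 e - (c z.1 e - kakeyaLine D k (z.1 / T) * ρ * v e))| := by
              congr 1; rw [hw]; ring
        _ ≤ ρ + ρ := (abs_sub _ _).trans (add_le_add h3 h4)
        _ = _ := by ring
    have h6 : |w| ≤ 2 := by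
      have : |w| * ρ ≤ |w| * (ρ * v e) :=
        mul_le_mul_of_nonneg_left (le_mul_of_one_le_right hρ.le hve) (abs_nonneg _)
      nlinarith
    have h7 : w = ((n : ℝ) - k) * (z.1 / T + b) := by
      rw [hb, mul_add, mul_div_cancel₀ _ (abs_pos.1 hnk), hw]
      simp only [kakeyaLine]; ring
    have h8 : |z.1 / T + b| ≤ δ := by
      rw [hδ, le_div_iff₀ hnk, mul_comm, ← abs_mul, ← h7]; exact h6
    obtain ⟨h9, h10⟩ := abs_le.1 h8
    have h11 : z.1 = T * (z.1 / T) := by field_simp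
    constructor
    · rw [h11]; gcongr; linarith
    · rw [h11]; gcongr; linarith
  refine (measure_mono hsub).trans ?_
  rw [volume_shearedBox measurableSet_Icc (continuous_kakeyaTube_center hc D n)
    fun i => (hr i).le, Real.volume_Icc, ← ENNReal.ofReal_mul' hprod]
  refine ENNReal.ofReal_le_ofReal (le_of_eq ?_)
  rw [hδ]; ring

/-- The union of `2 ^ μ` tubes in Keich's arrangement is smaller than the sum of their volumes by
a factor of order `μ + 1`. -/
lemma volume_iUnion_kakeyaTube_le (hT : 0 < T) (hρ : 0 < ρ) (hr : ∀ i, ρ ≤ r i)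
    (hv : ∀ i, |v i| ≤ 3) (hc : Continuous c) (μ : ℕ) :
    volume (⋃ n : Fin (2 ^ μ), kakeyaTube T ρ r c v (μ + 1) n) ≤
      ENNReal.ofReal (4 ^ d * 10 * 2 ^ μ / (μ + 1) * (T * ∏ i, (2 * r i))) := by
  have hr0 : ∀ i, 0 < r i := fun i => hρ.trans_le (hr i)
  have hprod : 0 ≤ ∏ i, (2 * r i) := Finset.prod_nonneg fun i _ => by have := hr0 i; positivity
  set D := μ + 1 with hDdef
  have hD : (0 : ℝ) < (D : ℕ) := by positivity
  set R : ℕ → ℕ := fun j => 2 ^ (μ + 1 - j) / (μ + 1) + 1 with hR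
  -- Replacing a line by a covering one moves the centre by at most ρ in the parameter along v,
  -- hence by at most 3ρ ≤ 3 r_i in each coordinate. This is why the half-sides are multiplied by 4.
  set U : ℕ → ℕ → ℤ → Set (ℝ × Freq d) := fun j i k =>
    shearedBox (Set.Icc (T * (j / D)) (T * ((j + 1) / D)))
      (fun t => c t - ((kakeyaLine D (2 ^ (μ + 1 - j) * i) (t / T) + k) * ρ) • v)
      (fun i => 4 * r i) with hU
  have hcov : (⋃ n : Fin (2 ^ μ), kakeyaTube T ρ r c v D n) ⊆
      ⋃ j ∈ Finset.range (μ + 1), ⋃ i ∈ Finset.range (2 ^ j),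
        ⋃ k ∈ Finset.Icc (-(R j : ℤ)) (R j : ℤ), U j i k := by
    intro z hz
    obtain ⟨n, hn⟩ := Set.mem_iUnion.1 hz
    have hτ : z.1 / T ∈ Set.Icc (0 : ℝ) 1 :=
      ⟨div_nonneg hn.1.1 hT.le, (div_le_one hT).2 hn.1.2⟩
    obtain ⟨j, hj, i, hi, k, hk, hjτ, hclose⟩ := exists_kakeyaLine_mem n.2 hτ
    simp only [Set.mem_iUnion]
    have h11 : z.1 = T * (z.1 / T) := by field_simp
    refine ⟨j, hj, i, hi, k, hk, ⟨?_, ?_⟩, fun a => ?_⟩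
    · rw [h11]; exact mul_le_mul_of_nonneg_left hjτ.1 hT.le
    · rw [h11]; exact mul_le_mul_of_nonneg_left hjτ.2 hT.le
    · have h1 := hn.2 a
      simp only [PiLp.sub_apply, PiLp.smul_apply, smul_eq_mul] at h1 ⊢
      set w := kakeyaLine D n (z.1 / T)
      set w' := kakeyaLine D (2 ^ (μ + 1 - j) * i) (z.1 / T) + k
      have h2 : |(w - w') * ρ * v a| ≤ 3 * r a := by
        rw [abs_mul, abs_mul, abs_of_pos hρ]
        calc _ ≤ 1 * ρ * 3 := by
              gcongr
              exact hv a
          _ ≤ _ := by linarith [hr a]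
      calc _ = |(z.2 a - (c z.1 a - w * ρ * v a)) - (w - w') * ρ * v a| := by congr 1; ring
        _ ≤ r a + 3 * r a := (abs_sub _ _).trans (add_le_add h1 h2)
        _ = _ := by ring
  have hUvol : ∀ j i k, volume (U j i k) =
      ENNReal.ofReal (4 ^ d / D * (T * ∏ i, (2 * r i))) := by
    intro j i k
    have hcont : Continuous fun t =>
        c t - ((kakeyaLine D (2 ^ (μ + 1 - j) * i) (t / T) + k) * ρ) • v := by
      have := (continuous_kakeyaLine D (2 ^ (μ + 1 - j) * i)).comp (continuous_id.div_const T)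
      exact hc.sub (((this.add continuous_const).mul continuous_const).smul continuous_const)
    rw [hU, volume_shearedBox measurableSet_Icc hcont fun i => by have := hr0 i; positivity,
      Real.volume_Icc, ← ENNReal.ofReal_mul' (Finset.prod_nonneg fun i _ => by
        have := hr0 i; positivity)]
    congr 1
    have : ∏ i, (2 * (4 * r i)) = 4 ^ d * ∏ i, (2 * r i) := by
      simp_rw [show ∀ i, 2 * (4 * r i) = 4 * (2 * r i) from fun i => by ring]
      rw [Finset.prod_mul_distrib]; simp
    rw [this]; ring
  refine (measure_mono hcov).trans ?_
  set V := 4 ^ d / D * (T * ∏ i, (2 * r i)) with hV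
  have hV0 : 0 ≤ V := by positivity
  calc _ ≤ ∑ j ∈ Finset.range (μ + 1), ∑ i ∈ Finset.range (2 ^ j),
        ∑ k ∈ Finset.Icc (-(R j : ℤ)) (R j : ℤ), volume (U j i k) :=
        (measure_biUnion_finset_le _ _).trans (Finset.sum_le_sum fun j _ =>
          (measure_biUnion_finset_le _ _).trans (Finset.sum_le_sum fun i _ =>
            measure_biUnion_finset_le _ _))
    _ = ∑ j ∈ Finset.range (μ + 1), ENNReal.ofReal (2 ^ j * (2 * (R j : ℝ) + 1) * V) := by
        refine Finset.sum_congr rfl fun j _ => ?_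
        simp_rw [hUvol]
        rw [Finset.sum_const, Finset.sum_const, Finset.card_range, Int.card_Icc, nsmul_eq_mul,
          nsmul_eq_mul, ← ENNReal.ofReal_natCast, ← ENNReal.ofReal_natCast,
          ← ENNReal.ofReal_mul (by positivity), ← ENNReal.ofReal_mul (by positivity)]
        congr 1
        have : ((R j : ℤ) + 1 - -(R j : ℤ)).toNat = 2 * R j + 1 := by omega
        rw [this]; push_cast; ring
    _ = ENNReal.ofReal ((∑ j ∈ Finset.range (μ + 1), 2 ^ j * (2 * (R j : ℝ) + 1)) * V) := by
        rw [Finset.sum_mul, ENNReal.ofReal_sum_of_nonneg fun j _ => by positivity]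
    _ ≤ _ := by
        refine ENNReal.ofReal_le_ofReal ?_
        calc _ ≤ 10 * 2 ^ μ * V := by gcongr; exact kakeya_cover_count μ
          _ = _ := by rw [hV, hDdef]; push_cast; ring

end KakeyaTubes

/-! ### The Kakeya lower bound -/

section KakeyaBound

variable {d : ℕ}

/-- The constant of the Kakeya lower bound. -/
noncomputable def kakeyaConst (d : ℕ) : ℝ :=
  (1 / (5 * d) * (2 * (1 / (5 * d))) ^ d) / (4 * √17 * (4 ^ d * 10) * 2 ^ d)

lemma kakeyaConst_pos (hd : 0 < d) : 0 < kakeyaConst d := by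
  have : (0 : ℝ) < d := by exact_mod_cast hd
  unfold kakeyaConst; positivity

/-- Allows the volume of the tiled region to be replaced by that of the box. The exponent may have
either sign; being at most 1, it costs no more than the factor k. -/
lemma rpow_sub_div_le {x W a b k : ℝ} (hk : 1 ≤ k) (hx : 0 < x) (h1 : W ≤ k * x) (h2 : x ≤ W)
    (ha : 0 ≤ a) (hb : b ≤ 1) : W ^ (b - a) / k ≤ x ^ (b - a) := by
  have hW : 0 < W := hx.trans_le h2
  have hk0 : 0 < k := by linarith
  have hx' : 0 < x ^ (b - a) := Real.rpow_pos_of_pos hx _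
  rw [div_le_iff₀ hk0]
  rcases le_total 0 (b - a) with h | h
  · calc W ^ (b - a) ≤ (k * x) ^ (b - a) := Real.rpow_le_rpow hW.le h1 h
      _ = k ^ (b - a) * x ^ (b - a) := Real.mul_rpow hk0.le hx.le
      _ ≤ k ^ (1 : ℝ) * x ^ (b - a) := mul_le_mul_of_nonneg_right
          (Real.rpow_le_rpow_of_exponent_le hk (by linarith)) hx'.le
      _ = _ := by rw [Real.rpow_one, mul_comm]
  · have h3 : W ^ (b - a) ≤ x ^ (b - a) := Real.rpow_le_rpow_of_nonpos hx h2 h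
    nlinarith

lemma mul_add_eq_mul_add_iff {L a b i j : ℕ} (hi : i < L) (hj : j < L)
    (h : a * L + i = b * L + j) : a = b ∧ i = j := by
  have hL : 0 < L := by omega
  have hab : a = b := by
    have := congrArg (· / L) h
    simpa only [mul_comm _ L, Nat.mul_add_div hL, Nat.div_eq_of_lt hi, Nat.div_eq_of_lt hj,
      add_zero] using this
  subst hab
  exact ⟨rfl, by omega⟩

/-- Bookkeeping of exponents for the Kakeya lower bound. -/
lemma kakeya_exponents {P M lam L κ C a b : ℝ} (hP : 0 < P) (hM : 0 < M) (hlam : 0 < lam)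
    (hL : 0 < L) (hκ : 0 < κ) (hC : 0 < C) :
    (P / 2 / (2 * √(17 * L)) * (M * (κ / lam ^ 2 / P))) /
      ((M * P) ^ a * (C / L * (M * (κ / lam ^ 2 / P))) ^ (1 - b)) =
    κ ^ b / (4 * √17 * C ^ (1 - b)) * (L ^ (1 / 2 - b) * (M * P) ^ (b - a) * P ^ (1 - 2 * b) *
      lam ^ (-2 * b)) := by
  have h17 : √(17 * L) = √17 * L ^ (1 / 2 : ℝ) := by
    rw [Real.sqrt_mul (by norm_num), Real.sqrt_eq_rpow L]
  rw [h17]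
  have h2 : (0 : ℝ) < √17 := by positivity
  -- In logarithmic variables the identity of powers becomes a polynomial identity of exponents.
  obtain ⟨p, rfl⟩ : ∃ p, P = Real.exp p := ⟨_, (Real.exp_log hP).symm⟩
  obtain ⟨μ, rfl⟩ : ∃ p, M = Real.exp p := ⟨_, (Real.exp_log hM).symm⟩
  obtain ⟨l, rfl⟩ : ∃ p, lam = Real.exp p := ⟨_, (Real.exp_log hlam).symm⟩
  obtain ⟨k, rfl⟩ : ∃ p, κ = Real.exp p := ⟨_, (Real.exp_log hκ).symm⟩
  obtain ⟨c, rfl⟩ : ∃ p, C = Real.exp p := ⟨_, (Real.exp_log hC).symm⟩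
  obtain ⟨L, rfl⟩ : ∃ p, L = Real.exp p := ⟨_, (Real.exp_log hL).symm⟩
  have e1 : Real.exp l ^ 2 = Real.exp (2 * l) := by rw [sq, ← Real.exp_add]; ring_nf
  rw [e1]
  have hx : Real.exp p / 2 / (2 * (√17 * Real.exp L ^ (1 / 2 : ℝ))) =
      1 / (4 * √17) * (Real.exp p / Real.exp L ^ (1 / 2 : ℝ)) := by field_simp; norm_num
  have hy : Real.exp k ^ b / (4 * √17 * Real.exp c ^ (1 - b)) =
      1 / (4 * √17) * (Real.exp k ^ b / Real.exp c ^ (1 - b)) := by field_simp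
  rw [hx, hy, mul_assoc (1 / (4 * √17)), mul_div_assoc (1 / (4 * √17)), mul_assoc (1 / (4 * √17))]
  congr 1
  simp only [← Real.exp_add, ← Real.exp_sub, ← Real.exp_mul]
  congr 1; ring

variable {N : ℕ∞} {ε₀ : ℝ} {ℓ : Fin d → ℝ≥0∞} {g : Freq d → ℝ} {m : Fin d → ℝ}

set_option maxHeartbeats 2000000 in
/-- The main lower bound for the restricted weak type norm. -/
theorem IsElliptic.kakeya_lower_bound (hg : IsElliptic N ε₀ ℓ g) (hN : 2 ≤ N) (hε : 0 < ε₀)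
    (hε' : ε₀ < 1) (hd : 0 < d) {p q : ℝ≥0∞} (hp : 1 ≤ p) (hq : 1 ≤ q)
    (hm : ∀ i, 0 < m i) (hmℓ : rectangle (fun i => ENNReal.ofReal (m i)) ⊆ rectangle ℓ)
    (e : Fin d) {lam : ℝ} (hlam : 0 < lam) (μ : ℕ) (hμ : 4 ^ μ * lam ≤ m e) :
    ENNReal.ofReal (kakeyaConst d * (((μ : ℝ) + 1) ^ (1 / 2 - (q⁻¹).toReal) *
      (∏ i, m i) ^ ((q⁻¹).toReal - (p⁻¹).toReal) *
      (∏ i, min (m i) lam) ^ (1 - 2 * (q⁻¹).toReal) * lam ^ (-2 * (q⁻¹).toReal))) ≤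
      rwtNorm ℓ g p q := by
  classical
  have hd' : (0 : ℝ) < d := by exact_mod_cast hd
  obtain ⟨ha0, ha1⟩ := inv_toReal_mem hp
  obtain ⟨hb0, hb1⟩ := inv_toReal_mem hq
  have hgc : ContinuousOn g (rectangle ℓ) := hg.contDiffOn.continuousOn
  set κ : ℝ := 1 / (5 * d) with hκ
  have hκ0 : 0 < κ := by positivity
  set σ : Fin d → ℝ := fun i => min (m i) lam with hσdef
  have hσ : ∀ i, 0 < σ i := fun i => lt_min (hm i) hlam
  have hσlam : ∀ i, σ i ≤ lam := fun i => min_le_right _ _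
  have h4μ : (1 : ℝ) ≤ 4 ^ μ := one_le_pow₀ (by norm_num)
  have h24 : (2 : ℝ) ^ μ * 2 ^ μ = 4 ^ μ := by rw [← mul_pow]; norm_num
  have h2μ : (1 : ℝ) ≤ 2 ^ μ := one_le_pow₀ (by norm_num)
  have h2μm : 2 ^ μ * lam ≤ m e := by
    refine le_trans ?_ hμ
    rw [← h24]
    gcongr
    nlinarith
  have hσe : σ e = lam := min_eq_right (by nlinarith)
  -- Sides of a block, a row of 2^μ cells along e. The blocks have lower corners `ξ₀`, and `η` gives
  -- the corners of the cells.
  set τ : Fin d → ℝ := fun i => if i = e then 2 ^ μ * lam else σ i with hτdef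
  have hτe : τ e = 2 ^ μ * lam := by simp [hτdef]
  have hτne : ∀ i, i ≠ e → τ i = σ i := fun i hi => by simp [hτdef, hi]
  have hτ : ∀ i, 0 < τ i := fun i => by
    by_cases h : i = e
    · rw [h, hτe]; positivity
    · rw [hτne i h]; exact hσ i
  have hτm : ∀ i, τ i ≤ m i := fun i => by
    by_cases h : i = e
    · rw [h, hτe]; exact h2μm
    · rw [hτne i h]; exact min_le_left _ _
  set B : Fin d → ℕ := fun i => ⌊m i / τ i⌋₊ with hB
  have hB1 : ∀ i, 1 ≤ B i := fun i => by
    rw [hB, Nat.one_le_floor_iff, one_le_div (hτ i)]; exact hτm i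
  have hBτ : ∀ i, B i * τ i ≤ m i := fun i => by
    rw [← le_div_iff₀ (hτ i)]; exact Nat.floor_le (by have := hm i; have := hτ i; positivity)
  have hBτ' : ∀ i, m i ≤ 2 * (B i * τ i) := fun i => by
    have h1 : m i < (B i + 1) * τ i := by
      rw [← div_lt_iff₀ (hτ i)]; exact Nat.lt_floor_add_one _
    have h2 : (1 : ℝ) ≤ B i := by exact_mod_cast hB1 i
    nlinarith [hτ i]
  let β₀ : Type := ∀ i, Fin (B i)
  let ι : Type := β₀ × Fin (2 ^ μ)
  let ξ₀ : β₀ → Freq d := fun β => WithLp.toLp 2 fun i => (β i : ℝ) * τ i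
  let η : ι → Freq d := fun x => ξ₀ x.1 + ((x.2 : ℝ) * lam) • coordVec e
  have hη : ∀ x i, η x i = (x.1 i : ℝ) * τ i + if i = e then (x.2 : ℝ) * lam else 0 := by
    intro x i
    simp only [η, ξ₀, coordVec, PiLp.add_apply, PiLp.smul_apply, PiLp.single_apply, smul_eq_mul]
    split_ifs <;> simp
  have hn : ∀ x : ι, (x.2 : ℝ) + 1 ≤ 2 ^ μ := fun x => by exact_mod_cast x.2.2
  have hβ : ∀ (x : β₀) i, (x i : ℝ) + 1 ≤ B i := fun x i => by exact_mod_cast (x i).2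
  have hη0 : ∀ x i, 0 ≤ η x i := fun x i => by
    rw [hη]
    have := hτ i
    split_ifs <;> positivity
  have hη1 : ∀ x i, η x i + σ i ≤ m i := fun x i => by
    rw [hη]
    refine le_trans ?_ (hBτ i)
    have h1 := hβ x.1 i
    have h2 := hn x
    have h3 : ((x.1 i : ℝ) + 1) * τ i ≤ B i * τ i := mul_le_mul_of_nonneg_right h1 (hτ i).le
    by_cases h : i = e
    · subst h
      rw [if_pos rfl, hσe]
      rw [hτe] at h3 ⊢
      nlinarith
    · rw [if_neg h]
      rw [hτne i h] at h3 ⊢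
      linarith
  have hcellm : ∀ x, cell (η x) σ ⊆ rectangle (fun i => ENNReal.ofReal (m i)) := by
    intro x ξ hξ
    rw [mem_rectangle_ofReal]
    intro i
    have h1 := (hξ i).1
    have h2 := (hξ i).2
    rw [abs_of_nonneg ((hη0 x i).trans h1)]
    linarith [hη1 x i]
  have hξ₀m : ∀ β : β₀, ξ₀ β ∈ rectangle (fun i => ENNReal.ofReal (m i)) := by
    intro β
    rw [mem_rectangle_ofReal]
    intro i
    have h1 := hβ β i
    have h2 : ((β i : ℝ) + 1) * τ i ≤ B i * τ i := mul_le_mul_of_nonneg_right h1 (hτ i).le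
    simp only [ξ₀]
    rw [abs_of_nonneg (by have := hτ i; positivity)]
    linarith [hBτ i, hτ i]
  have hdisj : Pairwise (Function.onFun Disjoint fun x : ι => cell (η x) σ) := by
    intro x y hxy
    refine Set.disjoint_left.2 fun ξ hx hy => hxy ?_
    have hne : ∀ i, i ≠ e → x.1 i = y.1 i := by
      intro i hi
      have h1 := hx i
      have h2 := hy i
      rw [hη, if_neg hi, add_zero, hτne i hi, Set.mem_Ico] at h1 h2
      have h3 : (x.1 i : ℝ) < y.1 i + 1 := by
        have := hσ i
        by_contra! h; nlinarith
      have h4 : (y.1 i : ℝ) < x.1 i + 1 := by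
        have := hσ i
        by_contra! h; nlinarith
      have h5 : (x.1 i : ℕ) < y.1 i + 1 := by exact_mod_cast h3
      have h6 : (y.1 i : ℕ) < x.1 i + 1 := by exact_mod_cast h4
      exact Fin.ext (by omega)
    have h1 := hx e
    have h2 := hy e
    rw [hη, if_pos rfl, hτe, hσe, Set.mem_Ico] at h1 h2
    have h3 : (x.1 e : ℝ) * 2 ^ μ + x.2 < y.1 e * 2 ^ μ + y.2 + 1 := by
      by_contra! h; nlinarith
    have h4 : (y.1 e : ℝ) * 2 ^ μ + y.2 < x.1 e * 2 ^ μ + x.2 + 1 := by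
      by_contra! h; nlinarith
    have h5 : (x.1 e : ℕ) * 2 ^ μ + x.2 < y.1 e * 2 ^ μ + y.2 + 1 := by exact_mod_cast h3
    have h6 : (y.1 e : ℕ) * 2 ^ μ + y.2 < x.1 e * 2 ^ μ + x.2 + 1 := by exact_mod_cast h4
    have h7 : (x.1 e : ℕ) * 2 ^ μ + x.2 = y.1 e * 2 ^ μ + y.2 := by omega
    obtain ⟨h8, h9⟩ := mul_add_eq_mul_add_iff x.2.2 y.2.2 h7
    refine Prod.ext (funext fun i => ?_) (Fin.ext h9)
    by_cases hi : i = e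
    · subst hi; exact Fin.ext h8
    · exact hne i hi
  -- Since ρ/T = λ, the n-th Kakeya line moves at speed nλ along v, which is the change of the
  -- linearised gradient from the block corner to the n-th cell.
  set T : ℝ := κ / lam ^ 2 with hT
  have hT0 : 0 < T := by positivity
  set ρ : ℝ := κ / lam with hρ
  have hρ0 : 0 < ρ := by positivity
  set r : Fin d → ℝ := fun i => κ / σ i with hr
  have hrρ : ∀ i, ρ ≤ r i := fun i => by
    rw [hρ, hr]; have := hσ i; have := hσlam i; dsimp only; gcongr
  have hr0 : ∀ i, 0 < r i := fun i => hρ0.trans_le (hrρ i)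
  have hre : r e = ρ := by simp only [hr, hσe, hρ]
  let G : β₀ → Fin d → ℝ := fun β i => fderiv ℝ g (ξ₀ β) (coordVec i)
  let v : β₀ → Freq d := fun β => WithLp.toLp 2 fun i =>
    hessian g (ξ₀ β) (coordVec e) (coordVec i)
  have hve : ∀ β, 1 ≤ v β e := fun β =>
    hg.one_le_hessian_coordVec hN hε hε' hm hmℓ (hξ₀m β) e
  have hv3 : ∀ β i, |v β i| ≤ 3 := fun β i =>
    hg.abs_hessian_coordVec_le hN hε hε' hm hmℓ (hξ₀m β) e i
  -- Every tube of a block stays within S of the block's centre in the coordinate e: drift, Kakeya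
  -- displacement and half-width. Centres spaced by 2S + 1 thus separate the blocks.
  set S : ℝ := T * ∑ β, |G β e| + 3 * 2 ^ μ * ρ + ρ with hS
  have hS0 : 0 < S := by
    have : 0 ≤ ∑ β, |G β e| := Finset.sum_nonneg fun _ _ => abs_nonneg _
    positivity
  let idx : β₀ → ℕ := fun β => (Fintype.equivFin β₀ β : ℕ)
  have hidx : ∀ β β', idx β = idx β' → β = β' := fun β β' h =>
    (Fintype.equivFin β₀).injective (Fin.ext h)
  let Y : β₀ → Freq d := fun β => ((idx β : ℝ) * (2 * S + 1)) • coordVec e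
  let c : β₀ → ℝ → Freq d := fun β t => Y β - t • WithLp.toLp 2 (G β)
  have hc : ∀ β, Continuous (c β) := fun β => by fun_prop
  let tube : ι → Set (ℝ × Freq d) := fun x =>
    kakeyaTube T ρ r (c x.1) (v x.1) (μ + 1) x.2
  let y : ι → Freq d := fun x => Y x.1 - (kakeyaLine (μ + 1) x.2 0 * ρ) • v x.1
  set V : ℝ := T * ∏ i, (2 * r i) with hV
  have hV0 : 0 < V := mul_pos hT0 (Finset.prod_pos fun i _ => by have := hr0 i; positivity)
  have htubem : ∀ x, MeasurableSet (tube x) := fun x => measurableSet_kakeyaTube (hc x.1) _ _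
  have htubev : ∀ x, volume (tube x) = ENNReal.ofReal V := fun x =>
    volume_kakeyaTube hT0 hr0 (hc x.1) _ _
  have hlow : ∀ x, ∀ z ∈ tube x, (∏ i, σ i) / 2 ≤
      ‖extOp ℓ g (wavePacket (cell (η x) σ) (y x)) z‖ := by
    rintro x ⟨t, w⟩ hz
    refine hg.prod_div_two_le_norm_extOp hN hε hε' hm hmℓ hd (s := (x.2 : ℝ) * lam) hlam
      (by positivity) ?_ hσ hσlam (hξ₀m x.1) (hcellm x) hz.1 fun i => ?_
    -- The hypothesis 4^μ λ ≤ m_e is what validates the linearisation over the whole block.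
    · have h1 := hn x
      have h2 : (x.2 : ℝ) ^ 2 ≤ 4 ^ μ := by
        rw [← h24, ← sq]; gcongr; linarith
      calc ((x.2 : ℝ) * lam) ^ 2 = (x.2 : ℝ) ^ 2 * lam * lam := by ring
        _ ≤ 4 ^ μ * lam * lam := by gcongr
        _ ≤ lam * m e := by rw [mul_comm]; gcongr
    · have h1 := hz.2 i
      simp only [c, PiLp.sub_apply, PiLp.smul_apply, smul_eq_mul] at h1
      simp only [y, PiLp.sub_apply, PiLp.smul_apply, smul_eq_mul]
      convert h1 using 2
      have h2 : kakeyaLine (μ + 1) x.2 (t / T) * ρ =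
          kakeyaLine (μ + 1) x.2 0 * ρ + x.2 * lam * t := by
        simp only [kakeyaLine, hT, hρ]
        field_simp
        ring
      rw [h2]
      simp only [G, v]
      ring
  have hsep : ∀ x x' : ι, x.1 ≠ x'.1 → tube x ∩ tube x' = ∅ := by
    intro x x' hne
    rw [Set.eq_empty_iff_forall_notMem]
    rintro ⟨t, w⟩ ⟨h1, h2⟩
    have hb : ∀ u : ι, (t, w) ∈ tube u → |w e - (idx u.1 : ℝ) * (2 * S + 1)| ≤ S := by
      intro u hu
      have ht : t ∈ Set.Icc 0 T := hu.1
      have h3 := hu.2 e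
      simp only [c, Y, coordVec, PiLp.sub_apply, PiLp.smul_apply, PiLp.single_apply, smul_eq_mul,
        if_true, mul_one, hre] at h3
      set k := kakeyaLine (μ + 1) u.2 (t / T) with hk
      have h4 : |k * ρ * v u.1 e| ≤ 3 * 2 ^ μ * ρ := by
        have h5 : |k| ≤ 2 ^ μ := (abs_kakeyaLine_le _ _
          ⟨div_nonneg ht.1 hT0.le, (div_le_one hT0).2 ht.2⟩).trans (by linarith [hn u])
        rw [abs_mul, abs_mul, abs_of_pos hρ0]
        calc _ ≤ 2 ^ μ * ρ * 3 := by gcongr; exact hv3 _ _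
          _ = _ := by ring
      have h6 : |t * G u.1 e| ≤ T * ∑ β, |G β e| := by
        rw [abs_mul, abs_of_nonneg ht.1]
        refine mul_le_mul ht.2 ?_ (abs_nonneg _) hT0.le
        exact Finset.single_le_sum (f := fun β => |G β e|) (fun _ _ => abs_nonneg _)
          (Finset.mem_univ u.1)
      rw [abs_le] at h3 h4 h6 ⊢
      rw [hS]
      constructor <;> linarith [h3.1, h3.2, h4.1, h4.2, h6.1, h6.2]
    have h3 := abs_le.1 (hb x h1)
    have h4 := abs_le.1 (hb x' h2)
    have hne' : idx x.1 ≠ idx x'.1 := fun h => hne (hidx _ _ h)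
    rcases lt_or_gt_of_ne hne' with h | h
    · have : (idx x.1 : ℝ) + 1 ≤ idx x'.1 := by exact_mod_cast h
      nlinarith
    · have : (idx x'.1 : ℝ) + 1 ≤ idx x.1 := by exact_mod_cast h
      nlinarith
  have hcross : ∑ x, ∑ x', volume (tube x ∩ tube x') ≤
      ENNReal.ofReal (17 * ((μ : ℝ) + 1)) * ∑ x, volume (tube x) := by
    rw [Finset.mul_sum]
    refine Finset.sum_le_sum fun x _ => ?_
    rw [Fintype.sum_prod_type, Finset.sum_eq_single x.1]
    · rw [htubev]
      calc _ ≤ ∑ k : Fin (2 ^ μ), ENNReal.ofReal ((if (x.2 : ℕ) = k then (1 : ℝ) else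
            4 / |((x.2 : ℕ) : ℝ) - (k : ℕ)|) * V) := Finset.sum_le_sum fun k _ =>
            volume_kakeyaTube_inter_le hT0 hρ0 hr0 hre (hve x.1) (hc x.1) _ _ _
        _ = ENNReal.ofReal ((∑ k ∈ Finset.range (2 ^ μ), (if (x.2 : ℕ) = k then (1 : ℝ) else
            4 / |((x.2 : ℕ) : ℝ) - k|)) * V) := by
            rw [Finset.sum_mul, ENNReal.ofReal_sum_of_nonneg, Finset.sum_range]
            intro k _
            split_ifs <;> positivity
        _ ≤ ENNReal.ofReal (17 * ((μ : ℝ) + 1) * V) := by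
            gcongr; exact sum_inv_dist_le x.2.2
        _ = _ := ENNReal.ofReal_mul (by positivity)
    · intro β _ hβ'
      refine Finset.sum_eq_zero fun k _ => ?_
      rw [hsep x (β, k) (Ne.symm hβ'), measure_empty]
    · simp
  set P : ℝ := ∏ i, σ i with hP
  have hP0 : 0 < P := Finset.prod_pos fun i _ => hσ i
  set M : ℝ := (Fintype.card ι : ℝ) with hM
  have : Nonempty ι := ⟨(fun i => ⟨0, hB1 i⟩, ⟨0, by positivity⟩)⟩
  have hM0 : 0 < M := by rw [hM]; exact_mod_cast Fintype.card_pos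
  have hsumT : ∑ x, volume (tube x) = ENNReal.ofReal (M * V) := by
    simp_rw [htubev]
    rw [Finset.sum_const, Finset.card_univ, nsmul_eq_mul, ENNReal.ofReal_mul hM0.le, hM,
      ENNReal.ofReal_natCast]
  have hvolC : volume (⋃ x, cell (η x) σ) = ENNReal.ofReal (M * P) := by
    rw [measure_iUnion hdisj fun x => measurableSet_cell _ _, tsum_fintype]
    simp_rw [volume_cell _ fun i => (hσ i).le]
    rw [Finset.sum_const, Finset.card_univ, nsmul_eq_mul, ENNReal.ofReal_mul hM0.le, hM,
      ENNReal.ofReal_natCast]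
  have hvolT : volume (⋃ x, tube x) ≤ ENNReal.ofReal (4 ^ d * 10 / ((μ : ℝ) + 1) * (M * V)) := by
    have h1 : (⋃ x, tube x) = ⋃ β : β₀, ⋃ k : Fin (2 ^ μ), tube (β, k) := by
      ext z
      simp only [Set.mem_iUnion]
      exact ⟨fun ⟨x, h⟩ => ⟨x.1, x.2, h⟩, fun ⟨β, k, h⟩ => ⟨(β, k), h⟩⟩
    rw [h1]
    calc _ ≤ ∑ β : β₀, volume (⋃ k : Fin (2 ^ μ), tube (β, k)) := measure_iUnion_fintype_le _ _
      _ ≤ ∑ _β : β₀, ENNReal.ofReal (4 ^ d * 10 * 2 ^ μ / (μ + 1) * V) :=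
          Finset.sum_le_sum fun β _ =>
            volume_iUnion_kakeyaTube_le hT0 hρ0 hrρ (hv3 β) (hc β) μ
      _ = _ := by
          rw [Finset.sum_const, Finset.card_univ, nsmul_eq_mul, ← ENNReal.ofReal_natCast,
            ← ENNReal.ofReal_mul (by positivity)]
          congr 1
          have : M = Fintype.card β₀ * 2 ^ μ := by
            rw [hM, Fintype.card_prod, Fintype.card_fin]; push_cast; rfl
          rw [this]; ring
  have hvolT0 : 0 < volume (⋃ x, tube x) := by
    obtain ⟨x⟩ := this
    refine lt_of_lt_of_le ?_ (measure_mono (Set.subset_iUnion tube x))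
    rw [htubev]; exact ENNReal.ofReal_pos.2 hV0
  have hmain := rwtNorm_ge_of_tubes hgc p hq (C := fun x : ι => cell (η x) σ)
    (f := fun x => wavePacket (cell (η x) σ) (y x)) (T := tube)
    (fun x => measurableSet_cell _ _) hdisj
    (by rw [hvolC]; exact ENNReal.ofReal_pos.2 (by positivity)) (by rw [hvolC]; finiteness)
    (fun x => ⟨measurable_wavePacket (measurableSet_cell _ _) _, norm_wavePacket_le _ _⟩)
    htubem hvolT0 (hvolT.trans_lt (by finiteness)) (v := P / 2) (M := 17 * ((μ : ℝ) + 1))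
    (by positivity) (by positivity) hlow hcross
  set a := (p⁻¹).toReal with ha
  set b := (q⁻¹).toReal with hb
  set κ' : ℝ := κ * (2 * κ) ^ d with hκ'
  have hκ'0 : 0 < κ' := by positivity
  have hκ'1 : κ' ≤ 1 := by
    have h1 : κ ≤ 1 / 5 := by
      rw [hκ]
      have : (1 : ℝ) ≤ d := by exact_mod_cast hd
      gcongr
      linarith
    have h2 : (2 * κ) ^ d ≤ 1 := pow_le_one₀ (by positivity) (by linarith)
    rw [hκ']
    nlinarith [show 0 < (2 * κ) ^ d by positivity]
  have hVeq : V = κ' / lam ^ 2 / P := by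
    rw [hV, hT, hκ', hP]
    have : ∏ i, (2 * r i) = (2 * κ) ^ d / ∏ i, σ i := by
      simp_rw [hr, ← mul_div_assoc]
      rw [Finset.prod_div_distrib]; simp
    rw [this]; ring
  set Den : ℝ := (M * P) ^ a * (4 ^ d * 10 / ((μ : ℝ) + 1) * (M * V)) ^ (1 - b) with hDen
  have hDen0 : 0 < Den := by positivity
  have hK : ENNReal.ofReal (P / 2 / (2 * √(17 * ((μ : ℝ) + 1))) * (M * V)) ≤
      rwtNorm ℓ g p q * ENNReal.ofReal Den := by
    rw [ENNReal.ofReal_mul (by positivity), ← hsumT]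
    refine hmain.trans ?_
    gcongr
    rw [hDen, ENNReal.ofReal_mul (by positivity), hvolC,
      ← ENNReal.ofReal_rpow_of_nonneg (by positivity) ha0,
      ← ENNReal.ofReal_rpow_of_nonneg (by positivity) (by linarith)]
    gcongr
  have hK2 : ENNReal.ofReal (P / 2 / (2 * √(17 * ((μ : ℝ) + 1))) * (M * V) / Den) ≤
      rwtNorm ℓ g p q := by
    rw [ENNReal.ofReal_div_of_pos hDen0]
    exact ENNReal.div_le_of_le_mul hK
  refine le_trans (ENNReal.ofReal_le_ofReal ?_) hK2
  rw [hDen, hVeq, kakeya_exponents hP0 hM0 hlam (by positivity) hκ'0 (by positivity)]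
  have hMP : M * P = ∏ i, (B i * τ i) := by
    rw [Finset.prod_mul_distrib, hM, Fintype.card_prod, Fintype.card_fin, Fintype.card_pi, hP,
      ← Finset.mul_prod_erase _ τ (Finset.mem_univ e), ← Finset.mul_prod_erase _ σ
      (Finset.mem_univ e), hτe, hσe]
    have : ∏ i ∈ Finset.univ.erase e, τ i = ∏ i ∈ Finset.univ.erase e, σ i :=
      Finset.prod_congr rfl fun i hi => hτne i (Finset.ne_of_mem_erase hi)
    rw [this]
    simp only [Fintype.card_fin]
    push_cast
    ring
  have hW1 : M * P ≤ ∏ i, m i := by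
    rw [hMP]
    exact Finset.prod_le_prod (fun i _ => by have := hτ i; positivity) fun i _ => hBτ i
  have hW2 : ∏ i, m i ≤ 2 ^ d * (M * P) := by
    rw [hMP]
    calc ∏ i, m i ≤ ∏ i, (2 * (B i * τ i)) :=
          Finset.prod_le_prod (fun i _ => (hm i).le) fun i _ => hBτ' i
      _ = _ := by rw [Finset.prod_mul_distrib]; simp
  have hpow := rpow_sub_div_le (one_le_pow₀ (by norm_num : (1 : ℝ) ≤ 2)) (by positivity) hW2 hW1
    ha0 hb1
  have h1 : κ' ≤ κ' ^ b := by
    conv_lhs => rw [← Real.rpow_one κ']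
    exact Real.rpow_le_rpow_of_exponent_ge hκ'0 hκ'1 hb1
  have h2 : ((4 : ℝ) ^ d * 10) ^ (1 - b) ≤ 4 ^ d * 10 := by
    conv_rhs => rw [← Real.rpow_one ((4 : ℝ) ^ d * 10)]
    refine Real.rpow_le_rpow_of_exponent_le ?_ (by linarith)
    have : (1 : ℝ) ≤ 4 ^ d := one_le_pow₀ (by norm_num)
    linarith
  -- The factors come from the tube volume (κ'), the packet size and Khinchine (two halves), the
  -- overlaps (√17), the covering (4^d · 10) and the rounding of the box to blocks (2^d).
  have hconst : kakeyaConst d = κ' / (4 * √17 * (4 ^ d * 10)) / 2 ^ d := by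
    rw [kakeyaConst, div_div]
  rw [hconst]
  have hW0 : 0 < ∏ i, m i := Finset.prod_pos fun i _ => hm i
  calc _ = κ' / (4 * √17 * (4 ^ d * 10)) * (((μ : ℝ) + 1) ^ (1 / 2 - b) *
        ((∏ i, m i) ^ (b - a) / 2 ^ d) * P ^ (1 - 2 * b) * lam ^ (-2 * b)) := by ring
    _ ≤ _ := by gcongr

end KakeyaBound

/-! ### Conditions on p and q in terms of 1/p and 1/q -/

section Exponents

variable {p q : ℝ≥0∞}

lemma inv_ne_top_of_one_le (hp : 1 ≤ p) : p⁻¹ ≠ ∞ :=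
  ENNReal.inv_ne_top.2 (zero_lt_one.trans_le hp).ne'

lemma conjExponent_ne_zero : p.conjExponent ≠ 0 := by
  simp [ENNReal.conjExponent]

lemma conjExponent_inv_ne_top : p.conjExponent⁻¹ ≠ ∞ :=
  ENNReal.inv_ne_top.2 conjExponent_ne_zero

lemma toReal_inv_ofReal_mul_conjExponent (hp : 1 ≤ p) {x : ℝ} (hx : 0 < x) :
    ((ENNReal.ofReal x * p.conjExponent)⁻¹).toReal = x⁻¹ * (1 - (p⁻¹).toReal) := by
  rw [ENNReal.mul_inv (Or.inl (ENNReal.ofReal_pos.2 hx).ne') (Or.inl ENNReal.ofReal_ne_top),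
    ENNReal.toReal_mul, inv_conjExponent_toReal hp, ENNReal.toReal_inv,
    ENNReal.toReal_ofReal hx.le]

lemma inv_ofReal_mul_conjExponent_ne_top {x : ℝ} (hx : 0 < x) :
    (ENNReal.ofReal x * p.conjExponent)⁻¹ ≠ ∞ :=
  ENNReal.inv_ne_top.2 (mul_ne_zero (ENNReal.ofReal_pos.2 hx).ne' conjExponent_ne_zero)

lemma lt_mul_inv_of_lt_ofReal_mul_conjExponent (hp : 1 ≤ p) (hq : 1 ≤ q) {x : ℝ} (hx : 0 < x)
    (h : q < ENNReal.ofReal x * p.conjExponent) : 1 - (p⁻¹).toReal < x * (q⁻¹).toReal := by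
  have h1 := (ENNReal.toReal_lt_toReal (inv_ofReal_mul_conjExponent_ne_top hx)
    (inv_ne_top_of_one_le hq)).2 (ENNReal.inv_lt_inv.2 h)
  rwa [toReal_inv_ofReal_mul_conjExponent hp hx, inv_mul_lt_iff₀ hx] at h1

lemma mul_inv_lt_of_ofReal_mul_conjExponent_lt (hp : 1 ≤ p) (hq : 1 ≤ q) {x : ℝ} (hx : 0 < x)
    (h : ENNReal.ofReal x * p.conjExponent < q) : x * (q⁻¹).toReal < 1 - (p⁻¹).toReal := by
  have h1 := (ENNReal.toReal_lt_toReal (inv_ne_top_of_one_le hq)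
    (inv_ofReal_mul_conjExponent_ne_top hx)).2 (ENNReal.inv_lt_inv.2 h)
  rwa [toReal_inv_ofReal_mul_conjExponent hp hx, lt_inv_mul_iff₀ hx] at h1

lemma inv_le_toReal_inv_of_le_ofReal (hq : 1 ≤ q) {x : ℝ} (hx : 0 < x)
    (h : q ≤ ENNReal.ofReal x) : x⁻¹ ≤ (q⁻¹).toReal := by
  have h1 := ENNReal.toReal_mono (inv_ne_top_of_one_le hq) (ENNReal.inv_le_inv.2 h)
  rwa [ENNReal.toReal_inv, ENNReal.toReal_ofReal hx.le] at h1

lemma toReal_inv_anti (hq : 1 ≤ q) (h : q ≤ p) : (p⁻¹).toReal ≤ (q⁻¹).toReal :=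
  ENNReal.toReal_mono (inv_ne_top_of_one_le hq) (ENNReal.inv_le_inv.2 h)

lemma scaling_relation (hp : 1 ≤ p) {s : ℝ} (hs : 0 ≤ s)
    (h : q = ENNReal.ofReal (s + 2) / ENNReal.ofReal s * p.conjExponent) :
    s * (1 - (p⁻¹).toReal) = (s + 2) * (q⁻¹).toReal := by
  rcases hs.eq_or_lt with rfl | hs
  · have : q = ∞ := by
      rw [h, ENNReal.ofReal_zero, ENNReal.div_zero (by simp),
        ENNReal.top_mul conjExponent_ne_zero]
    simp [this]
  · rw [← ENNReal.ofReal_div_of_pos hs] at h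
    rw [h, toReal_inv_ofReal_mul_conjExponent hp (by positivity)]
    field_simp

lemma diagonal_relation {s : ℝ} (hs : 0 < s)
    (h : q = ENNReal.ofReal (2 * (s + 1)) / ENNReal.ofReal s) :
    (q⁻¹).toReal = s / (2 * (s + 1)) := by
  rw [← ENNReal.ofReal_div_of_pos hs] at h
  rw [h, ENNReal.toReal_inv, ENNReal.toReal_ofReal (by positivity), inv_div]

lemma three_mul_inv_le (hq : 4 < q) (h : (q / 3).conjExponent ≤ p) :
    (p⁻¹).toReal ≤ 1 - 3 * (q⁻¹).toReal := by
  have h3 : 1 ≤ q / 3 := by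
    rw [ENNReal.le_div_iff_mul_le (by simp) (by simp), one_mul]
    exact le_trans (by norm_num) hq.le
  have h1 := ENNReal.toReal_mono conjExponent_inv_ne_top (ENNReal.inv_le_inv.2 h)
  rw [inv_conjExponent_toReal h3, ENNReal.inv_div (by simp) (by simp), ENNReal.div_eq_inv_mul,
    ENNReal.toReal_mul, mul_comm] at h1
  simpa using h1

end Exponents

/-! ### Divergence criterion -/

section Growth

/-- The exponential decides in the open range of exponents; at an endpoint only the power, the
Kakeya gain, remains. -/
lemma tendsto_rpow_mul_exp_atTop {s δ : ℝ} (h : 0 < δ ∨ δ = 0 ∧ 0 < s) :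
    Tendsto (fun n : ℕ => ((n : ℝ) + 1) ^ s * Real.exp (δ * (n + 1))) atTop atTop := by
  have hn : Tendsto (fun n : ℕ => (n : ℝ) + 1) atTop atTop :=
    tendsto_atTop_add_const_right _ _ tendsto_natCast_atTop_atTop
  rcases h with h | ⟨rfl, h⟩
  · refine ((tendsto_exp_mul_div_rpow_atTop (-s) δ h).comp hn).congr fun n => ?_
    have : (0 : ℝ) < n + 1 := by positivity
    simp only [Function.comp_apply]
    rw [Real.rpow_neg this.le, div_inv_eq_mul, mul_comm]
  · refine ((tendsto_rpow_atTop h).comp hn).congr fun n => ?_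
    simp

lemma eq_top_of_growth {K : ℝ≥0∞} {A s δ : ℝ} (hA : 0 < A) (h : 0 < δ ∨ δ = 0 ∧ 0 < s)
    (hK : ∀ n : ℕ, ENNReal.ofReal (A * (((n : ℝ) + 1) ^ s * Real.exp (δ * (n + 1)))) ≤ K) :
    K = ∞ := by
  have h1 := ENNReal.tendsto_ofReal_atTop.comp ((tendsto_rpow_mul_exp_atTop h).const_mul_atTop hA)
  exact top_le_iff.1 (le_of_tendsto' h1 hK)

end Growth

/-! ### The Knapp bound and the cases of infinite norm -/

section Consequences

variable {d : ℕ}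

lemma rectangle_ofReal_subset {m : Fin d → ℝ} {ℓ : Fin d → ℝ≥0∞}
    (h : ∀ i, ENNReal.ofReal (m i) ≤ ℓ i) :
    rectangle (fun i => ENNReal.ofReal (m i)) ⊆ rectangle ℓ :=
  fun _ hξ i => (hξ i).trans_le (h i)

lemma exists_pos_ofReal_le {ℓ : Fin d → ℝ≥0∞} (hd : 0 < d) (hℓ : ∀ i, 0 < ℓ i)
    (hmono : Monotone ℓ) : ∃ r : ℝ, 0 < r ∧ ∀ i, ENNReal.ofReal r ≤ ℓ i := by
  have hfin : min (ℓ ⟨0, hd⟩) 1 ≠ ∞ := ((min_le_right _ _).trans_lt ENNReal.one_lt_top).ne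
  refine ⟨(min (ℓ ⟨0, hd⟩) 1).toReal,
    ENNReal.toReal_pos (lt_min (hℓ _) one_pos).ne' hfin, fun i => ?_⟩
  rw [ENNReal.ofReal_toReal hfin]
  exact (min_le_left _ _).trans (hmono (Nat.zero_le _))

lemma prod_Iio_mul_prod_Ici (j : Fin d) (x : Fin d → ℝ) :
    (∏ i ∈ Finset.Iio j, x i) * ∏ i ∈ Finset.Ici j, x i = ∏ i, x i := by
  rw [← Finset.prod_mul_prod_compl (Finset.Iio j)]
  congr 2
  ext i; simp

lemma prod_truncate (j : Fin d) (x y : Fin d → ℝ) (h1 : ∀ i < j, y i = x i)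
    (h2 : ∀ i, j ≤ i → y i = x j) :
    ∏ i, y i = (∏ i ∈ Finset.Iio j, x i) * x j ^ ((d : ℝ) - j) := by
  rw [← prod_Iio_mul_prod_Ici j,
    Finset.prod_congr rfl fun i hi => h1 i (Finset.mem_Iio.1 hi),
    Finset.prod_congr rfl fun i hi => h2 i (Finset.mem_Ici.1 hi),
    Finset.prod_const, Fin.card_Ici, ← Nat.cast_sub j.2.le, Real.rpow_natCast]

variable {N : ℕ∞} {ε₀ : ℝ} {ℓ : Fin d → ℝ≥0∞} {g : Freq d → ℝ} {p q : ℝ≥0∞}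
  (hg : IsElliptic N ε₀ ℓ g) (hN : 2 ≤ N) (hε : 0 < ε₀) (hε' : ε₀ < 1) (hd : 0 < d)
  (hp : 1 ≤ p) (hq : 1 ≤ q)

include hg hN hε hε' hd hp hq

/-- The Knapp lower bound over a monotone finite box. -/
lemma IsElliptic.knapp_lower_bound {m : Fin d → ℝ} (hm : ∀ i, 0 < m i)
    (hmℓ : ∀ i, ENNReal.ofReal (m i) ≤ ℓ i) (e : Fin d) (he : ∀ i, m i ≤ m e) :
    ENNReal.ofReal (kakeyaConst d * ((∏ i, m i) ^ (1 - (p⁻¹).toReal - (q⁻¹).toReal) *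
      m e ^ (-2 * (q⁻¹).toReal))) ≤ rwtNorm ℓ g p q := by
  have h := hg.kakeya_lower_bound hN hε hε' hd hp hq hm (rectangle_ofReal_subset hmℓ) e (hm e) 0
    (by simp)
  refine le_trans (ENNReal.ofReal_le_ofReal (le_of_eq ?_)) h
  have hW : 0 < ∏ i, m i := Finset.prod_pos fun i _ => hm i
  have h1 : ∏ i, min (m i) (m e) = ∏ i, m i :=
    Finset.prod_congr rfl fun i _ => min_eq_left (he i)
  rw [h1]
  simp only [Nat.cast_zero, zero_add, Real.one_rpow, one_mul]
  rw [← Real.rpow_add hW]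
  ring_nf

/-- Knapp examples on cubes whose side tends to 0. -/
lemma IsElliptic.rwtNorm_eq_top_of_lt (hℓ : ∀ i, 0 < ℓ i) (hmono : Monotone ℓ)
    (h : d * (1 - (p⁻¹).toReal) < (d + 2) * (q⁻¹).toReal) : rwtNorm ℓ g p q = ∞ := by
  obtain ⟨r, hr, hrℓ⟩ := exists_pos_ofReal_le hd hℓ hmono
  set a := (p⁻¹).toReal
  set b := (q⁻¹).toReal
  obtain ⟨ρ, rfl⟩ : ∃ ρ, r = Real.exp ρ := ⟨_, (Real.exp_log hr).symm⟩
  refine eq_top_of_growth (s := 0) (δ := (d + 2) * b - d * (1 - a))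
    (mul_pos (kakeyaConst_pos hd) (Real.exp_pos (ρ * (d * (1 - a) - (d + 2) * b))))
    (Or.inl (by linarith)) fun n => ?_
  have h1 := hg.knapp_lower_bound hN hε hε' hd hp hq
    (m := fun _ => Real.exp (ρ - (n + 1))) (fun _ => Real.exp_pos _)
    (fun i => le_trans (ENNReal.ofReal_le_ofReal (Real.exp_le_exp.2
      (by linarith [(Nat.cast_nonneg n : (0 : ℝ) ≤ n)]))) (hrℓ i)) ⟨0, hd⟩ fun _ => le_rfl
  refine le_trans (ENNReal.ofReal_le_ofReal (le_of_eq ?_)) h1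
  rw [Real.rpow_zero, one_mul, mul_assoc, Finset.prod_const, Finset.card_univ, Fintype.card_fin,
    ← Real.exp_nat_mul, ← Real.exp_mul, ← Real.exp_mul, ← Real.exp_add, ← Real.exp_add]
  congr 2
  ring

/-- A fixed cube of half-side r with λ = r 4^(-(n+1)) and μ = n makes the bound grow like
(n+1)^(1/2-b) 4^((n+1)((2d+2)b-d)). At equality b = d/(2d+2) < 1/2, so the first factor still
diverges. -/
lemma IsElliptic.rwtNorm_eq_top_of_le (hℓ : ∀ i, 0 < ℓ i) (hmono : Monotone ℓ)
    (h : d ≤ (2 * d + 2) * (q⁻¹).toReal) : rwtNorm ℓ g p q = ∞ := by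
  obtain ⟨r, hr, hrℓ⟩ := exists_pos_ofReal_le hd hℓ hmono
  set a := (p⁻¹).toReal
  set b := (q⁻¹).toReal
  have hd' : (0 : ℝ) < d := by exact_mod_cast hd
  have hlog4 : 0 < Real.log 4 := Real.log_pos (by norm_num)
  obtain ⟨ρ, rfl⟩ : ∃ ρ, r = Real.exp ρ := ⟨_, (Real.exp_log hr).symm⟩
  refine eq_top_of_growth (s := 1 / 2 - b) (δ := Real.log 4 * ((2 * d + 2) * b - d))
    (mul_pos (kakeyaConst_pos hd) (Real.exp_pos (ρ * (d * (b - a) + d * (1 - 2 * b) - 2 * b))))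
    ?_ fun n => ?_
  · rcases h.eq_or_lt with h | h
    · refine Or.inr ⟨by rw [← h]; simp, ?_⟩
      nlinarith
    · exact Or.inl (mul_pos hlog4 (by linarith))
  · have hle : ρ - Real.log 4 * (n + 1) ≤ ρ := by
      have : 0 ≤ Real.log 4 * ((n : ℝ) + 1) := by positivity
      linarith
    have h4 : (4 : ℝ) ^ n * Real.exp (ρ - Real.log 4 * (n + 1)) ≤ Real.exp ρ := by
      have h5 : (4 : ℝ) ^ n = Real.exp (Real.log 4 * n) := by
        rw [mul_comm, Real.exp_nat_mul, Real.exp_log (by norm_num)]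
      rw [h5, ← Real.exp_add]
      refine Real.exp_le_exp.2 ?_
      linarith
    have h1 := hg.kakeya_lower_bound hN hε hε' hd hp hq
      (m := fun _ => Real.exp ρ) (fun _ => Real.exp_pos _) (rectangle_ofReal_subset hrℓ)
      ⟨0, hd⟩ (Real.exp_pos (ρ - Real.log 4 * (n + 1))) n h4
    refine le_trans (ENNReal.ofReal_le_ofReal (le_of_eq ?_)) h1
    rw [min_eq_right (Real.exp_le_exp.2 hle)]
    simp only [Finset.prod_const, Finset.card_univ, Fintype.card_fin]
    rw [← Real.exp_nat_mul, ← Real.exp_nat_mul, ← Real.exp_mul, ← Real.exp_mul, ← Real.exp_mul,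
      mul_assoc, mul_left_comm (Real.exp _), ← Real.exp_add,
      mul_assoc (_ * _) (Real.exp _), ← Real.exp_add, mul_assoc (((n : ℝ) + 1) ^ _), ← Real.exp_add]
    congr 3
    ring

/-- With λ fixed, stretching side e to r 4^(n+1) makes the volume factor contribute 4^((n+1)(b-a));
when a = b the Kakeya gain diverges. -/
lemma IsElliptic.rwtNorm_eq_top_of_side_eq_top (hℓ : ∀ i, 0 < ℓ i) (hmono : Monotone ℓ)
    {e : Fin d} (he : ℓ e = ∞) (h : (p⁻¹).toReal ≤ (q⁻¹).toReal) : rwtNorm ℓ g p q = ∞ := by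
  -- The remaining case has b < 1/2, as the Kakeya gain requires.
  rcases le_or_gt (d : ℝ) ((2 * d + 2) * (q⁻¹).toReal) with h0 | h0
  · exact hg.rwtNorm_eq_top_of_le hN hε hε' hd hp hq hℓ hmono h0
  obtain ⟨r, hr, hrℓ⟩ := exists_pos_ofReal_le hd hℓ hmono
  set a := (p⁻¹).toReal
  set b := (q⁻¹).toReal
  have hd' : (0 : ℝ) < d := by exact_mod_cast hd
  have hlog4 : 0 < Real.log 4 := Real.log_pos (by norm_num)
  obtain ⟨ρ, rfl⟩ : ∃ ρ, r = Real.exp ρ := ⟨_, (Real.exp_log hr).symm⟩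
  refine eq_top_of_growth (s := 1 / 2 - b) (δ := Real.log 4 * (b - a))
    (mul_pos (kakeyaConst_pos hd) (Real.exp_pos (ρ * (d * (b - a) + d * (1 - 2 * b) - 2 * b))))
    ?_ fun n => ?_
  · have hb : 0 < 1 / 2 - b := by nlinarith
    rcases h.eq_or_lt with h | h
    · exact Or.inr ⟨by rw [h]; simp, hb⟩
    · exact Or.inl (mul_pos hlog4 (by linarith))
  · have hpos : 0 ≤ Real.log 4 * ((n : ℝ) + 1) := by positivity
    set m : Fin d → ℝ := fun i => Real.exp ρ *
      (if i = e then Real.exp (Real.log 4 * (n + 1)) else 1) with hm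
    have hme : m e = Real.exp ρ * Real.exp (Real.log 4 * (n + 1)) := by simp [hm]
    have hge : ∀ i, Real.exp ρ ≤ m i := fun i => by
      refine le_mul_of_one_le_right (Real.exp_pos _).le ?_
      split_ifs
      · exact Real.one_le_exp hpos
      · exact le_rfl
    have h4 : (4 : ℝ) ^ n * Real.exp ρ ≤ m e := by
      have h5 : (4 : ℝ) ^ n = Real.exp (Real.log 4 * n) := by
        rw [mul_comm, Real.exp_nat_mul, Real.exp_log (by norm_num)]
      rw [h5, hme, mul_comm]
      gcongr
      linarith
    have h1 := hg.kakeya_lower_bound hN hε hε' hd hp hq (m := m)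
      (fun i => (Real.exp_pos ρ).trans_le (hge i)) (rectangle_ofReal_subset fun i => ?_)
      e (Real.exp_pos ρ) n h4
    · refine le_trans (ENNReal.ofReal_le_ofReal (le_of_eq ?_)) h1
      have hW : ∏ i, m i = Real.exp (d * ρ + Real.log 4 * (n + 1)) := by
        rw [hm, Finset.prod_mul_distrib, Finset.prod_ite_eq' Finset.univ e, Finset.prod_const,
          Finset.card_univ, Fintype.card_fin, ← Real.exp_nat_mul, if_pos (Finset.mem_univ e),
          ← Real.exp_add]
      have hP : ∏ i, min (m i) (Real.exp ρ) = Real.exp (d * ρ) := by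
        rw [Finset.prod_congr rfl fun i _ => min_eq_right (hge i), Finset.prod_const,
          Finset.card_univ, Fintype.card_fin, ← Real.exp_nat_mul]
      rw [hW, hP, ← Real.exp_mul, ← Real.exp_mul, ← Real.exp_mul,
        mul_assoc, mul_left_comm (Real.exp _), ← Real.exp_add,
        mul_assoc (_ * _) (Real.exp _), ← Real.exp_add, mul_assoc (((n : ℝ) + 1) ^ _),
        ← Real.exp_add]
      congr 3
      ring
    · by_cases hi : i = e
      · rw [hi, he]; exact le_top
      · simpa [hm, hi] using hrℓ i

/-- By monotonicity all d - k sides from index k on are infinite. Knapp examples with these sides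
equal and tending to infinity, the others fixed, see a problem in d - k dimensions. -/
lemma IsElliptic.rwtNorm_eq_top_of_partial_scaling (hℓ : ∀ i, 0 < ℓ i) (hmono : Monotone ℓ)
    {k : Fin d} (hk : ℓ k = ∞) (h : ((d : ℝ) - k + 2) * (q⁻¹).toReal <
      ((d : ℝ) - k) * (1 - (p⁻¹).toReal)) : rwtNorm ℓ g p q = ∞ := by
  obtain ⟨r, hr, hrℓ⟩ := exists_pos_ofReal_le hd hℓ hmono
  set a := (p⁻¹).toReal
  set b := (q⁻¹).toReal
  obtain ⟨ρ, rfl⟩ : ∃ ρ, r = Real.exp ρ := ⟨_, (Real.exp_log hr).symm⟩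
  refine eq_top_of_growth (s := 0) (δ := ((d : ℝ) - k) * (1 - a) - ((d : ℝ) - k + 2) * b)
    (mul_pos (kakeyaConst_pos hd) (Real.exp_pos (ρ * (d * (1 - a - b) - 2 * b))))
    (Or.inl (by linarith)) fun n => ?_
  have hn : (0 : ℝ) ≤ n + 1 := by positivity
  set m : Fin d → ℝ := fun i => if i < k then Real.exp ρ else Real.exp (ρ + (n + 1)) with hm
  have hmlt : ∀ i < k, m i = Real.exp ρ := fun i hi => by simp [hm, hi]
  have hmge : ∀ i, k ≤ i → m i = Real.exp (ρ + (n + 1)) := fun i hi => by simp [hm, not_lt.2 hi]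
  have h1 := hg.knapp_lower_bound hN hε hε' hd hp hq (m := m)
    (fun i => by simp only [hm]; split_ifs <;> positivity) (fun i => ?_) k fun i => ?_
  · refine le_trans (ENNReal.ofReal_le_ofReal (le_of_eq ?_)) h1
    have hW : ∏ i, m i = Real.exp (k * ρ + (ρ + (n + 1)) * (d - k)) := by
      rw [prod_truncate k (fun i => if i < k then Real.exp ρ else Real.exp (ρ + (n + 1))) m
        (fun i _ => rfl) (fun i hi => by simp [hm, not_lt.2 hi]),
        Finset.prod_congr rfl fun i hi => if_pos (Finset.mem_Iio.1 hi), Finset.prod_const,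
        Fin.card_Iio, if_neg (lt_irrefl k), ← Real.exp_nat_mul, ← Real.exp_mul, ← Real.exp_add]
    rw [hW, hmge k le_rfl, Real.rpow_zero, one_mul, mul_assoc, ← Real.exp_mul, ← Real.exp_mul,
      ← Real.exp_add, ← Real.exp_add]
    congr 2
    ring
  · rcases lt_or_ge i k with hi | hi
    · rw [hmlt i hi]; exact hrℓ i
    · rw [top_le_iff.1 (hk.symm.le.trans (hmono hi))]; exact le_top
  · rw [hmge k le_rfl]
    rcases lt_or_ge i k with hi | hi
    · rw [hmlt i hi]; exact Real.exp_le_exp.2 (by linarith)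
    · rw [hmge i hi]

end Consequences

/-! ### Approximation of infinite sides by finite ones -/

section Limits

variable {d : ℕ}

lemma exists_ofReal_eq_min {ℓ : Fin d → ℝ≥0∞} (hℓ : ∀ i, 0 < ℓ i) (hmono : Monotone ℓ) (n : ℕ) :
    ∃ x : Fin d → ℝ, (∀ i, 0 < x i) ∧ Monotone x ∧
      ∀ i, min (ℓ i) ((n : ℝ≥0∞) + 1) = ENNReal.ofReal (x i) := by
  have hfin : ∀ i, min (ℓ i) ((n : ℝ≥0∞) + 1) ≠ ∞ := fun i =>
    ((min_le_right _ _).trans_lt (by finiteness)).ne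
  refine ⟨fun i => (min (ℓ i) ((n : ℝ≥0∞) + 1)).toReal,
    fun i => ENNReal.toReal_pos (lt_min (hℓ i) (by positivity)).ne' (hfin i),
    fun i j hij => ENNReal.toReal_mono (hfin j) (min_le_min_right _ (hmono hij)),
    fun i => (ENNReal.ofReal_toReal (hfin i)).symm⟩

lemma tendsto_min_natCast (x : ℝ≥0∞) :
    Tendsto (fun n : ℕ => min x ((n : ℝ≥0∞) + 1)) atTop (𝓝 x) := by
  have h : Tendsto (fun n : ℕ => (n : ℝ≥0∞) + 1) atTop (𝓝 ∞) := by
    simpa using ENNReal.tendsto_nat_nhds_top.add_const 1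
  simpa using (tendsto_const_nhds (x := x)).min h

/-- Nonzero limits exclude the indeterminate product 0 · ∞, at which multiplication on `ℝ≥0∞` is
discontinuous. -/
lemma tendsto_prod_of_ne_zero {ι : Type*} (s : Finset ι) {f : ι → ℕ → ℝ≥0∞} {y : ι → ℝ≥0∞}
    (hy : ∀ i, y i ≠ 0) (hf : ∀ i, Tendsto (f i) atTop (𝓝 (y i))) :
    Tendsto (fun n => ∏ i ∈ s, f i n) atTop (𝓝 (∏ i ∈ s, y i)) := by
  classical
  induction s using Finset.induction_on with
  | empty => simp
  | insert i s hi ih =>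
    simp only [Finset.prod_insert hi]
    exact ENNReal.Tendsto.mul (hf i) (Or.inl (hy i)) ih
      (Or.inl (Finset.prod_ne_zero_iff.2 fun j _ => hy j))

lemma rpow_ne_zero_of_nonneg {x : ℝ≥0∞} (hx : 0 < x) {r : ℝ} (hr : 0 ≤ r) : x ^ r ≠ 0 := by
  simp [ENNReal.rpow_eq_zero_iff, hx.ne', not_lt.2 hr]

end Limits

/-! ### The quantitative lower bounds -/

section QuantitativeBounds

variable {d : ℕ} {N : ℕ∞} {ε₀ : ℝ} {ℓ : Fin d → ℝ≥0∞} {g : Freq d → ℝ} {p q : ℝ≥0∞}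
  (hg : IsElliptic N ε₀ ℓ g) (hN : 2 ≤ N) (hε : 0 < ε₀) (hε' : ε₀ < 1) (hd : 0 < d)
  (hp : 1 ≤ p) (hq : 1 ≤ q) (hℓ : ∀ i, 0 < ℓ i) (hmono : Monotone ℓ)

include hg hN hε hε' hd hp hq hℓ hmono

/-- Knapp on the box whose sides after j are cut down to the j-th one, the sides being first
truncated at n + 1. The hypothesis says that the total power of the j-th side is θ times the common
exponent. -/
lemma IsElliptic.scaling_lower_bound (j : Fin d) {θ : ℝ} (hθ : 0 ≤ θ)
    (h : ((d : ℝ) - j) * (1 - (p⁻¹).toReal - (q⁻¹).toReal) - 2 * (q⁻¹).toReal =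
      θ * (1 - (p⁻¹).toReal - (q⁻¹).toReal)) :
    ENNReal.ofReal (kakeyaConst d) * ((∏ i ∈ Finset.Iio j, ℓ i) * ℓ j ^ θ) ^
      (1 - (p⁻¹).toReal - (q⁻¹).toReal) ≤ rwtNorm ℓ g p q := by
  set γ := 1 - (p⁻¹).toReal - (q⁻¹).toReal
  set b := (q⁻¹).toReal
  have hlim : Tendsto (fun n : ℕ => ENNReal.ofReal (kakeyaConst d) *
      ((∏ i ∈ Finset.Iio j, min (ℓ i) ((n : ℝ≥0∞) + 1)) * min (ℓ j) ((n : ℝ≥0∞) + 1) ^ θ) ^ γ)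
      atTop (𝓝 (ENNReal.ofReal (kakeyaConst d) *
        ((∏ i ∈ Finset.Iio j, ℓ i) * ℓ j ^ θ) ^ γ)) := by
    refine ENNReal.Tendsto.const_mul ?_ (Or.inr ENNReal.ofReal_ne_top)
    refine Tendsto.ennrpow_const _ (ENNReal.Tendsto.mul
      (tendsto_prod_of_ne_zero _ (fun i => (hℓ i).ne') fun i => tendsto_min_natCast _)
      (Or.inl (Finset.prod_ne_zero_iff.2 fun i _ => (hℓ i).ne'))
      ((tendsto_min_natCast _).ennrpow_const _)
      (Or.inl (rpow_ne_zero_of_nonneg (hℓ j) hθ)))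
  refine le_of_tendsto' hlim fun n => ?_
  obtain ⟨x, hx, hxm, hxℓ⟩ := exists_ofReal_eq_min hℓ hmono n
  have hxle : ∀ i, ENNReal.ofReal (x i) ≤ ℓ i := fun i => (hxℓ i).symm.le.trans (min_le_left _ _)
  set m : Fin d → ℝ := fun i => x (min i j) with hm
  have hmj : m j = x j := by simp [hm]
  have h1 := hg.knapp_lower_bound hN hε hε' hd hp hq (m := m) (fun i => hx _)
    (fun i => (hxle _).trans (hmono (min_le_left _ _))) j
    fun i => by rw [hmj]; exact hxm (min_le_right _ _)
  have hQ : 0 < ∏ i ∈ Finset.Iio j, x i := Finset.prod_pos fun i _ => hx i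
  have hW : ∏ i, m i = (∏ i ∈ Finset.Iio j, x i) * x j ^ ((d : ℝ) - j) :=
    prod_truncate j x m (fun i hi => by simp [hm, min_eq_left hi.le])
      (fun i hi => by simp [hm, min_eq_right hi])
  simp_rw [hxℓ]
  rw [← ENNReal.ofReal_prod_of_nonneg fun i _ => (hx i).le, ENNReal.ofReal_rpow_of_pos (hx j),
    ← ENNReal.ofReal_mul hQ.le,
    ENNReal.ofReal_rpow_of_pos (mul_pos hQ (Real.rpow_pos_of_pos (hx j) _)),
    ← ENNReal.ofReal_mul (kakeyaConst_pos hd).le]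
  refine le_trans (ENNReal.ofReal_le_ofReal (le_of_eq ?_)) h1
  rw [hmj, hW, Real.mul_rpow hQ.le (Real.rpow_nonneg (hx j).le _),
    Real.mul_rpow hQ.le (Real.rpow_nonneg (hx j).le _), ← Real.rpow_mul (hx j).le,
    ← Real.rpow_mul (hx j).le, mul_assoc ((∏ i ∈ Finset.Iio j, x i) ^ γ),
    ← Real.rpow_add (hx j)]
  congr 3
  linarith

/-- Knapp on the whole truncated box. The sign conditions keep both factors nonzero, so the limit
passes through their product even for infinite sides. -/
lemma IsElliptic.last_side_lower_bound (e : Fin d) (he : ∀ i, i ≤ e)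
    (hγ : 0 ≤ 1 - (p⁻¹).toReal - (q⁻¹).toReal)
    (h : 0 ≤ 1 - 3 * (q⁻¹).toReal - (p⁻¹).toReal) :
    ENNReal.ofReal (kakeyaConst d) * ((∏ i ∈ Finset.Iio e, ℓ i) ^
      (1 - (p⁻¹).toReal - (q⁻¹).toReal) * ℓ e ^ (1 - 3 * (q⁻¹).toReal - (p⁻¹).toReal)) ≤
      rwtNorm ℓ g p q := by
  set γ := 1 - (p⁻¹).toReal - (q⁻¹).toReal
  set b := (q⁻¹).toReal
  have hprod : 0 < ∏ i ∈ Finset.Iio e, ℓ i :=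
    pos_iff_ne_zero.2 (Finset.prod_ne_zero_iff.2 fun i _ => (hℓ i).ne')
  have hlim : Tendsto (fun n : ℕ => ENNReal.ofReal (kakeyaConst d) *
      ((∏ i ∈ Finset.Iio e, min (ℓ i) ((n : ℝ≥0∞) + 1)) ^ γ *
        min (ℓ e) ((n : ℝ≥0∞) + 1) ^ (1 - 3 * b - (p⁻¹).toReal)))
      atTop (𝓝 (ENNReal.ofReal (kakeyaConst d) *
        ((∏ i ∈ Finset.Iio e, ℓ i) ^ γ * ℓ e ^ (1 - 3 * b - (p⁻¹).toReal)))) := by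
    refine ENNReal.Tendsto.const_mul ?_ (Or.inr ENNReal.ofReal_ne_top)
    exact ENNReal.Tendsto.mul
      ((tendsto_prod_of_ne_zero _ (fun i => (hℓ i).ne') fun i =>
        tendsto_min_natCast _).ennrpow_const _)
      (Or.inl (rpow_ne_zero_of_nonneg hprod hγ))
      ((tendsto_min_natCast _).ennrpow_const _)
      (Or.inl (rpow_ne_zero_of_nonneg (hℓ e) h))
  refine le_of_tendsto' hlim fun n => ?_
  obtain ⟨x, hx, hxm, hxℓ⟩ := exists_ofReal_eq_min hℓ hmono n
  have h1 := hg.knapp_lower_bound hN hε hε' hd hp hq (m := x) hx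
    (fun i => (hxℓ i).symm.le.trans (min_le_left _ _)) e fun i => hxm (he i)
  have hQ : 0 < ∏ i ∈ Finset.Iio e, x i := Finset.prod_pos fun i _ => hx i
  have hIci : Finset.Ici e = {e} := by
    ext i
    simp only [Finset.mem_Ici, Finset.mem_singleton]
    exact ⟨fun hi => le_antisymm (he i) hi, fun hi => hi.symm.le⟩
  have hW : ∏ i, x i = (∏ i ∈ Finset.Iio e, x i) * x e := by
    rw [← prod_Iio_mul_prod_Ici e, hIci, Finset.prod_singleton]
  simp_rw [hxℓ]
  rw [← ENNReal.ofReal_prod_of_nonneg fun i _ => (hx i).le, ENNReal.ofReal_rpow_of_pos (hx e),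
    ENNReal.ofReal_rpow_of_pos hQ, ← ENNReal.ofReal_mul (Real.rpow_nonneg hQ.le _),
    ← ENNReal.ofReal_mul (kakeyaConst_pos hd).le]
  refine le_trans (ENNReal.ofReal_le_ofReal (le_of_eq ?_)) h1
  rw [hW, Real.mul_rpow hQ.le (hx e).le, mul_assoc ((∏ i ∈ Finset.Iio e, x i) ^ γ),
    ← Real.rpow_add (hx e)]
  congr 3
  change _ = 1 - (p⁻¹).toReal - b + -2 * b
  ring

/-- The Kakeya bound on the full box at scale λ = ℓ_j: cells keep the sides before j and are cut to
ℓ_j afterwards, and the ratio ℓ_e/ℓ_j determines how many generations of compression fit. -/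
lemma IsElliptic.diagonal_lower_bound (j e : Fin d) (hfin : ∀ i, ℓ i ≠ ∞) {θ : ℝ}
    (h : ((d : ℝ) - j) * (1 - 2 * (q⁻¹).toReal) - 2 * (q⁻¹).toReal =
      θ * (1 - 2 * (q⁻¹).toReal)) (μ : ℕ) (hμ : (4 : ℝ≥0∞) ^ μ ≤ ℓ e / ℓ j) :
    (∏ i, ℓ i) ^ ((q⁻¹).toReal - (p⁻¹).toReal) *
      ENNReal.ofReal (kakeyaConst d * ((μ : ℝ) + 1) ^ (1 / 2 - (q⁻¹).toReal)) *
      ((∏ i ∈ Finset.Iio j, ℓ i) * ℓ j ^ θ) ^ (1 - 2 * (q⁻¹).toReal) ≤ rwtNorm ℓ g p q := by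
  set a := (p⁻¹).toReal
  set b := (q⁻¹).toReal
  set x : Fin d → ℝ := fun i => (ℓ i).toReal with hxdef
  have hx : ∀ i, 0 < x i := fun i => ENNReal.toReal_pos (hℓ i).ne' (hfin i)
  have hxℓ : ∀ i, ℓ i = ENNReal.ofReal (x i) := fun i => (ENNReal.ofReal_toReal (hfin i)).symm
  have hxm : Monotone x := fun i k hik => ENNReal.toReal_mono (hfin k) (hmono hik)
  have h4 : 4 ^ μ * x j ≤ x e := by
    rw [ENNReal.le_div_iff_mul_le (Or.inl (hℓ j).ne') (Or.inl (hfin j))] at hμ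
    have := ENNReal.toReal_mono (hfin e) hμ
    simpa using this
  have h1 := hg.kakeya_lower_bound hN hε hε' hd hp hq hx
    (rectangle_ofReal_subset fun i => (hxℓ i).symm.le) e (hx j) μ h4
  have hQ : 0 < ∏ i ∈ Finset.Iio j, x i := Finset.prod_pos fun i _ => hx i
  have hW : 0 < ∏ i, x i := Finset.prod_pos fun i _ => hx i
  have hP : ∏ i, min (x i) (x j) = (∏ i ∈ Finset.Iio j, x i) * x j ^ ((d : ℝ) - j) :=
    prod_truncate j x _ (fun i hi => min_eq_left (hxm hi.le))
      (fun i hi => min_eq_right (hxm hi))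
  have hθ := Real.rpow_pos_of_pos (hx j) θ
  simp_rw [hxℓ]
  rw [← ENNReal.ofReal_prod_of_nonneg fun i _ => (hx i).le,
    ← ENNReal.ofReal_prod_of_nonneg fun i _ => (hx i).le, ENNReal.ofReal_rpow_of_pos (hx j),
    ← ENNReal.ofReal_mul hQ.le, ENNReal.ofReal_rpow_of_pos hW,
    ENNReal.ofReal_rpow_of_pos (mul_pos hQ hθ), ← ENNReal.ofReal_mul (by positivity),
    ← ENNReal.ofReal_mul (by have := kakeyaConst_pos hd; positivity)]
  refine le_trans (ENNReal.ofReal_le_ofReal (le_of_eq ?_)) h1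
  rw [hP, Real.mul_rpow hQ.le hθ.le, Real.mul_rpow hQ.le (Real.rpow_nonneg (hx j).le _),
    ← Real.rpow_mul (hx j).le, ← Real.rpow_mul (hx j).le, ← h, sub_eq_add_neg (_ * _),
    Real.rpow_add (hx j), ← neg_mul]
  ring

end QuantitativeBounds

/-! ### The function α -/

section GrowthFunction

/-- The growth function of the endpoint lower bound. -/
noncomputable def growthFn (d : ℕ) (e : ℝ) (r : ℝ≥0∞) : ℝ≥0∞ :=
  max (ENNReal.ofReal (kakeyaConst d)) (⨆ (μ : ℕ) (_ : (4 : ℝ≥0∞) ^ μ ≤ r),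
    ENNReal.ofReal (kakeyaConst d * ((μ : ℝ) + 1) ^ e))

lemma tendsto_growthFn {d : ℕ} (hd : 0 < d) {e : ℝ} (he : 0 < e) :
    Tendsto (growthFn d e) (𝓝 ∞) (𝓝 ∞) := by
  rw [ENNReal.tendsto_nhds_top_iff_nnreal]
  intro x
  have h1 : Tendsto (fun n : ℕ => kakeyaConst d * ((n : ℝ) + 1) ^ e) atTop atTop :=
    ((tendsto_rpow_atTop he).comp (tendsto_atTop_add_const_right _ _
      tendsto_natCast_atTop_atTop)).const_mul_atTop (kakeyaConst_pos hd)
  obtain ⟨μ, hμ⟩ := (h1.eventually_gt_atTop (x : ℝ)).exists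
  have h4 : ((4 : ℝ≥0∞) ^ μ) < ∞ := by finiteness
  filter_upwards [lt_mem_nhds h4] with r hr
  refine lt_of_lt_of_le ?_ (le_max_of_le_right (le_iSup₂_of_le μ hr.le le_rfl))
  rw [ENNReal.lt_ofReal_iff_toReal_lt ENNReal.coe_ne_top]
  exact hμ

/-- For r ≥ 1 the index μ = 0 already supplies the floor; the maximum matters only for r < 1, where
the supremum is empty. -/
lemma growthFn_eq_iSup {d : ℕ} {e : ℝ} {r : ℝ≥0∞} (hr : 1 ≤ r) :
    growthFn d e r = ⨆ (μ : ℕ) (_ : (4 : ℝ≥0∞) ^ μ ≤ r),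
      ENNReal.ofReal (kakeyaConst d * ((μ : ℝ) + 1) ^ e) :=
  max_eq_right (le_iSup₂_of_le 0 (by simpa using hr) (by simp))

end GrowthFunction

end RestrictionAboveRectangles

/-! ### Assembly of the theorem -/

theorem theorem1p5 (d : ℕ) (hd : 1 ≤ d) (p q : ℝ≥0∞) [Fact (1 ≤ p)] [Fact (1 ≤ q)] :
    -- the constant `c` and the function `α` depend on `d, p, q` only
    ∃ (c : ℝ≥0) (α : ℝ≥0∞ → ℝ≥0∞), 0 < c ∧ (∀ r, (c : ℝ≥0∞) ≤ α r) ∧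
      Tendsto α (𝓝 ∞) (𝓝 ∞) ∧
    ∀ (N : ℕ∞) (ε₀ : ℝ) (ℓ : Fin d → ℝ≥0∞) (g : RestrictionAboveRectangles.Freq d → ℝ),
      2 ≤ N → 0 < ε₀ → ε₀ < 1 → (∀ i, 0 < ℓ i) → Monotone ℓ →
      RestrictionAboveRectangles.IsElliptic N ε₀ ℓ g →
      -- unboundedness outside the conjectured region, and for infinite side lengths
      -- (`k : Fin d` is the index `k + 1` in one-based counting)
      ((q < ENNReal.ofReal ((d + 2) / d) * p.conjExponent ∨
          q ≤ ENNReal.ofReal (2 * (d + 1) / d) ∨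
          ∃ k : Fin d, ℓ k = ∞ ∧
            (q ≤ p ∨ ENNReal.ofReal (((d : ℝ) - (k + 1) + 3) / ((d : ℝ) - (k + 1) + 1)) *
              p.conjExponent < q)) →
        ¬ RestrictionAboveRectangles.ExtendsBoundedly ℓ g p q ∧
        RestrictionAboveRectangles.strongNorm ℓ g p q = ∞ ∧
        RestrictionAboveRectangles.rwtNorm ℓ g p q = ∞) ∧
      -- quantitative lower bounds, for the operator norm and the restricted weak type norm
      ∀ K ∈ ({RestrictionAboveRectangles.strongNorm ℓ g p q,
          RestrictionAboveRectangles.rwtNorm ℓ g p q} : Set ℝ≥0∞),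
        (∀ (j : Fin d) (θ : ℝ), 0 ≤ θ → θ ≤ 1 → p < q →
          q = ENNReal.ofReal ((d : ℝ) - j - θ + 2) / ENNReal.ofReal ((d : ℝ) - j - θ) *
            p.conjExponent →
          (c : ℝ≥0∞) * ((∏ i ∈ Finset.Iio j, ℓ i) * ℓ j ^ θ) ^
            (((p.conjExponent)⁻¹).toReal - (q⁻¹).toReal) ≤ K) ∧
        (∀ (j : Fin d) (θ : ℝ), (j : ℕ) + 2 ≤ d → 0 < θ → θ ≤ 1 → q ≤ p →
          q = ENNReal.ofReal (2 * ((d : ℝ) - j - θ + 1)) / ENNReal.ofReal ((d : ℝ) - j - θ) →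
          (∏ i, ℓ i) ^ ((q⁻¹).toReal - (p⁻¹).toReal) * α (ℓ ⟨d - 1, by omega⟩ / ℓ j) *
            ((∏ i ∈ Finset.Iio j, ℓ i) * ℓ j ^ θ) ^ (1 - 2 * (q⁻¹).toReal) ≤ K) ∧
        (4 < q → (q / 3).conjExponent ≤ p →
          (c : ℝ≥0∞) * ((∏ i ∈ Finset.Iio (⟨d - 1, by omega⟩ : Fin d), ℓ i) ^
              (((p.conjExponent)⁻¹).toReal - (q⁻¹).toReal) *
            ℓ ⟨d - 1, by omega⟩ ^ (1 - 3 * (q⁻¹).toReal - (p⁻¹).toReal)) ≤ K) := by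
  have hd0 : 0 < d := hd
  have hp : 1 ≤ p := Fact.out
  have hq : 1 ≤ q := Fact.out
  have hd' : (0 : ℝ) < d := by exact_mod_cast hd0
  -- The bound involving α forces 1/q < 1/2. The value 1 otherwise only ensures that α tends to
  -- infinity for every q.
  set ν : ℝ := if (q⁻¹).toReal < 1 / 2 then 1 / 2 - (q⁻¹).toReal else 1 with hν
  have hν0 : 0 < ν := by
    rw [hν]; split_ifs with h
    · linarith
    · exact one_pos
  refine ⟨(RestrictionAboveRectangles.kakeyaConst d).toNNReal,
    RestrictionAboveRectangles.growthFn d ν,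
    Real.toNNReal_pos.2 (RestrictionAboveRectangles.kakeyaConst_pos hd0), fun r => le_max_left _ _,
    RestrictionAboveRectangles.tendsto_growthFn hd0 hν0, ?_⟩
  intro N ε₀ ℓ g hN hε hε' hℓ hmono hg
  have hgc : ContinuousOn g (RestrictionAboveRectangles.rectangle ℓ) := hg.contDiffOn.continuousOn
  have hstrong := RestrictionAboveRectangles.rwtNorm_le_strongNorm hgc (p := p) hq
  have htop : (q < ENNReal.ofReal ((d + 2) / d) * p.conjExponent ∨
          q ≤ ENNReal.ofReal (2 * (d + 1) / d) ∨
          ∃ k : Fin d, ℓ k = ∞ ∧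
            (q ≤ p ∨ ENNReal.ofReal (((d : ℝ) - (k + 1) + 3) / ((d : ℝ) - (k + 1) + 1)) *
              p.conjExponent < q)) → RestrictionAboveRectangles.rwtNorm ℓ g p q = ∞ := by
    rintro (h | h | ⟨k, hk, h | h⟩)
    · refine hg.rwtNorm_eq_top_of_lt hN hε hε' hd0 hp hq hℓ hmono ?_
      have h1 := RestrictionAboveRectangles.lt_mul_inv_of_lt_ofReal_mul_conjExponent hp hq
        (by positivity) h
      rw [div_mul_eq_mul_div, lt_div_iff₀ hd'] at h1
      linarith
    · refine hg.rwtNorm_eq_top_of_le hN hε hε' hd0 hp hq hℓ hmono ?_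
      have h1 := RestrictionAboveRectangles.inv_le_toReal_inv_of_le_ofReal hq (by positivity) h
      rw [inv_div, div_le_iff₀ (by positivity)] at h1
      linarith
    · exact hg.rwtNorm_eq_top_of_side_eq_top hN hε hε' hd0 hp hq hℓ hmono hk
        (RestrictionAboveRectangles.toReal_inv_anti hq h)
    · refine hg.rwtNorm_eq_top_of_partial_scaling hN hε hε' hd0 hp hq hℓ hmono hk ?_
      have hdk : (0 : ℝ) < (d : ℝ) - k := sub_pos.2 (by exact_mod_cast k.2)
      have h0 : ((d : ℝ) - (k + 1) + 3) / ((d : ℝ) - (k + 1) + 1) =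
          ((d : ℝ) - k + 2) / ((d : ℝ) - k) := by congr 1 <;> ring
      rw [h0] at h
      have h1 := RestrictionAboveRectangles.mul_inv_lt_of_ofReal_mul_conjExponent_lt hp hq
        (by positivity) h
      rw [div_mul_eq_mul_div, div_lt_iff₀ hdk] at h1
      linarith
  refine ⟨fun h => ?_, ?_⟩
  · have h1 := htop h
    have h2 : RestrictionAboveRectangles.strongNorm ℓ g p q = ∞ := top_le_iff.1 (h1 ▸ hstrong)
    exact ⟨fun hT => (RestrictionAboveRectangles.strongNorm_lt_top_of_extendsBoundedly hT).ne h2,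
      h2, h1⟩
  intro K hK
  have hrK : RestrictionAboveRectangles.rwtNorm ℓ g p q ≤ K := by
    rcases hK with rfl | rfl
    · exact hstrong
    · exact le_rfl
  obtain ⟨ha0, ha1⟩ := RestrictionAboveRectangles.inv_toReal_mem hp
  obtain ⟨hb0, hb1⟩ := RestrictionAboveRectangles.inv_toReal_mem hq
  rw [RestrictionAboveRectangles.inv_conjExponent_toReal hp]
  refine ⟨fun j θ hθ0 hθ1 _ hqs => ?_, fun j θ hj hθ0 hθ1 hqp hqs => ?_, fun h4 h3 => ?_⟩
  · have hjd : (j : ℝ) + 1 ≤ d := by exact_mod_cast j.2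
    have h1 := RestrictionAboveRectangles.scaling_relation hp (s := (d : ℝ) - j - θ)
      (by linarith) hqs
    refine (hg.scaling_lower_bound hN hε hε' hd0 hp hq hℓ hmono j hθ0 ?_).trans hrK
    linarith
  · have hjd : (j : ℝ) + 2 ≤ d := by exact_mod_cast hj
    have hs : 0 < (d : ℝ) - j - θ := by linarith
    have h1 := RestrictionAboveRectangles.diagonal_relation hs hqs
    have h2 : (q⁻¹).toReal < 1 / 2 := by
      rw [h1, div_lt_div_iff₀ (by linarith) (by norm_num)]
      linarith
    rw [eq_div_iff (by linarith)] at h1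
    by_cases hfin : ∀ i, ℓ i ≠ ∞
    · have hr : 1 ≤ ℓ ⟨d - 1, by omega⟩ / ℓ j := by
        rw [ENNReal.le_div_iff_mul_le (Or.inl (hℓ j).ne') (Or.inl (hfin j)), one_mul]
        exact hmono (Nat.le_sub_one_of_lt j.2)
      rw [RestrictionAboveRectangles.growthFn_eq_iSup hr]
      simp only [ENNReal.mul_iSup, ENNReal.iSup_mul]
      refine iSup₂_le fun μ hμ => le_trans ?_ hrK
      rw [hν, if_pos h2]
      refine hg.diagonal_lower_bound hN hε hε' hd0 hp hq hℓ hmono j _ hfin ?_ μ hμ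
      linarith
    -- With an infinite side and q ≤ p the norm is infinite by part 2, so no reading of ∞/∞ matters.
    · push Not at hfin
      obtain ⟨k, hk⟩ := hfin
      have h3 := htop (Or.inr (Or.inr ⟨k, hk, Or.inl hqp⟩))
      have hKtop : K = ∞ := top_le_iff.1 (h3 ▸ hrK)
      rw [hKtop]
      exact le_top
  · have h1 := RestrictionAboveRectangles.three_mul_inv_le h4 h3
    exact (hg.last_side_lower_bound hN hε hε' hd0 hp hq hℓ hmono _
      (fun i => Nat.le_sub_one_of_lt i.2) (by linarith) (by linarith)).trans hrK
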